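/- **Setting.** Let $C^\infty(S^{1|2})$ be the space of functions $f=f_0+\xi_1f_1+\xi_2f_2+\xi_1\xi_2f_{12}$ with $f_0,f_1,f_2,f_{12}\in C^\infty(S^1,\mathbb C)$, $x=e^{i\theta}$ the coordinate on $S^1$ and $\xi_1,\xi_2$ odd anticommuting variables. Put $\overline D_i=\partial_{\xi_i}-\xi_i\partial_x$ $(i=1,2)$ and, for homogeneous $f$, $$X_f=f\partial_x-(-1)^{p(f)}\tfrac12\big(\overline D_1(f)\overline D_1+\overline D_2(f)\overline D_2\big),\qquad L^\lambda_{X_f}=X_f+\lambda f' ,$$ extended linearly in $f$. The Lie superalgebra $\mathrm{osp}(2|2)$ is spanned by the $X_f$ with $f\in\{1,\xi_1,\xi_2,x,\xi_1\xi_2,x\xi_1,x\xi_2,x^2\}$. For $k\in\frac12\mathbb Z_{\ge0}$ let $\mathcal D^k_{\lambda\mu}$ be the space of operators $\sum a_{\ell,m,n}\partial_x^\ell\overline D_1^m\overline D_2^n$ with $m,n\le1$ and $\ell+\frac m2+\frac n2\le k$ (contact order at most $k$), with the action $A\mapsto L^\mu_{X_f}A-(-1)^{p(f)p(A)}A\,L^\lambda_{X_f}$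 of $X_f$, and let $\mathcal D_{\lambda\mu}=\bigcup_k\mathcal D^k_{\lambda\mu}$. The space of symbols is $\mathcal S_{\mu-\lambda}=\bigoplus_k\mathcal D^k_{\lambda\mu}/\mathcal D^{k-1/2}_{\lambda\mu}$ (with $\mathcal D^{-1/2}_{\lambda\mu}=0$), with the induced action. For $K\in\mathbb Z_{\ge 0}$, a symbol $(F_1,F_2)$ of contact order $K$ is the class of $F_1\partial_x^K+F_2\partial_x^{K-1}\overline D_1\overline D_2$ (for $K=0$ the second term is absent), and a symbol $(F_1,F_2)$ of contact order $K+\frac12$ is the class of $F_1\partial_x^K\overline D_1+F_2\partial_x^K\overline D_2$. A quantization map is a linear bijection $Q:\mathcal S_{\mu-\lambda}\to\mathcal D_{\lambda\mu}$ that maps each symbol of contact order $k$ to an operator of contact order at most $k$ with this principal symbol. **Theorem.** Let $\lambda,\mu\in\mathbb C$ with $\mu-\lambda\notin\{0,\frac12,1,\frac32,2,\dots\}$. Then there is exactly one $\mathrm{osp}(2|2)$-equivariant quantization map $Q$. Write $\delta=\mu-\lambda$ and $\binom zm=\frac{z(z-1)\cdots(z-m+1)}{m!}$, with $\binom zm=0$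 for $m<0$. Let $F_1,F_2$ be homogeneous of the same parity $p$, and let the contact order be $k/2$, with $k=2K$ or $k=2K+1$. Then $$Q(F_1,F_2)=\sum_{n=0}^{k}\frac{\binom{[k/2]}{[(2n+1+(-1)^k)/4]}\binom{[(k-1)/2]+2\lambda}{[(2n+1-(-1)^k)/4]}}{\binom{k-2\delta}{[(n+1)/2]}}\;DIV^n(F_1,F_2)\,div^{k-n},$$ where the product of a pair of functions $(G_1,G_2)$ and a pair of operators $(d_1,d_2)$ is $G_1d_1+G_2d_2$, terms with a negative power of $\partial_x$ are absent, and, with $q=[n/2]$: * for $k=2K$, $n=2q+1$: $DIV^n=(-1)^{p+1}\Big(\tfrac{K+2\lambda}{K}\partial_x^q\overline D_2F_2+\partial_x^q\overline D_1F_1,\ \ \partial_x^q\overline D_2F_1-\tfrac{K+2\lambda}{K}\partial_x^q\overline D_1F_2\Big)$ and $div^{k-n}=\big(\partial_x^{K-q-1}\overline D_1,\ \partial_x^{K-q-1}\overline D_2\big)$; * for $k=2K$, $n=2q$: $DIV^n=\Big(\partial_x^qF_1-\tfrac{(K+2\lambda)q}{K(2\delta+q-2K)}\partial_x^{q-1}\overline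 D_1\overline D_2F_2,\ \ \tfrac{(K+2\lambda)(K-q)}{K(K-q+2\lambda)}\partial_x^qF_2+\tfrac{q(K-q)}{(2\delta+q-2K)(K-q+2\lambda)}\partial_x^{q-1}\overline D_1\overline D_2F_1\Big)$ and $div^{k-n}=\big(\partial_x^{K-q},\ \partial_x^{K-q-1}\overline D_1\overline D_2\big)$; * for $k=2K+1$, $n=2q+1$: $DIV^n=(-1)^p\tfrac{2\delta-(2K+1)}{2\delta-2K}\Big(\partial_x^q\overline D_2F_2+\partial_x^q\overline D_1F_1,\ \ \tfrac{K-q}{K-q+2\lambda}\big(\partial_x^q\overline D_2F_1-\partial_x^q\overline D_1F_2\big)\Big)$ and $div^{k-n}=\big(\partial_x^{K-q},\ \partial_x^{K-q-1}\overline D_1\overline D_2\big)$; * for $k=2K+1$, $n=2q$: $DIV^n=\tfrac{2\delta-(2K+1)}{2\delta-2K}\Big(\tfrac{2\delta+q-2K}{2\delta+q-(2K+1)}\partial_x^qF_1-\tfrac{q}{2\delta+q-(2K+1)}\partial_x^{q-1}\overline D_1\overline D_2F_2,\ \ \tfrac{2\delta+q-2K}{2\delta+q-(2K+1)}\partial_x^qF_2+\tfrac{q}{2\delta+q-(2K+1)}\partial_x^{q-1}\overline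 D_1\overline D_2F_1\Big)$ and $div^{k-n}=\big(\partial_x^{K-q}\overline D_1,\ \partial_x^{K-q}\overline D_2\big)$. This holds as written if $K-q+2\lambda\ne0$ for all $0\le q\le K$ and, when $k=2K$, $K\geq 1$. In general the factors $K$ and $K-q+2\lambda$ of the denominators cancel against the binomial coefficients, and the formula holds for all $\lambda$ and all $K\ge0$ after this cancellation, that is, in the following form. * For $k=2K$, with $N=2K-2\delta$, $$\begin{aligned}Q(F_1,F_2)=\sum_{q=0}^{K}\Big[&\Big(\tfrac{\binom Kq\binom{K-1+2\lambda}{q}}{\binom Nq}\partial_x^qF_1+\tfrac{\binom{K-1}{q-1}\binom{K+2\lambda}{q+1}}{\binom N{q+1}}\partial_x^{q-1}\overline D_1\overline D_2F_2\Big)\partial_x^{K-q}\\&+\Big(\tfrac{\binom{K-1}q\binom{K+2\lambda}{q}}{\binom Nq}\partial_x^qF_2-\tfrac{\binom K{q+1}\binom{K-1+2\lambda}{q-1}}{\binom N{q+1}}\partial_x^{q-1}\overline D_1\overline D_2F_1\Big)\partial_x^{K-q-1}\overline D_1\overline D_2\\&+(-1)^{p+1}\Big(u_q\,\partial_x^q\overline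 D_1F_1+v_q\,\partial_x^q\overline D_2F_2\Big)\partial_x^{K-q-1}\overline D_1+(-1)^{p+1}\Big(u_q\,\partial_x^q\overline D_2F_1-v_q\,\partial_x^q\overline D_1F_2\Big)\partial_x^{K-q-1}\overline D_2\Big],\end{aligned}$$ where $u_q=\binom K{q+1}\binom{K-1+2\lambda}q/\binom N{q+1}$ and $v_q=\binom{K-1}q\binom{K+2\lambda}{q+1}/\binom N{q+1}$. * For $k=2K+1$, with $N=2K+1-2\delta$ and $r=\frac N{N-1}$, $$\begin{aligned}Q(F_1,F_2)=\sum_{q=0}^{K}\Big[&\tfrac{r\binom Kq\binom{K+2\lambda}q}{\binom Nq}\Big(\tfrac{N-q-1}{N-q}\partial_x^qF_1+\tfrac q{N-q}\partial_x^{q-1}\overline D_1\overline D_2F_2\Big)\partial_x^{K-q}\overline D_1\\&+\tfrac{r\binom Kq\binom{K+2\lambda}q}{\binom Nq}\Big(\tfrac{N-q-1}{N-q}\partial_x^qF_2-\tfrac q{N-q}\partial_x^{q-1}\overline D_1\overline D_2F_1\Big)\partial_x^{K-q}\overline D_2\\&+(-1)^p\tfrac{r\binom Kq\binom{K+2\lambda}{q+1}}{\binom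 N{q+1}}\big(\partial_x^q\overline D_1F_1+\partial_x^q\overline D_2F_2\big)\partial_x^{K-q}\\&+(-1)^p\tfrac{r\binom K{q+1}\binom{K+2\lambda}q}{\binom N{q+1}}\big(\partial_x^q\overline D_2F_1-\partial_x^q\overline D_1F_2\big)\partial_x^{K-q-1}\overline D_1\overline D_2\Big].\end{aligned}$$ -/

import Mathlib

open scoped ContDiff

noncomputable section

namespace SuperCircle

/-! ### Functions on the circle and on the supercircle -/

/-- The algebra of smooth complex-valued functions on the circle, realised as the smooth
`2π`-periodic functions of the angle `θ`. -/
def circleAlgebra : Subalgebra ℂ (ℝ → ℂ) where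
  carrier := {f | ContDiff ℝ ∞ f ∧ Function.Periodic f (2 * Real.pi)}
  mul_mem' := fun hf hg => ⟨hf.1.mul hg.1, hf.2.mul hg.2⟩
  add_mem' := fun hf hg => ⟨hf.1.add hg.1, hf.2.add hg.2⟩
  algebraMap_mem' := fun _ => ⟨contDiff_const, fun _ => rfl⟩

/-- Smooth complex-valued functions on the circle. -/
def CircleFun : Type := circleAlgebra

instance : CommRing CircleFun := inferInstanceAs (CommRing circleAlgebra)

instance : Algebra ℂ CircleFun := inferInstanceAs (Algebra ℂ circleAlgebra)

/-- The coordinate `x = e^{iθ}` on the circle. -/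
def coordX : CircleFun :=
  ⟨fun θ => Complex.exp (Complex.I * θ), by
    refine ⟨?_, fun θ => ?_⟩
    · have h : ContDiff ℝ ∞ (fun θ : ℝ => Complex.I * (θ : ℂ)) :=
        contDiff_const.mul Complex.ofRealCLM.contDiff
      exact h.cexp
    · have h : Complex.I * ((θ + 2 * Real.pi : ℝ) : ℂ)
          = Complex.I * θ + 2 * Real.pi * Complex.I := by push_cast; ring
      change Complex.exp _ = Complex.exp _
      rw [h]
      exact Complex.exp_periodic _⟩

/-- The vector field `∂ₓ = (i x)⁻¹ d/dθ` on the circle, where `x = e^{iθ}`. -/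
def partialX : Derivation ℂ CircleFun CircleFun :=
  Derivation.mk'
    { toFun := fun f =>
        ⟨fun θ => deriv f.1 θ / (Complex.I * Complex.exp (Complex.I * θ)), by
          refine ⟨?_, fun θ => ?_⟩
          · have h1 : ContDiff ℝ ∞ (deriv f.1) := ((contDiff_infty_iff_deriv (𝕜 := ℝ)).1 f.2.1).2
            have hx : ContDiff ℝ ∞ (fun θ : ℝ => Complex.exp (Complex.I * θ)) := coordX.2.1
            have h2 : ContDiff ℝ ∞ (fun θ : ℝ => Complex.I * Complex.exp (Complex.I * θ)) :=
              contDiff_const.mul hx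
            simp only [div_eq_mul_inv]
            exact h1.mul (h2.inv fun θ => mul_ne_zero Complex.I_ne_zero (Complex.exp_ne_zero _))
          · have h1 : deriv f.1 (θ + 2 * Real.pi) = deriv f.1 θ := by
              have h := deriv_comp_add_const f.1 (2 * Real.pi) θ
              rw [← h]
              exact congrArg (fun g => deriv g θ) (funext f.2.2)
            have h2 := coordX.2.2 θ
            change Complex.exp _ = Complex.exp _ at h2
            change _ / _ = _ / _
            rw [h1, h2]⟩
      map_add' := fun f g => by
        apply Subtype.ext
        funext θ
        have hf := (f.2.1.differentiable (by simp)) θ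
        have hg := (g.2.1.differentiable (by simp)) θ
        change deriv (f.1 + g.1) θ / _ = deriv f.1 θ / _ + deriv g.1 θ / _
        rw [deriv_add hf hg, add_div]
      map_smul' := fun c f => by
        apply Subtype.ext
        funext θ
        have hf := (f.2.1.differentiable (by simp)) θ
        change deriv (c • f.1) θ / _ = c • (deriv f.1 θ / _)
        rw [deriv_const_smul c hf, smul_div_assoc] }
    (fun f g => by
        apply Subtype.ext
        funext θ
        have hf := (f.2.1.differentiable (by simp)) θ
        have hg := (g.2.1.differentiable (by simp)) θ
        change deriv (f.1 * g.1) θ / _ = f.1 θ * (deriv g.1 θ / _) + g.1 θ * (deriv f.1 θ / _)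
        rw [deriv_mul hf hg]
        ring)

/-- The function `f₀ + ξ₁ f₁ + ξ₂ f₂ + ξ₁ ξ₂ f₁₂` on the supercircle `S^{1|2}`. -/
@[ext]
structure SuperFun where
  f0 : CircleFun
  f1 : CircleFun
  f2 : CircleFun
  f12 : CircleFun

namespace SuperFun

/-- The components of a function on the supercircle. -/
def equivProd : SuperFun ≃ CircleFun × CircleFun × CircleFun × CircleFun where
  toFun f := (f.f0, f.f1, f.f2, f.f12)
  invFun q := ⟨q.1, q.2.1, q.2.2.1, q.2.2.2⟩
  left_inv _ := rfl
  right_inv _ := rfl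

instance : AddCommGroup SuperFun := equivProd.addCommGroup

instance : Module ℂ SuperFun := equivProd.module ℂ

/-- The product of the algebra of functions on the supercircle: `ξ₁ ξ₂ = - ξ₂ ξ₁`, `ξᵢ² = 0`. -/
instance : Mul SuperFun where
  mul f g :=
    { f0 := f.f0 * g.f0
      f1 := f.f0 * g.f1 + f.f1 * g.f0
      f2 := f.f0 * g.f2 + f.f2 * g.f0
      f12 := f.f0 * g.f12 + f.f12 * g.f0 + f.f1 * g.f2 - f.f2 * g.f1 }

@[simp] theorem add_f0 (f g : SuperFun) : (f + g).f0 = f.f0 + g.f0 := rfl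
@[simp] theorem add_f1 (f g : SuperFun) : (f + g).f1 = f.f1 + g.f1 := rfl
@[simp] theorem add_f2 (f g : SuperFun) : (f + g).f2 = f.f2 + g.f2 := rfl
@[simp] theorem add_f12 (f g : SuperFun) : (f + g).f12 = f.f12 + g.f12 := rfl
@[simp] theorem sub_f0 (f g : SuperFun) : (f - g).f0 = f.f0 - g.f0 := rfl
@[simp] theorem sub_f1 (f g : SuperFun) : (f - g).f1 = f.f1 - g.f1 := rfl
@[simp] theorem sub_f2 (f g : SuperFun) : (f - g).f2 = f.f2 - g.f2 := rfl
@[simp] theorem sub_f12 (f g : SuperFun) : (f - g).f12 = f.f12 - g.f12 := rfl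
@[simp] theorem neg_f0 (f : SuperFun) : (-f).f0 = -f.f0 := rfl
@[simp] theorem neg_f1 (f : SuperFun) : (-f).f1 = -f.f1 := rfl
@[simp] theorem neg_f2 (f : SuperFun) : (-f).f2 = -f.f2 := rfl
@[simp] theorem neg_f12 (f : SuperFun) : (-f).f12 = -f.f12 := rfl
@[simp] theorem smul_f0 (c : ℂ) (f : SuperFun) : (c • f).f0 = c • f.f0 := rfl
@[simp] theorem smul_f1 (c : ℂ) (f : SuperFun) : (c • f).f1 = c • f.f1 := rfl
@[simp] theorem smul_f2 (c : ℂ) (f : SuperFun) : (c • f).f2 = c • f.f2 := rfl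
@[simp] theorem smul_f12 (c : ℂ) (f : SuperFun) : (c • f).f12 = c • f.f12 := rfl
@[simp] theorem mul_f0 (f g : SuperFun) : (f * g).f0 = f.f0 * g.f0 := rfl
@[simp] theorem mul_f1 (f g : SuperFun) : (f * g).f1 = f.f0 * g.f1 + f.f1 * g.f0 := rfl
@[simp] theorem mul_f2 (f g : SuperFun) : (f * g).f2 = f.f0 * g.f2 + f.f2 * g.f0 := rfl
@[simp] theorem mul_f12 (f g : SuperFun) :
    (f * g).f12 = f.f0 * g.f12 + f.f12 * g.f0 + f.f1 * g.f2 - f.f2 * g.f1 := rfl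

/-- The even part `f₀ + ξ₁ ξ₂ f₁₂`. -/
def evenPart (f : SuperFun) : SuperFun := ⟨f.f0, 0, 0, f.f12⟩

/-- The odd part `ξ₁ f₁ + ξ₂ f₂`. -/
def oddPart (f : SuperFun) : SuperFun := ⟨0, f.f1, f.f2, 0⟩

end SuperFun

open SuperFun

/-- Linear endomorphisms of the space of functions on the supercircle. -/
abbrev Op := Module.End ℂ SuperFun

/-- The function `1`. -/
def funOne : SuperFun := ⟨1, 0, 0, 0⟩
/-- The even coordinate function `x`. -/
def funX : SuperFun := ⟨coordX, 0, 0, 0⟩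
/-- The odd coordinate function `ξ₁`. -/
def xi1 : SuperFun := ⟨0, 1, 0, 0⟩
/-- The odd coordinate function `ξ₂`. -/
def xi2 : SuperFun := ⟨0, 0, 1, 0⟩

/-- The operator of left multiplication by a function. -/
def mulOp (f : SuperFun) : Op where
  toFun g := f * g
  map_add' g h := by ext1 <;> simp <;> ring
  map_smul' c g := by ext1 <;> simp [smul_add, smul_sub]

/-- The parity involution: `f ↦ (-1)^{p(f)} f` on homogeneous functions. -/
def parityInv : Op where
  toFun f := ⟨f.f0, -f.f1, -f.f2, f.f12⟩
  map_add' g h := by ext1 <;> simp <;> ring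
  map_smul' c g := by ext1 <;> simp

/-- `f` is homogeneous of parity `p mod 2`. -/
def HasParity (f : SuperFun) (p : ℕ) : Prop := parityInv f = (-1 : ℂ) ^ p • f

/-- The even vector field `∂ₓ`. -/
def dx : Op where
  toFun f := ⟨partialX f.f0, partialX f.f1, partialX f.f2, partialX f.f12⟩
  map_add' g h := by ext1 <;> simp
  map_smul' c g := by ext1 <;> simp

/-- The odd vector field `∂_{ξ₁}`. -/
def dxi1 : Op where
  toFun f := ⟨f.f1, 0, f.f12, 0⟩
  map_add' g h := by ext1 <;> simp
  map_smul' c g := by ext1 <;> simp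

/-- The odd vector field `∂_{ξ₂}`. -/
def dxi2 : Op where
  toFun f := ⟨f.f2, -f.f12, 0, 0⟩
  map_add' g h := by
    ext1 <;> simp
    ring
  map_smul' c g := by ext1 <;> simp

/-- `D̄₁ = ∂_{ξ₁} - ξ₁ ∂ₓ`. -/
def Dbar1 : Op := dxi1 - mulOp xi1 * dx

/-- `D̄₂ = ∂_{ξ₂} - ξ₂ ∂ₓ`. -/
def Dbar2 : Op := dxi2 - mulOp xi2 * dx

/-! ### Contact vector fields, densities, the orthosymplectic algebra -/

/-- The contact vector field `X_f = f ∂ₓ - (-1)^{p(f)} ½ (D̄₁(f) D̄₁ + D̄₂(f) D̄₂)`, extended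
linearly from homogeneous `f` (note `(-1)^{p(f)} D̄ᵢ(f) = D̄ᵢ((-1)^{p(f)} f)`). -/
def contactField (f : SuperFun) : Op :=
  mulOp f * dx - (1 / 2 : ℂ) •
    (mulOp (Dbar1 (parityInv f)) * Dbar1 + mulOp (Dbar2 (parityInv f)) * Dbar2)

/-- The action `L^λ_{X_f} = X_f + λ f'` on `λ`-densities. -/
def densityAction (lam : ℂ) (f : SuperFun) : Op := contactField f + lam • mulOp (dx f)

/-- The contact Hamiltonians of `osp(2|2)`: the span of
`1, ξ₁, ξ₂, x, ξ₁ξ₂, xξ₁, xξ₂, x²`. -/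
def ospHamiltonians : Submodule ℂ SuperFun :=
  Submodule.span ℂ
    {funOne, xi1, xi2, funX, xi1 * xi2, funX * xi1, funX * xi2, funX * funX}

/-- `A ↦ (-1)^{p(A)} A` on homogeneous operators. -/
def opParity (A : Op) : Op := parityInv * A * parityInv

/-- The action of the contact field `X_f` on operators from `λ`-densities to `μ`-densities,
`L^μ_{X_f} ∘ A - (-1)^{p(f) p(A)} A ∘ L^λ_{X_f}`, extended linearly from homogeneous `f`, `A`. -/
def opAction (lam mu : ℂ) (f : SuperFun) : Op →ₗ[ℂ] Op where
  toFun A := densityAction mu f * A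
    - A * densityAction lam (evenPart f) - opParity A * densityAction lam (oddPart f)
  map_add' A B := by simp only [opParity, mul_add, add_mul]; abel
  map_smul' c A := by
    simp only [opParity, mul_smul_comm, smul_mul_assoc, smul_sub, RingHom.id_apply]

/-! ### Differential operators and the contact filtration -/

/-- The differential operators `∑ a_{ℓ,m,n} ∂ₓ^ℓ D̄₁^m D̄₂^n` of contact order at most `i/2`,
that is `m, n ≤ 1` and `ℓ + m/2 + n/2 ≤ i/2`. -/
def diffOps (i : ℕ) : Submodule ℂ Op :=
  Submodule.span ℂ {A | ∃ (a : SuperFun) (l m n : ℕ), m ≤ 1 ∧ n ≤ 1 ∧ 2 * l + m + n ≤ i ∧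
    A = mulOp a * dx ^ l * Dbar1 ^ m * Dbar2 ^ n}

/-- The space of all differential operators on the supercircle. -/
def allDiffOps : Submodule ℂ Op := ⨆ i, diffOps i

/-- The preceding term of the contact filtration (zero before order `0`). -/
def prevDiffOps : ℕ → Submodule ℂ Op
  | 0 => ⊥
  | i + 1 => diffOps i

/-! ### The contact filtration is invariant under contact fields -/

section Invariance

theorem mulOp_apply (f g : SuperFun) : mulOp f g = f * g := rfl

theorem parityInv_apply (f : SuperFun) : parityInv f = ⟨f.f0, -f.f1, -f.f2, f.f12⟩ := rfl

theorem dx_apply (f : SuperFun) :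
    dx f = ⟨partialX f.f0, partialX f.f1, partialX f.f2, partialX f.f12⟩ := rfl

theorem Dbar1_apply (f : SuperFun) :
    Dbar1 f = ⟨f.f1, -partialX f.f0, f.f12, -partialX f.f2⟩ := by
  change (⟨f.f1, 0, f.f12, 0⟩ : SuperFun) - xi1 * dx f = _
  ext1 <;> simp [xi1, dx_apply]

theorem Dbar2_apply (f : SuperFun) :
    Dbar2 f = ⟨f.f2, -f.f12, -partialX f.f0, partialX f.f1⟩ := by
  change (⟨f.f2, -f.f12, 0, 0⟩ : SuperFun) - xi2 * dx f = _
  ext1 <;> simp [xi2, dx_apply]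

theorem contactField_apply (f g : SuperFun) :
    contactField f g = f * dx g - (1 / 2 : ℂ) •
      (Dbar1 (parityInv f) * Dbar1 g + Dbar2 (parityInv f) * Dbar2 g) := rfl

theorem Dbar1_mulOp (a : SuperFun) :
    Dbar1 * mulOp a = mulOp (Dbar1 a) + mulOp (parityInv a) * Dbar1 := by
  refine LinearMap.ext fun g => ?_
  change Dbar1 (a * g) = Dbar1 a * g + parityInv a * Dbar1 g
  ext1 <;> simp [Dbar1_apply, parityInv_apply, Derivation.leibniz] <;> ring

theorem Dbar2_mulOp (a : SuperFun) :
    Dbar2 * mulOp a = mulOp (Dbar2 a) + mulOp (parityInv a) * Dbar2 := by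
  refine LinearMap.ext fun g => ?_
  change Dbar2 (a * g) = Dbar2 a * g + parityInv a * Dbar2 g
  ext1 <;> simp [Dbar2_apply, parityInv_apply, Derivation.leibniz] <;> ring

theorem dx_mulOp (a : SuperFun) : dx * mulOp a = mulOp (dx a) + mulOp a * dx := by
  refine LinearMap.ext fun g => ?_
  change dx (a * g) = dx a * g + a * dx g
  ext1 <;> simp [dx_apply, Derivation.leibniz] <;> ring

theorem mulOp_mulOp (a b : SuperFun) : mulOp a * mulOp b = mulOp (a * b) := by
  refine LinearMap.ext fun g => ?_
  change a * (b * g) = a * b * g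
  ext1 <;> simp <;> ring

theorem mulOp_funOne : mulOp funOne = 1 := by
  refine LinearMap.ext fun g => ?_
  change funOne * g = g
  ext1 <;> simp [funOne]

theorem Dbar1_sq : Dbar1 * Dbar1 = -dx := by
  refine LinearMap.ext fun g => ?_
  change Dbar1 (Dbar1 g) = -dx g
  ext1 <;> simp [Dbar1_apply, dx_apply]

theorem Dbar2_sq : Dbar2 * Dbar2 = -dx := by
  refine LinearMap.ext fun g => ?_
  change Dbar2 (Dbar2 g) = -dx g
  ext1 <;> simp [Dbar2_apply, dx_apply]

theorem Dbar2_Dbar1 : Dbar2 * Dbar1 = -(Dbar1 * Dbar2) := by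
  refine LinearMap.ext fun g => ?_
  change Dbar2 (Dbar1 g) = -Dbar1 (Dbar2 g)
  ext1 <;> simp [Dbar1_apply, Dbar2_apply]

theorem Dbar1_dx : Dbar1 * dx = dx * Dbar1 := by
  refine LinearMap.ext fun g => ?_
  change Dbar1 (dx g) = dx (Dbar1 g)
  ext1 <;> simp [Dbar1_apply, dx_apply]

theorem Dbar2_dx : Dbar2 * dx = dx * Dbar2 := by
  refine LinearMap.ext fun g => ?_
  change Dbar2 (dx g) = dx (Dbar2 g)
  ext1 <;> simp [Dbar2_apply, dx_apply]

theorem parityInv_sq : parityInv * parityInv = 1 := by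
  refine LinearMap.ext fun g => ?_
  change parityInv (parityInv g) = g
  ext1 <;> simp [parityInv_apply]

theorem opParity_mul (A B : Op) : opParity (A * B) = opParity A * opParity B := by
  have h : parityInv * A * parityInv * (parityInv * B * parityInv)
      = parityInv * A * (parityInv * parityInv) * B * parityInv := by
    simp only [mul_assoc]
  simp only [opParity]
  rw [h, parityInv_sq, mul_one, mul_assoc parityInv A B]

theorem opParity_mulOp (a : SuperFun) : opParity (mulOp a) = mulOp (parityInv a) := by
  refine LinearMap.ext fun g => ?_
  change parityInv (a * parityInv g) = parityInv a * g
  ext1 <;> simp [parityInv_apply] <;> ring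

theorem opParity_Dbar1 : opParity Dbar1 = -Dbar1 := by
  refine LinearMap.ext fun g => ?_
  change parityInv (Dbar1 (parityInv g)) = -Dbar1 g
  ext1 <;> simp [parityInv_apply, Dbar1_apply]

theorem opParity_Dbar2 : opParity Dbar2 = -Dbar2 := by
  refine LinearMap.ext fun g => ?_
  change parityInv (Dbar2 (parityInv g)) = -Dbar2 g
  ext1 <;> simp [parityInv_apply, Dbar2_apply]

theorem opParity_dx : opParity dx = dx := by
  refine LinearMap.ext fun g => ?_
  change parityInv (dx (parityInv g)) = dx g
  ext1 <;> simp [parityInv_apply, dx_apply]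

theorem half_add_half :
    algebraMap ℂ CircleFun (1 / 2) + algebraMap ℂ CircleFun (1 / 2) = 1 := by
  rw [← map_add]; norm_num

theorem contactField_add (f g : SuperFun) :
    contactField (f + g) = contactField f + contactField g := by
  refine LinearMap.ext fun h => ?_
  change contactField (f + g) h = contactField f h + contactField g h
  simp only [contactField_apply, map_add]
  ext1 <;> simp [Dbar1_apply, Dbar2_apply, dx_apply, parityInv_apply, add_mul, smul_add,
    Algebra.smul_def] <;> ring

/-! The twisted commutators `X_f A - A X_f` (`f` even), `X_f A - (-1)^{p(A)} A X_f` (`f` odd). -/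

theorem even_mulOp (f a : SuperFun) :
    contactField (evenPart f) * mulOp a - mulOp a * contactField (evenPart f)
      = mulOp (contactField (evenPart f) a) := by
  refine LinearMap.ext fun g => ?_
  change contactField (evenPart f) (a * g) - a * contactField (evenPart f) g
    = contactField (evenPart f) a * g
  simp only [contactField_apply]
  ext1 <;> simp [Dbar1_apply, Dbar2_apply, dx_apply, parityInv_apply, evenPart,
    Derivation.leibniz, Algebra.smul_def] <;> ring

theorem odd_mulOp (f a : SuperFun) :
    contactField (oddPart f) * mulOp a - mulOp (parityInv a) * contactField (oddPart f)
      = mulOp (contactField (oddPart f) a) := by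
  refine LinearMap.ext fun g => ?_
  change contactField (oddPart f) (a * g) - parityInv a * contactField (oddPart f) g
    = contactField (oddPart f) a * g
  simp only [contactField_apply]
  ext1 <;> simp [Dbar1_apply, Dbar2_apply, dx_apply, parityInv_apply, oddPart,
    Derivation.leibniz, Algebra.smul_def] <;> ring

theorem even_Dbar1 (f : SuperFun) :
    contactField (evenPart f) * Dbar1 - Dbar1 * contactField (evenPart f)
      = mulOp ((-(1 / 2) : ℂ) • dx (evenPart f)) * Dbar1
        + mulOp ((1 / 2 : ℂ) • Dbar1 (Dbar2 (evenPart f))) * Dbar2 := by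
  refine LinearMap.ext fun g => ?_
  change contactField (evenPart f) (Dbar1 g) - Dbar1 (contactField (evenPart f) g)
    = ((-(1 / 2) : ℂ) • dx (evenPart f)) * Dbar1 g
        + ((1 / 2 : ℂ) • Dbar1 (Dbar2 (evenPart f))) * Dbar2 g
  have h := half_add_half
  simp only [contactField_apply]
  ext1 <;> simp [Dbar1_apply, Dbar2_apply, dx_apply, parityInv_apply, evenPart,
    Derivation.leibniz, Algebra.smul_def] <;> simp only [← one_div] <;> grind

theorem even_Dbar2 (f : SuperFun) :
    contactField (evenPart f) * Dbar2 - Dbar2 * contactField (evenPart f)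
      = mulOp ((-(1 / 2) : ℂ) • dx (evenPart f)) * Dbar2
        + mulOp ((1 / 2 : ℂ) • Dbar2 (Dbar1 (evenPart f))) * Dbar1 := by
  refine LinearMap.ext fun g => ?_
  change contactField (evenPart f) (Dbar2 g) - Dbar2 (contactField (evenPart f) g)
    = ((-(1 / 2) : ℂ) • dx (evenPart f)) * Dbar2 g
        + ((1 / 2 : ℂ) • Dbar2 (Dbar1 (evenPart f))) * Dbar1 g
  have h := half_add_half
  simp only [contactField_apply]
  ext1 <;> simp [Dbar1_apply, Dbar2_apply, dx_apply, parityInv_apply, evenPart,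
    Derivation.leibniz, Algebra.smul_def] <;> simp only [← one_div] <;> grind

set_option maxHeartbeats 1000000 in
theorem odd_Dbar1 (f : SuperFun) :
    contactField (oddPart f) * Dbar1 + Dbar1 * contactField (oddPart f)
      = mulOp ((-(1 / 2) : ℂ) • dx (oddPart f)) * Dbar1
        + mulOp ((1 / 2 : ℂ) • Dbar1 (Dbar2 (oddPart f))) * Dbar2 := by
  refine LinearMap.ext fun g => ?_
  change contactField (oddPart f) (Dbar1 g) + Dbar1 (contactField (oddPart f) g)
    = ((-(1 / 2) : ℂ) • dx (oddPart f)) * Dbar1 g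
        + ((1 / 2 : ℂ) • Dbar1 (Dbar2 (oddPart f))) * Dbar2 g
  have h := half_add_half
  simp only [contactField_apply]
  ext1 <;> simp [Dbar1_apply, Dbar2_apply, dx_apply, parityInv_apply, oddPart,
    Derivation.leibniz, Algebra.smul_def] <;> simp only [← one_div] <;> grind

set_option maxHeartbeats 1000000 in
theorem odd_Dbar2 (f : SuperFun) :
    contactField (oddPart f) * Dbar2 + Dbar2 * contactField (oddPart f)
      = mulOp ((-(1 / 2) : ℂ) • dx (oddPart f)) * Dbar2
        + mulOp ((1 / 2 : ℂ) • Dbar2 (Dbar1 (oddPart f))) * Dbar1 := by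
  refine LinearMap.ext fun g => ?_
  change contactField (oddPart f) (Dbar2 g) + Dbar2 (contactField (oddPart f) g)
    = ((-(1 / 2) : ℂ) • dx (oddPart f)) * Dbar2 g
        + ((1 / 2 : ℂ) • Dbar2 (Dbar1 (oddPart f))) * Dbar1 g
  have h := half_add_half
  simp only [contactField_apply]
  ext1 <;> simp [Dbar1_apply, Dbar2_apply, dx_apply, parityInv_apply, oddPart,
    Derivation.leibniz, Algebra.smul_def] <;> simp only [← one_div] <;> grind


theorem opParity_add (A B : Op) : opParity (A + B) = opParity A + opParity B := by
  simp only [opParity, mul_add, add_mul]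

theorem opParity_neg (A : Op) : opParity (-A) = -opParity A := by
  simp only [opParity, mul_neg, neg_mul]

theorem opParity_smul (c : ℂ) (A : Op) : opParity (c • A) = c • opParity A := by
  simp only [opParity, mul_smul_comm, smul_mul_assoc]

theorem diffOps_mono {i j : ℕ} (h : i ≤ j) : diffOps i ≤ diffOps j := by
  refine Submodule.span_mono ?_
  rintro A ⟨a, l, m, n, hm, hn, hi, rfl⟩
  exact ⟨a, l, m, n, hm, hn, hi.trans h, rfl⟩

theorem prevDiffOps_le (i : ℕ) : prevDiffOps i ≤ diffOps i := by
  cases i with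
  | zero => exact bot_le
  | succ i => exact diffOps_mono (Nat.le_succ i)

theorem word_mem (a : SuperFun) {l m n i : ℕ} (hm : m ≤ 1) (hn : n ≤ 1)
    (hi : 2 * l + m + n ≤ i) : mulOp a * dx ^ l * Dbar1 ^ m * Dbar2 ^ n ∈ diffOps i :=
  Submodule.subset_span ⟨a, l, m, n, hm, hn, hi, rfl⟩

theorem mulOp_mem (a : SuperFun) (i : ℕ) : mulOp a ∈ diffOps i := by
  simpa using word_mem a (l := 0) (m := 0) (n := 0) (i := i) (by simp) (by simp) (by simp)

theorem one_mem_diffOps (i : ℕ) : (1 : Op) ∈ diffOps i := mulOp_funOne ▸ mulOp_mem funOne i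

theorem dx_mem : dx ∈ diffOps 2 := by
  have := word_mem funOne (l := 1) (m := 0) (n := 0) (i := 2) (by simp) (by simp) (by simp)
  simpa [mulOp_funOne] using this

theorem Dbar1_mem : Dbar1 ∈ diffOps 1 := by
  have := word_mem funOne (l := 0) (m := 1) (n := 0) (i := 1) (by simp) (by simp) (by simp)
  simpa [mulOp_funOne] using this

theorem Dbar2_mem : Dbar2 ∈ diffOps 1 := by
  have := word_mem funOne (l := 0) (m := 0) (n := 1) (i := 1) (by simp) (by simp) (by simp)
  simpa [mulOp_funOne] using this

/-- A linear condition on `diffOps i` may be checked on the spanning operators. -/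
theorem diffOps_le_comap {i j : ℕ} (T : Op →ₗ[ℂ] Op)
    (h : ∀ (a : SuperFun) (l m n : ℕ), m ≤ 1 → n ≤ 1 → 2 * l + m + n ≤ i →
      T (mulOp a * dx ^ l * Dbar1 ^ m * Dbar2 ^ n) ∈ diffOps j) {A : Op}
    (hA : A ∈ diffOps i) : T A ∈ diffOps j := by
  have : diffOps i ≤ (diffOps j).comap T := by
    refine Submodule.span_le.2 ?_
    rintro A ⟨a, l, m, n, hm, hn, hi, rfl⟩
    exact h a l m n hm hn hi
  exact this hA

theorem mulOp_mul_mem (a : SuperFun) {i : ℕ} {A : Op} (hA : A ∈ diffOps i) :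
    mulOp a * A ∈ diffOps i := by
  refine diffOps_le_comap (LinearMap.mulLeft ℂ (mulOp a)) ?_ hA
  intro b l m n hm hn hi
  have : mulOp a * (mulOp b * dx ^ l * Dbar1 ^ m * Dbar2 ^ n)
      = mulOp (a * b) * dx ^ l * Dbar1 ^ m * Dbar2 ^ n := by
    simp only [← mul_assoc, mulOp_mulOp]
  rw [LinearMap.mulLeft_apply, this]
  exact word_mem _ hm hn hi

theorem dx_mul_mem {i : ℕ} {A : Op} (hA : A ∈ diffOps i) : dx * A ∈ diffOps (i + 2) := by
  refine diffOps_le_comap (LinearMap.mulLeft ℂ dx) ?_ hA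
  intro b l m n hm hn hi
  have : dx * (mulOp b * dx ^ l * Dbar1 ^ m * Dbar2 ^ n)
      = mulOp (dx b) * dx ^ l * Dbar1 ^ m * Dbar2 ^ n
        + mulOp b * dx ^ (l + 1) * Dbar1 ^ m * Dbar2 ^ n := by
    simp only [← mul_assoc, dx_mulOp, add_mul, pow_succ']
  rw [LinearMap.mulLeft_apply, this]
  exact add_mem (word_mem _ hm hn (by omega)) (word_mem _ hm hn (by omega))

theorem Dbar1_dx_pow (l : ℕ) : Dbar1 * dx ^ l = dx ^ l * Dbar1 :=
  (show Commute Dbar1 dx from Dbar1_dx).pow_right l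

theorem Dbar2_dx_pow (l : ℕ) : Dbar2 * dx ^ l = dx ^ l * Dbar2 :=
  (show Commute Dbar2 dx from Dbar2_dx).pow_right l

theorem Dbar1_mul_mem {i : ℕ} {A : Op} (hA : A ∈ diffOps i) : Dbar1 * A ∈ diffOps (i + 1) := by
  refine diffOps_le_comap (LinearMap.mulLeft ℂ Dbar1) ?_ hA
  intro b l m n hm hn hi
  have h0 : Dbar1 * (mulOp b * dx ^ l * Dbar1 ^ m * Dbar2 ^ n)
      = mulOp (Dbar1 b) * dx ^ l * Dbar1 ^ m * Dbar2 ^ n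
        + mulOp (parityInv b) * dx ^ l * Dbar1 ^ (m + 1) * Dbar2 ^ n := by
    rw [← mul_assoc, ← mul_assoc, ← mul_assoc, Dbar1_mulOp, add_mul, add_mul, add_mul,
      mul_assoc (mulOp (parityInv b)) Dbar1, Dbar1_dx_pow, ← mul_assoc, pow_succ',
      mul_assoc (mulOp (parityInv b) * dx ^ l) Dbar1]
  rw [LinearMap.mulLeft_apply, h0]
  refine add_mem (word_mem _ hm hn (by omega)) ?_
  obtain rfl | rfl : m = 0 ∨ m = 1 := by omega
  · exact word_mem _ (by omega) hn (by omega)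
  · have h1 : mulOp (parityInv b) * dx ^ l * Dbar1 ^ (1 + 1) * Dbar2 ^ n
        = -(mulOp (parityInv b) * dx ^ (l + 1) * Dbar1 ^ 0 * Dbar2 ^ n) := by
      rw [pow_succ, pow_one, Dbar1_sq]
      simp only [mul_neg, neg_mul, pow_succ, pow_zero, mul_one, mul_assoc]
    rw [h1]
    exact neg_mem (word_mem _ (by omega) hn (by omega))

theorem Dbar2_mul_mem {i : ℕ} {A : Op} (hA : A ∈ diffOps i) : Dbar2 * A ∈ diffOps (i + 1) := by
  refine diffOps_le_comap (LinearMap.mulLeft ℂ Dbar2) ?_ hA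
  intro b l m n hm hn hi
  have hc : Dbar2 * Dbar1 ^ m = (-1 : ℂ) ^ m • (Dbar1 ^ m * Dbar2) := by
    obtain rfl | rfl : m = 0 ∨ m = 1 := by omega
    · simp
    · simp [Dbar2_Dbar1]
  have h0 : Dbar2 * (mulOp b * dx ^ l * Dbar1 ^ m * Dbar2 ^ n)
      = mulOp (Dbar2 b) * dx ^ l * Dbar1 ^ m * Dbar2 ^ n
        + (-1 : ℂ) ^ m • (mulOp (parityInv b) * dx ^ l * Dbar1 ^ m * Dbar2 ^ (n + 1)) := by
    rw [← mul_assoc, ← mul_assoc, ← mul_assoc, Dbar2_mulOp, add_mul, add_mul, add_mul,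
      mul_assoc (mulOp (parityInv b)) Dbar2, Dbar2_dx_pow, ← mul_assoc,
      mul_assoc (mulOp (parityInv b) * dx ^ l) Dbar2, hc, mul_smul_comm, smul_mul_assoc,
      pow_succ']
    simp only [mul_assoc]
  rw [LinearMap.mulLeft_apply, h0]
  refine add_mem (word_mem _ hm hn (by omega)) (Submodule.smul_mem _ _ ?_)
  obtain rfl | rfl : n = 0 ∨ n = 1 := by omega
  · exact word_mem _ hm (by omega) (by omega)
  · have h1 : mulOp (parityInv b) * dx ^ l * Dbar1 ^ m * Dbar2 ^ (1 + 1)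
        = -(mulOp (parityInv b) * dx ^ (l + 1) * Dbar1 ^ m * Dbar2 ^ 0) := by
      have hd : Dbar1 ^ m * dx = dx * Dbar1 ^ m :=
        (show Commute Dbar1 dx from Dbar1_dx).pow_left m
      rw [pow_succ Dbar2, pow_one, Dbar2_sq, mul_neg, mul_assoc _ (Dbar1 ^ m) dx, hd]
      simp only [pow_succ, pow_zero, mul_one, mul_assoc]
    rw [h1]
    exact neg_mem (word_mem _ hm (by omega) (by omega))

theorem mul_mem_diffOps {i j : ℕ} {A B : Op} (hA : A ∈ diffOps i) (hB : B ∈ diffOps j) :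
    A * B ∈ diffOps (i + j) := by
  refine diffOps_le_comap (LinearMap.mulRight ℂ B) ?_ hA
  intro a l m n hm hn hi
  rw [LinearMap.mulRight_apply]
  have h2 : Dbar2 ^ n * B ∈ diffOps (j + n) := by
    obtain rfl | rfl : n = 0 ∨ n = 1 := by omega
    · simpa using hB
    · simpa using Dbar2_mul_mem hB
  have h1 : Dbar1 ^ m * (Dbar2 ^ n * B) ∈ diffOps (j + n + m) := by
    obtain rfl | rfl : m = 0 ∨ m = 1 := by omega
    · simpa using h2
    · simpa using Dbar1_mul_mem h2
  have h3 : ∀ k : ℕ, dx ^ k * (Dbar1 ^ m * (Dbar2 ^ n * B)) ∈ diffOps (j + n + m + 2 * k) := by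
    intro k
    induction k with
    | zero => simpa using h1
    | succ k ih =>
      rw [pow_succ', mul_assoc]
      exact dx_mul_mem ih
  simp only [mul_assoc]
  exact diffOps_mono (by omega) (mulOp_mul_mem a (h3 l))

/-- Operators of contact order `i/2` whose parity twist and whose twisted commutators with the
contact field of `f` are again of contact order `i/2`. -/
def IsGood (f : SuperFun) (i : ℕ) (A : Op) : Prop :=
  A ∈ diffOps i ∧ opParity A ∈ diffOps i ∧
    contactField (evenPart f) * A - A * contactField (evenPart f) ∈ diffOps i ∧
    contactField (oddPart f) * A - opParity A * contactField (oddPart f) ∈ diffOps i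

theorem IsGood.mul {f : SuperFun} {i j : ℕ} {A B : Op} (hA : IsGood f i A) (hB : IsGood f j B) :
    IsGood f (i + j) (A * B) := by
  obtain ⟨a1, a2, a3, a4⟩ := hA
  obtain ⟨b1, b2, b3, b4⟩ := hB
  refine ⟨mul_mem_diffOps a1 b1, ?_, ?_, ?_⟩
  · rw [opParity_mul]
    exact mul_mem_diffOps a2 b2
  · have h := add_mem (mul_mem_diffOps a3 b1) (mul_mem_diffOps a1 b3)
    convert h using 1
    noncomm_ring
  · have h := add_mem (mul_mem_diffOps a4 b1) (mul_mem_diffOps a2 b4)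
    rw [opParity_mul]
    convert h using 1
    noncomm_ring

theorem isGood_mulOp (f a : SuperFun) : IsGood f 0 (mulOp a) := by
  refine ⟨mulOp_mem a 0, ?_, ?_, ?_⟩
  · rw [opParity_mulOp]
    exact mulOp_mem _ 0
  · rw [even_mulOp]
    exact mulOp_mem _ 0
  · rw [opParity_mulOp, odd_mulOp]
    exact mulOp_mem _ 0

theorem isGood_Dbar1 (f : SuperFun) : IsGood f 1 Dbar1 := by
  refine ⟨Dbar1_mem, ?_, ?_, ?_⟩
  · rw [opParity_Dbar1]
    exact neg_mem Dbar1_mem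
  · rw [even_Dbar1]
    exact add_mem (mulOp_mul_mem _ Dbar1_mem) (mulOp_mul_mem _ Dbar2_mem)
  · rw [opParity_Dbar1, neg_mul, sub_neg_eq_add, odd_Dbar1]
    exact add_mem (mulOp_mul_mem _ Dbar1_mem) (mulOp_mul_mem _ Dbar2_mem)

theorem isGood_Dbar2 (f : SuperFun) : IsGood f 1 Dbar2 := by
  refine ⟨Dbar2_mem, ?_, ?_, ?_⟩
  · rw [opParity_Dbar2]
    exact neg_mem Dbar2_mem
  · rw [even_Dbar2]
    exact add_mem (mulOp_mul_mem _ Dbar2_mem) (mulOp_mul_mem _ Dbar1_mem)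
  · rw [opParity_Dbar2, neg_mul, sub_neg_eq_add, odd_Dbar2]
    exact add_mem (mulOp_mul_mem _ Dbar2_mem) (mulOp_mul_mem _ Dbar1_mem)

theorem IsGood.neg {f : SuperFun} {i : ℕ} {A : Op} (hA : IsGood f i A) : IsGood f i (-A) := by
  obtain ⟨a1, a2, a3, a4⟩ := hA
  refine ⟨neg_mem a1, ?_, ?_, ?_⟩
  · rw [opParity_neg]
    exact neg_mem a2
  · convert neg_mem a3 using 1
    noncomm_ring
  · rw [opParity_neg]
    convert neg_mem a4 using 1
    noncomm_ring

theorem isGood_one (f : SuperFun) : IsGood f 0 1 := mulOp_funOne ▸ isGood_mulOp f funOne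

theorem isGood_dx (f : SuperFun) : IsGood f 2 dx := by
  have h : dx = -(Dbar1 * Dbar1) := by rw [Dbar1_sq, neg_neg]
  rw [h]
  exact ((isGood_Dbar1 f).mul (isGood_Dbar1 f)).neg

theorem IsGood.pow {f : SuperFun} {i : ℕ} {A : Op} (hA : IsGood f i A) (k : ℕ) :
    IsGood f (i * k) (A ^ k) := by
  induction k with
  | zero => simpa using isGood_one f
  | succ k ih =>
    rw [pow_succ]
    exact ih.mul hA

theorem contactField_split (f : SuperFun) :
    contactField f = contactField (evenPart f) + contactField (oddPart f) := by
  have h : f = evenPart f + oddPart f := by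
    ext1 <;> simp [evenPart, oddPart]
  rw [← contactField_add, ← h]

theorem opAction_apply (lam mu : ℂ) (f : SuperFun) (A : Op) :
    opAction lam mu f A = densityAction mu f * A - A * densityAction lam (evenPart f)
      - opParity A * densityAction lam (oddPart f) := rfl

theorem opAction_eq (lam mu : ℂ) (f : SuperFun) (A : Op) :
    opAction lam mu f A
      = (contactField (evenPart f) * A - A * contactField (evenPart f))
        + (contactField (oddPart f) * A - opParity A * contactField (oddPart f))
        + mu • (mulOp (dx f) * A) - lam • (A * mulOp (dx (evenPart f)))
        - lam • (opParity A * mulOp (dx (oddPart f))) := by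
  rw [opAction_apply, densityAction, densityAction, densityAction, contactField_split f]
  simp only [add_mul, mul_add, smul_mul_assoc, mul_smul_comm]
  abel

theorem IsGood.opAction_mem {f : SuperFun} {i : ℕ} {A : Op} (hA : IsGood f i A) (lam mu : ℂ) :
    opAction lam mu f A ∈ diffOps i := by
  obtain ⟨a1, a2, a3, a4⟩ := hA
  rw [opAction_eq]
  have h1 := Submodule.smul_mem _ mu (mulOp_mul_mem (dx f) a1)
  have h2 := Submodule.smul_mem _ lam (mul_mem_diffOps a1 (mulOp_mem (dx (evenPart f)) 0))
  have h3 := Submodule.smul_mem _ lam (mul_mem_diffOps a2 (mulOp_mem (dx (oddPart f)) 0))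
  exact sub_mem (sub_mem (add_mem (add_mem a3 a4) h1) h2) h3

/-- The contact filtration is invariant under the contact fields. -/
theorem opAction_mem (lam mu : ℂ) (f : SuperFun) {i : ℕ} {A : Op} (hA : A ∈ diffOps i) :
    opAction lam mu f A ∈ diffOps i := by
  refine diffOps_le_comap (opAction lam mu f) ?_ hA
  intro a l m n hm hn hi
  have h := (((isGood_mulOp f a).mul ((isGood_dx f).pow l)).mul ((isGood_Dbar1 f).pow m)).mul
    ((isGood_Dbar2 f).pow n)
  exact diffOps_mono (by omega) (h.opAction_mem lam mu)

theorem opAction_mem_prev (lam mu : ℂ) (f : SuperFun) {i : ℕ} {A : Op}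
    (hA : A ∈ prevDiffOps i) : opAction lam mu f A ∈ prevDiffOps i := by
  cases i with
  | zero =>
    have h : A = 0 := hA
    rw [h, map_zero]
    exact zero_mem _
  | succ i => exact opAction_mem lam mu f hA

end Invariance

/-! ### Symbols -/

/-- The graded piece `gr^{i/2}`: operators of contact order at most `i/2` modulo operators of
contact order at most `(i-1)/2`. -/
abbrev Gr (i : ℕ) : Type := diffOps i ⧸ (prevDiffOps i).submoduleOf (diffOps i)

/-- The principal symbol of an operator of contact order at most `i/2`. -/
def principalSymbol (i : ℕ) : diffOps i →ₗ[ℂ] Gr i :=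
  ((prevDiffOps i).submoduleOf (diffOps i)).mkQ

/-- The action of the contact field `X_f` on the graded piece `gr^{i/2}`, induced by its action on
differential operators from `λ`-densities to `μ`-densities. -/
def grAction (lam mu : ℂ) (f : SuperFun) (i : ℕ) : Gr i →ₗ[ℂ] Gr i :=
  Submodule.mapQ _ _
    ((opAction lam mu f).restrict (p := diffOps i) (q := diffOps i)
      (fun _ hA => opAction_mem lam mu f hA))
    (fun A hA => opAction_mem_prev lam mu f (A := A.1) hA)

/-- The space of symbols, the direct sum of all the `gr^{i/2}`. -/
abbrev Symbols : Type := DirectSum ℕ Gr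

/-- The action of the contact field `X_f` on the space of symbols. -/
def symbolAction (lam mu : ℂ) (f : SuperFun) : Symbols →ₗ[ℂ] Symbols :=
  DirectSum.lmap (grAction lam mu f)

/-- A quantization map is a linear bijection from symbols to differential operators that preserves
principal symbols. -/
def IsQuantizationMap (Q : Symbols →ₗ[ℂ] allDiffOps) : Prop :=
  Function.Bijective Q ∧
    ∀ (i : ℕ) (s : Gr i), ∃ h : (Q (DirectSum.lof ℂ ℕ Gr i s) : Op) ∈ diffOps i,
      principalSymbol i ⟨(Q (DirectSum.lof ℂ ℕ Gr i s) : Op), h⟩ = s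

/-- Equivariance under the contact fields of `osp(2|2)`. -/
def IsOspEquivariant (lam mu : ℂ) (Q : Symbols →ₗ[ℂ] allDiffOps) : Prop :=
  ∀ f ∈ ospHamiltonians, ∀ s : Symbols,
    (Q (symbolAction lam mu f s) : Op) = opAction lam mu f (Q s : Op)

/-- `∂ₓ^j`; the terms with a negative exponent, which the formulas below write down with a zero
coefficient or a zero component, are absent. -/
def dxPow (j : ℤ) : Op := if 0 ≤ j then dx ^ j.toNat else 0

theorem dxPow_natCast (l : ℕ) : dxPow (l : ℤ) = dx ^ l := by
  simp [dxPow]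

theorem dxPow_neg {j : ℤ} (h : j < 0) : dxPow j = 0 := by
  simp [dxPow, not_le.2 h]

theorem topInt_mem (K : ℕ) (F₁ F₂ : SuperFun) :
    mulOp F₁ * dx ^ K + mulOp F₂ * dxPow ((K : ℤ) - 1) * Dbar1 * Dbar2 ∈ diffOps (2 * K) := by
  refine add_mem ?_ ?_
  · simpa using word_mem F₁ (l := K) (m := 0) (n := 0) (i := 2 * K) (by simp) (by simp) (by simp)
  · cases K with
    | zero =>
      rw [dxPow_neg (by simp)]
      simp
    | succ K =>
      rw [show ((K + 1 : ℕ) : ℤ) - 1 = (K : ℤ) by push_cast; ring, dxPow_natCast]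
      simpa using word_mem F₂ (l := K) (m := 1) (n := 1) (i := 2 * (K + 1))
        (by simp) (by simp) (by omega)

theorem topHalf_mem (K : ℕ) (F₁ F₂ : SuperFun) :
    mulOp F₁ * dx ^ K * Dbar1 + mulOp F₂ * dx ^ K * Dbar2 ∈ diffOps (2 * K + 1) := by
  refine add_mem ?_ ?_
  · simpa using word_mem F₁ (l := K) (m := 1) (n := 0) (i := 2 * K + 1)
      (by simp) (by simp) (by simp)
  · simpa using word_mem F₂ (l := K) (m := 0) (n := 1) (i := 2 * K + 1)
      (by simp) (by simp) (by simp)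

/-- The symbol `(F₁, F₂)` of integer contact order `K`: the principal symbol of
`F₁ ∂ₓ^K + F₂ ∂ₓ^{K-1} D̄₁ D̄₂` (for `K = 0` the second term is absent). -/
def symbolInt (K : ℕ) (F₁ F₂ : SuperFun) : Symbols :=
  DirectSum.lof ℂ ℕ Gr (2 * K) (principalSymbol (2 * K) ⟨_, topInt_mem K F₁ F₂⟩)

/-- The symbol `(F₁, F₂)` of half-integer contact order `K + 1/2`: the principal symbol of
`F₁ ∂ₓ^K D̄₁ + F₂ ∂ₓ^K D̄₂`. -/
def symbolHalf (K : ℕ) (F₁ F₂ : SuperFun) : Symbols :=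
  DirectSum.lof ℂ ℕ Gr (2 * K + 1) (principalSymbol (2 * K + 1) ⟨_, topHalf_mem K F₁ F₂⟩)

/-! ### The explicit formula -/

/-- The generalized binomial coefficient `z (z-1) ⋯ (z-m+1) / m!`, zero for negative `m`. -/
def gbinom (z : ℂ) (m : ℤ) : ℂ :=
  if 0 ≤ m then (∏ i ∈ Finset.range m.toNat, (z - i)) / (m.toNat.factorial : ℂ) else 0

/-- The coefficient of `DIV^n (F₁, F₂) div^{k-n}`; the contact order is `k/2`, and all the
divisions of integers are floor divisions. -/
def quantCoeff (lam mu : ℂ) (k n : ℕ) : ℂ :=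
  gbinom (((k : ℤ) / 2 : ℤ) : ℂ) ((2 * (n : ℤ) + 1 + (-1) ^ k) / 4) *
      gbinom (((((k : ℤ) - 1) / 2 : ℤ) : ℂ) + 2 * lam) ((2 * (n : ℤ) + 1 - (-1) ^ k) / 4) /
    gbinom ((k : ℂ) - 2 * (mu - lam)) (((n : ℤ) + 1) / 2)

/-- The divergence operators `DIV^n`, for symbols of parity `p` and integer contact order `K`;
`n = 2q + 1` or `n = 2q`. -/
def DIVInt (lam mu : ℂ) (K p n : ℕ) (F₁ F₂ : SuperFun) : SuperFun × SuperFun :=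
  let q : ℕ := n / 2
  let a : ℂ := K + 2 * lam
  let t : ℂ := 2 * (mu - lam) + q - 2 * K
  if n % 2 = 1 then
    ((-1 : ℂ) ^ (p + 1) • ((a / K) • dxPow q (Dbar2 F₂) + dxPow q (Dbar1 F₁)),
      (-1 : ℂ) ^ (p + 1) • (dxPow q (Dbar2 F₁) - (a / K) • dxPow q (Dbar1 F₂)))
  else
    (dxPow q F₁ - (a * q / (K * t)) • dxPow ((q : ℤ) - 1) (Dbar1 (Dbar2 F₂)),
      (a * (K - q) / (K * (K - q + 2 * lam))) • dxPow q F₂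
        + (q * (K - q) / (t * (K - q + 2 * lam))) • dxPow ((q : ℤ) - 1) (Dbar1 (Dbar2 F₁)))

/-- The operators `div^{2K-n}`, for integer contact order `K`; `n = 2q + 1` or `n = 2q`. -/
def divInt (K n : ℕ) : Op × Op :=
  let q : ℤ := (n : ℤ) / 2
  if n % 2 = 1 then (dxPow (K - q - 1) * Dbar1, dxPow (K - q - 1) * Dbar2)
  else (dxPow (K - q), dxPow (K - q - 1) * Dbar1 * Dbar2)

/-- The divergence operators `DIV^n`, for symbols of parity `p` and half-integer contact order
`K + 1/2`; `n = 2q + 1` or `n = 2q`. -/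
def DIVHalf (lam mu : ℂ) (K p n : ℕ) (F₁ F₂ : SuperFun) : SuperFun × SuperFun :=
  let q : ℕ := n / 2
  let r : ℂ := (2 * (mu - lam) - (2 * K + 1)) / (2 * (mu - lam) - 2 * K)
  let t : ℂ := 2 * (mu - lam) + q - (2 * K + 1)
  if n % 2 = 1 then
    (((-1 : ℂ) ^ p * r) • (dxPow q (Dbar2 F₂) + dxPow q (Dbar1 F₁)),
      ((-1 : ℂ) ^ p * r * ((K - q) / (K - q + 2 * lam))) •
        (dxPow q (Dbar2 F₁) - dxPow q (Dbar1 F₂)))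
  else
    (r • (((2 * (mu - lam) + q - 2 * K) / t) • dxPow q F₁
        - (q / t) • dxPow ((q : ℤ) - 1) (Dbar1 (Dbar2 F₂))),
      r • (((2 * (mu - lam) + q - 2 * K) / t) • dxPow q F₂
        + (q / t) • dxPow ((q : ℤ) - 1) (Dbar1 (Dbar2 F₁))))

/-- The operators `div^{2K+1-n}`, for half-integer contact order `K + 1/2`; `n = 2q + 1` or
`n = 2q`. -/
def divHalf (K n : ℕ) : Op × Op :=
  let q : ℤ := (n : ℤ) / 2
  if n % 2 = 1 then (dxPow (K - q), dxPow (K - q - 1) * Dbar1 * Dbar2)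
  else (dxPow (K - q) * Dbar1, dxPow (K - q) * Dbar2)

/-- The product `G₁ d₁ + G₂ d₂` of a pair of functions and a pair of operators. -/
def pairing (G : SuperFun × SuperFun) (d : Op × Op) : Op := mulOp G.1 * d.1 + mulOp G.2 * d.2

/-- `∑_n c_n DIV^n (F₁, F₂) div^{2K-n}`, for integer contact order `K`. -/
def quantInt (lam mu : ℂ) (K p : ℕ) (F₁ F₂ : SuperFun) : Op :=
  ∑ n ∈ Finset.range (2 * K + 1),
    quantCoeff lam mu (2 * K) n • pairing (DIVInt lam mu K p n F₁ F₂) (divInt K n)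

/-- `∑_n c_n DIV^n (F₁, F₂) div^{2K+1-n}`, for half-integer contact order `K + 1/2`. -/
def quantHalf (lam mu : ℂ) (K p : ℕ) (F₁ F₂ : SuperFun) : Op :=
  ∑ n ∈ Finset.range (2 * K + 2),
    quantCoeff lam mu (2 * K + 1) n • pairing (DIVHalf lam mu K p n F₁ F₂) (divHalf K n)

/-- The sum `quantInt` with the factors `K` and `K - q + 2λ` of its denominators cancelled against
the binomial coefficients; it is meaningful for every `λ` and every `K ≥ 0`. -/
def quantIntCancelled (lam mu : ℂ) (K p : ℕ) (F₁ F₂ : SuperFun) : Op :=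
  let N : ℂ := 2 * K - 2 * (mu - lam)
  ∑ q ∈ Finset.range (K + 1),
    (pairing
      ((gbinom K q * gbinom (K - 1 + 2 * lam) q / gbinom N q) • dxPow q F₁
        + (gbinom ((K : ℂ) - 1) (q - 1) * gbinom (K + 2 * lam) (q + 1) / gbinom N (q + 1)) •
            dxPow ((q : ℤ) - 1) (Dbar1 (Dbar2 F₂)),
       (gbinom ((K : ℂ) - 1) q * gbinom (K + 2 * lam) q / gbinom N q) • dxPow q F₂
        - (gbinom K (q + 1) * gbinom (K - 1 + 2 * lam) (q - 1) / gbinom N (q + 1)) •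
            dxPow ((q : ℤ) - 1) (Dbar1 (Dbar2 F₁)))
      (dxPow ((K : ℤ) - q), dxPow ((K : ℤ) - q - 1) * Dbar1 * Dbar2)
    + (-1 : ℂ) ^ (p + 1) • pairing
      ((gbinom K (q + 1) * gbinom (K - 1 + 2 * lam) q / gbinom N (q + 1)) • dxPow q (Dbar1 F₁)
        + (gbinom ((K : ℂ) - 1) q * gbinom (K + 2 * lam) (q + 1) / gbinom N (q + 1)) •
            dxPow q (Dbar2 F₂),
       (gbinom K (q + 1) * gbinom (K - 1 + 2 * lam) q / gbinom N (q + 1)) • dxPow q (Dbar2 F₁)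
        - (gbinom ((K : ℂ) - 1) q * gbinom (K + 2 * lam) (q + 1) / gbinom N (q + 1)) •
            dxPow q (Dbar1 F₂))
      (dxPow ((K : ℤ) - q - 1) * Dbar1, dxPow ((K : ℤ) - q - 1) * Dbar2))

/-- The sum `quantHalf` with the factors `K - q + 2λ` of its denominators cancelled against the
binomial coefficients; it is meaningful for every `λ`. -/
def quantHalfCancelled (lam mu : ℂ) (K p : ℕ) (F₁ F₂ : SuperFun) : Op :=
  let N : ℂ := 2 * K + 1 - 2 * (mu - lam)
  let r : ℂ := N / (N - 1)
  ∑ q ∈ Finset.range (K + 1),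
    ((r * gbinom K q * gbinom (K + 2 * lam) q / gbinom N q) • pairing
      (((N - q - 1) / (N - q)) • dxPow q F₁
          + (q / (N - q)) • dxPow ((q : ℤ) - 1) (Dbar1 (Dbar2 F₂)),
       ((N - q - 1) / (N - q)) • dxPow q F₂
          - (q / (N - q)) • dxPow ((q : ℤ) - 1) (Dbar1 (Dbar2 F₁)))
      (dxPow ((K : ℤ) - q) * Dbar1, dxPow ((K : ℤ) - q) * Dbar2)
    + (-1 : ℂ) ^ p • pairing
      ((r * gbinom K q * gbinom (K + 2 * lam) (q + 1) / gbinom N (q + 1)) •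
          (dxPow q (Dbar1 F₁) + dxPow q (Dbar2 F₂)),
       (r * gbinom K (q + 1) * gbinom (K + 2 * lam) q / gbinom N (q + 1)) •
          (dxPow q (Dbar2 F₁) - dxPow q (Dbar1 F₂)))
      (dxPow ((K : ℤ) - q), dxPow ((K : ℤ) - q - 1) * Dbar1 * Dbar2))

end SuperCircle

end

/-!
# The `osp(2|2)`-equivariant quantization on the supercircle `S^{1|2}`

**Reduction to odd generators.** The algebra `osp(2|2)` is generated by the contact fields of
`ξ₁, ξ₂, xξ₁, xξ₂` (`ospHamiltonians_le`), so equivariance has to be checked, and used, for these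
four only. The fields of `ξ₁` and `ξ₂` supercommute with `D̄₁`, `D̄₂`, `∂ₓ`, so for them the
equivariance of an expression with constant coefficients is automatic. The fields of `xξ₁` and
`xξ₂` satisfy the same commutation relations in the frames `(D̄₁, D̄₂)` and `(D̄₂, -D̄₁)`
(`Frame`, `frame_xi1`, `frame_xi2`), and the quantization looks the same in both frames, so one
computation settles both.

**Existence.** Take the terms with `q` derivatives in the explicit formula, with undetermined
coefficients. If the coefficients satisfy a list of two-term recursions, the failure of
equivariance of these terms is the difference of the remainders with indices `q + 1` and `q`
(`Frame.opAction_intTerm`, `Frame.opAction_halfTerm`). Summed over `q`, the remainders telescope to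
zero. The products of binomial coefficients of the formula satisfy the recursions; their
denominators do not vanish because `μ - λ` is non-resonant. The formula has the prescribed
principal symbol, and a linear map that preserves principal symbols is bijective by induction along
the contact filtration (`bijective_of_principalSymbol`).

**Uniqueness.** The words `∂ₓ^l D̄₁^m D̄₂^n` are independent over the functions
(`normalForm_coeff_eq_zero`), so a symbol is the same as a pair of functions, on which the
generators act by `pairAction`: as on two densities, which for half-integer contact order are in
addition rotated into one another. Two equivariant quantization maps differ, on symbols of contact
order `k/2`, by an equivariant map into operators of smaller order. If its values had order at most
`j/2`, with `j < k`, their principal symbols would define an intertwining map of such modules, and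
for non-resonant `μ - λ` there is none but zero (`intertwiner_eq_zero`). Hence the order of the
values decreases until the difference is zero (`eq_zero_of_equivariant`, `quantization_unique`).

**The two forms of the formula.** The cancelled form is the definition of the quantization map. The
sum over `n` agrees with it term by term, `n = 2q` and `n = 2q + 1`, by the absorption identities
`mul_gbinom_sub_one` and `mul_gbinom_sub_one_sub_one` for binomial coefficients.
-/

noncomputable section

namespace SuperCircle

open SuperFun

/-! ### The contact fields of `xξ₁` and `xξ₂` -/

theorem zero_f0 : (0 : SuperFun).f0 = 0 := rfl
theorem zero_f1 : (0 : SuperFun).f1 = 0 := rfl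
theorem zero_f2 : (0 : SuperFun).f2 = 0 := rfl
theorem zero_f12 : (0 : SuperFun).f12 = 0 := rfl
attribute [simp] zero_f0 zero_f1 zero_f2 zero_f12

theorem mulOp_add (a b : SuperFun) : mulOp (a + b) = mulOp a + mulOp b := by
  refine LinearMap.ext fun g => ?_
  change (a + b) * g = a * g + b * g
  ext1 <;> simp <;> ring

theorem mulOp_smul (c : ℂ) (a : SuperFun) : mulOp (c • a) = c • mulOp a := by
  refine LinearMap.ext fun g => ?_
  change (c • a) * g = c • (a * g)
  ext1 <;> simp [smul_add, smul_sub]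

/-- `mulOp` as a linear map. -/
def mulLin : SuperFun →ₗ[ℂ] Op where
  toFun := mulOp
  map_add' := mulOp_add
  map_smul' := mulOp_smul

theorem mulOp_neg (a : SuperFun) : mulOp (-a) = -mulOp a := map_neg mulLin a

theorem mulOp_sub (a b : SuperFun) : mulOp (a - b) = mulOp a - mulOp b := map_sub mulLin a b

theorem mulOp_zero : mulOp 0 = 0 := map_zero mulLin

theorem partialX_coordX : partialX coordX = 1 := by
  apply Subtype.ext
  funext θ
  change deriv (fun θ : ℝ => Complex.exp (Complex.I * θ)) θ
    / (Complex.I * Complex.exp (Complex.I * θ)) = 1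
  have h : HasDerivAt (fun θ : ℝ => Complex.exp (Complex.I * θ))
      (Complex.exp (Complex.I * θ) * (Complex.I * 1)) θ :=
    ((Complex.ofRealCLM.hasDerivAt (x := θ)).const_mul Complex.I).cexp
  rw [h.deriv, mul_one, mul_comm]
  exact div_self (mul_ne_zero Complex.I_ne_zero (Complex.exp_ne_zero _))

/-- The commutation relations shared by the contact Hamiltonians `φ = xξ₁` and `φ = xξ₂`,
relative to the frames `(e₁, e₂, d₁, d₂) = (ξ₁, ξ₂, D̄₁, D̄₂)` and `(ξ₂, -ξ₁, D̄₂, -D̄₁)`. Only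
these relations enter the proof of equivariance, which therefore covers both fields at once. -/
structure Frame (φ e₁ e₂ : SuperFun) (d₁ d₂ : Op) : Prop where
  evenPart_eq : evenPart φ = 0
  oddPart_eq : oddPart φ = φ
  dx_eq : dx φ = e₁
  field_dx : contactField φ * dx
    = dx * contactField φ - mulOp e₁ * dx - (1 / 2 : ℂ) • d₁
  field_d₁ : contactField φ * d₁
    = -(d₁ * contactField φ) - (1 / 2 : ℂ) • (mulOp e₁ * d₁) + (1 / 2 : ℂ) • (mulOp e₂ * d₂)
  field_d₂ : contactField φ * d₂
    = -(d₂ * contactField φ) - (1 / 2 : ℂ) • (mulOp e₁ * d₂) - (1 / 2 : ℂ) • (mulOp e₂ * d₁)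
  field_mul : ∀ a, contactField φ * mulOp a
    = mulOp (contactField φ a) + mulOp (parityInv a) * contactField φ
  field_parity : opParity (contactField φ) = -contactField φ
  dx_e₁ : dx * mulOp e₁ = mulOp e₁ * dx
  dx_e₂ : dx * mulOp e₂ = mulOp e₂ * dx
  d₁_e₁ : d₁ * mulOp e₁ = 1 - mulOp e₁ * d₁
  d₁_e₂ : d₁ * mulOp e₂ = -(mulOp e₂ * d₁)
  d₂_e₁ : d₂ * mulOp e₁ = -(mulOp e₁ * d₂)
  d₂_e₂ : d₂ * mulOp e₂ = 1 - mulOp e₂ * d₂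
  parity_e₁ : opParity (mulOp e₁) = -mulOp e₁
  parity_e₂ : opParity (mulOp e₂) = -mulOp e₂
  d₁_d₁ : d₁ * d₁ = -dx
  d₂_d₂ : d₂ * d₂ = -dx
  d₁_dx : d₁ * dx = dx * d₁
  parity_d₁ : opParity d₁ = -d₁
  parity_d₂ : opParity d₂ = -d₂
  mul_e₁ : ∀ a, parityInv a * e₁ = e₁ * a
  mul_e₂ : ∀ a, parityInv a * e₂ = e₂ * a

theorem contactField_zero : contactField 0 = 0 := by
  have h := contactField_add 0 0
  rw [add_zero] at h
  exact left_eq_add.mp h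

theorem contactField_parity {φ : SuperFun} (h : oddPart φ = φ) :
    opParity (contactField φ) = -contactField φ := by
  rw [← h]
  refine LinearMap.ext fun g => ?_
  change parityInv (contactField (oddPart φ) (parityInv g)) = -contactField (oddPart φ) g
  simp only [contactField_apply]
  ext1 <;> simp [Dbar1_apply, Dbar2_apply, dx_apply, parityInv_apply, oddPart, smul_add,
    smul_neg] <;> ring

theorem contactField_odd_mulOp {φ : SuperFun} (h : oddPart φ = φ) (a : SuperFun) :
    contactField φ * mulOp a
      = mulOp (contactField φ a) + mulOp (parityInv a) * contactField φ := by
  have := odd_mulOp φ a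
  rw [h] at this
  rw [← this, sub_add_cancel]

theorem field_Dbar1 {φ : SuperFun} (h : oddPart φ = φ) :
    contactField φ * Dbar1 = -(Dbar1 * contactField φ) - (1 / 2 : ℂ) • (mulOp (dx φ) * Dbar1)
      + (1 / 2 : ℂ) • (mulOp (Dbar1 (Dbar2 φ)) * Dbar2) := by
  have := odd_Dbar1 φ
  rw [h, mulOp_smul, mulOp_smul, smul_mul_assoc, smul_mul_assoc] at this
  rw [eq_sub_of_add_eq this]
  module

theorem field_Dbar2 {φ : SuperFun} (h : oddPart φ = φ) :
    contactField φ * Dbar2 = -(Dbar2 * contactField φ) - (1 / 2 : ℂ) • (mulOp (dx φ) * Dbar2)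
      - (1 / 2 : ℂ) • (mulOp (Dbar1 (Dbar2 φ)) * Dbar1) := by
  have := odd_Dbar2 φ
  rw [h, show Dbar2 (Dbar1 φ) = -Dbar1 (Dbar2 φ) from LinearMap.congr_fun Dbar2_Dbar1 φ,
    mulOp_smul, mulOp_smul, mulOp_neg, smul_mul_assoc, smul_mul_assoc, neg_mul] at this
  rw [eq_sub_of_add_eq this]
  module

theorem parityInv_mul_odd {e : SuperFun} (h : oddPart e = e) (a : SuperFun) :
    parityInv a * e = e * a := by
  rw [← h]
  ext1 <;> simp [parityInv_apply, oddPart] <;> ring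

theorem oddPart_xi1 : oddPart xi1 = xi1 := rfl
theorem oddPart_xi2 : oddPart xi2 = xi2 := rfl
theorem parityInv_xi1 : parityInv xi1 = -xi1 := by
  ext1 <;> simp [parityInv_apply, xi1]
theorem parityInv_xi2 : parityInv xi2 = -xi2 := by
  ext1 <;> simp [parityInv_apply, xi2]
theorem dx_xi1 : dx xi1 = 0 := by ext1 <;> simp [dx_apply, xi1]
theorem dx_xi2 : dx xi2 = 0 := by ext1 <;> simp [dx_apply, xi2]
theorem Dbar1_xi1 : Dbar1 xi1 = funOne := by ext1 <;> simp [Dbar1_apply, xi1, funOne]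
theorem Dbar1_xi2 : Dbar1 xi2 = 0 := by ext1 <;> simp [Dbar1_apply, xi2]
theorem Dbar2_xi1 : Dbar2 xi1 = 0 := by ext1 <;> simp [Dbar2_apply, xi1]
theorem Dbar2_xi2 : Dbar2 xi2 = funOne := by ext1 <;> simp [Dbar2_apply, xi2, funOne]

theorem oddPart_funX_xi1 : oddPart (funX * xi1) = funX * xi1 := by
  ext1 <;> simp [oddPart, funX, xi1]
theorem oddPart_funX_xi2 : oddPart (funX * xi2) = funX * xi2 := by
  ext1 <;> simp [oddPart, funX, xi2]
theorem dx_funX_xi1 : dx (funX * xi1) = xi1 := by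
  ext1 <;> simp [dx_apply, funX, xi1, partialX_coordX]
theorem dx_funX_xi2 : dx (funX * xi2) = xi2 := by
  ext1 <;> simp [dx_apply, funX, xi2, partialX_coordX]
theorem Dbar_funX_xi1 : Dbar1 (Dbar2 (funX * xi1)) = xi2 := by
  ext1 <;> simp [Dbar1_apply, Dbar2_apply, funX, xi1, xi2, partialX_coordX]
theorem Dbar_funX_xi2 : Dbar1 (Dbar2 (funX * xi2)) = -xi1 := by
  ext1 <;> simp [Dbar1_apply, Dbar2_apply, funX, xi1, xi2, partialX_coordX]

theorem field_funX_xi1_dx : contactField (funX * xi1) * dx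
    = dx * contactField (funX * xi1) - mulOp xi1 * dx - (1 / 2 : ℂ) • Dbar1 := by
  refine LinearMap.ext fun g => ?_
  change contactField _ (dx g) = dx (contactField _ g) - xi1 * dx g - (1 / 2 : ℂ) • Dbar1 g
  have h := half_add_half
  simp only [contactField_apply]
  ext1 <;> simp [Dbar1_apply, Dbar2_apply, dx_apply, parityInv_apply, funX, xi1,
    partialX_coordX, Algebra.smul_def] <;> simp only [← one_div] <;> grind

theorem field_funX_xi2_dx : contactField (funX * xi2) * dx
    = dx * contactField (funX * xi2) - mulOp xi2 * dx - (1 / 2 : ℂ) • Dbar2 := by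
  refine LinearMap.ext fun g => ?_
  change contactField _ (dx g) = dx (contactField _ g) - xi2 * dx g - (1 / 2 : ℂ) • Dbar2 g
  have h := half_add_half
  simp only [contactField_apply]
  ext1 <;> simp [Dbar1_apply, Dbar2_apply, dx_apply, parityInv_apply, funX, xi2,
    partialX_coordX, Algebra.smul_def] <;> simp only [← one_div] <;> grind

theorem frame_xi1 : Frame (funX * xi1) xi1 xi2 Dbar1 Dbar2 where
  evenPart_eq := by ext1 <;> simp [evenPart, funX, xi1]
  oddPart_eq := oddPart_funX_xi1
  dx_eq := dx_funX_xi1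
  field_dx := field_funX_xi1_dx
  field_d₁ := by rw [field_Dbar1 oddPart_funX_xi1, dx_funX_xi1, Dbar_funX_xi1]
  field_d₂ := by rw [field_Dbar2 oddPart_funX_xi1, dx_funX_xi1, Dbar_funX_xi1]
  field_mul := contactField_odd_mulOp oddPart_funX_xi1
  field_parity := contactField_parity oddPart_funX_xi1
  dx_e₁ := by rw [dx_mulOp, dx_xi1, mulOp_zero, zero_add]
  dx_e₂ := by rw [dx_mulOp, dx_xi2, mulOp_zero, zero_add]
  d₁_e₁ := by rw [Dbar1_mulOp, Dbar1_xi1, parityInv_xi1, mulOp_funOne, mulOp_neg, neg_mul,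
    sub_eq_add_neg]
  d₁_e₂ := by rw [Dbar1_mulOp, Dbar1_xi2, parityInv_xi2, mulOp_zero, mulOp_neg, neg_mul, zero_add]
  d₂_e₁ := by rw [Dbar2_mulOp, Dbar2_xi1, parityInv_xi1, mulOp_zero, mulOp_neg, neg_mul, zero_add]
  d₂_e₂ := by rw [Dbar2_mulOp, Dbar2_xi2, parityInv_xi2, mulOp_funOne, mulOp_neg, neg_mul,
    sub_eq_add_neg]
  parity_e₁ := by rw [opParity_mulOp, parityInv_xi1, mulOp_neg]
  parity_e₂ := by rw [opParity_mulOp, parityInv_xi2, mulOp_neg]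
  d₁_d₁ := Dbar1_sq
  d₂_d₂ := Dbar2_sq
  d₁_dx := Dbar1_dx
  parity_d₁ := opParity_Dbar1
  parity_d₂ := opParity_Dbar2
  mul_e₁ := parityInv_mul_odd oddPart_xi1
  mul_e₂ := parityInv_mul_odd oddPart_xi2

theorem frame_xi2 : Frame (funX * xi2) xi2 (-xi1) Dbar2 (-Dbar1) where
  evenPart_eq := by ext1 <;> simp [evenPart, funX, xi2]
  oddPart_eq := oddPart_funX_xi2
  dx_eq := dx_funX_xi2
  field_dx := field_funX_xi2_dx
  field_d₁ := by
    rw [field_Dbar2 oddPart_funX_xi2, dx_funX_xi2, Dbar_funX_xi2, mulOp_neg, neg_mul_neg, neg_mul,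
      smul_neg, sub_neg_eq_add]
  field_d₂ := by
    rw [mul_neg, field_Dbar1 oddPart_funX_xi2, dx_funX_xi2, Dbar_funX_xi2, mulOp_neg]
    simp only [neg_mul, mul_neg]
    module
  field_mul := contactField_odd_mulOp oddPart_funX_xi2
  field_parity := contactField_parity oddPart_funX_xi2
  dx_e₁ := frame_xi1.dx_e₂
  dx_e₂ := by rw [mulOp_neg, mul_neg, neg_mul, frame_xi1.dx_e₁]
  d₁_e₁ := frame_xi1.d₂_e₂
  d₁_e₂ := by rw [mulOp_neg, mul_neg, neg_mul, frame_xi1.d₂_e₁]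
  d₂_e₁ := by rw [mul_neg, neg_mul, frame_xi1.d₁_e₂]
  d₂_e₂ := by rw [mulOp_neg, neg_mul_neg, neg_mul_neg, frame_xi1.d₁_e₁]
  parity_e₁ := frame_xi1.parity_e₂
  parity_e₂ := by rw [mulOp_neg, opParity_neg, frame_xi1.parity_e₁]
  d₁_d₁ := Dbar2_sq
  d₂_d₂ := by rw [neg_mul_neg, Dbar1_sq]
  d₁_dx := Dbar2_dx
  parity_d₁ := opParity_Dbar2
  parity_d₂ := by rw [opParity_neg, opParity_Dbar1]
  mul_e₁ := parityInv_mul_odd oddPart_xi2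
  mul_e₂ := parityInv_mul_odd (by ext1 <;> simp [oddPart, xi1])

/-! ### Moving contact fields past words in `∂ₓ`, `D̄₁`, `D̄₂` -/

/-- The factor `l` makes this true at `l = 0`, where `dxPow (-1) = 0` is not inverse to `∂ₓ`. -/
theorem smul_dxPow_sub_one_mul_dx (l : ℤ) : (l : ℂ) • (dxPow (l - 1) * dx) = (l : ℂ) • dxPow l := by
  rcases lt_trichotomy l 0 with h | rfl | h
  · rw [dxPow_neg h, dxPow_neg (by omega), zero_mul]
  · simp
  · obtain ⟨n, rfl⟩ : ∃ n : ℕ, l = n + 1 := ⟨(l - 1).toNat, by omega⟩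
    rw [add_sub_cancel_right, dxPow_natCast, ← pow_succ]
    norm_cast

theorem mul_dxPow_of_comm {A : Op} (h : A * dx = dx * A) (l : ℤ) : A * dxPow l = dxPow l * A := by
  unfold dxPow
  split_ifs
  · exact (show Commute A dx from h).pow_right _
  · simp

theorem opParity_dxPow (l : ℤ) : opParity (dxPow l) = dxPow l := by
  unfold dxPow
  split_ifs
  · induction l.toNat with
    | zero =>
      rw [pow_zero, ← mulOp_funOne, opParity_mulOp]
      congr 1
      ext1 <;> simp [parityInv_apply, funOne]
    | succ n ih => rw [pow_succ, opParity_mul, ih, opParity_dx]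
  · simp [opParity]

namespace Frame

variable {φ e₁ e₂ : SuperFun} {d₁ d₂ : Op}

theorem density_eq (F : Frame φ e₁ e₂ d₁ d₂) (w : ℂ) :
    densityAction w φ = contactField φ + w • mulOp e₁ := by
  rw [densityAction, F.dx_eq]

theorem density_d₁ (F : Frame φ e₁ e₂ d₁ d₂) (w : ℂ) : densityAction w φ * d₁
    = -(d₁ * densityAction w φ) + w • 1 - (1 / 2 : ℂ) • (mulOp e₁ * d₁)
      + (1 / 2 : ℂ) • (mulOp e₂ * d₂) := by
  rw [F.density_eq, add_mul, mul_add, F.field_d₁, smul_mul_assoc, mul_smul_comm, F.d₁_e₁]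
  module

theorem density_d₂ (F : Frame φ e₁ e₂ d₁ d₂) (w : ℂ) : densityAction w φ * d₂
    = -(d₂ * densityAction w φ) - (1 / 2 : ℂ) • (mulOp e₁ * d₂)
      - (1 / 2 : ℂ) • (mulOp e₂ * d₁) := by
  rw [F.density_eq, add_mul, mul_add, F.field_d₂, smul_mul_assoc, mul_smul_comm, F.d₂_e₁]
  module

theorem field_dx_pow (F : Frame φ e₁ e₂ d₁ d₂) (l : ℕ) : contactField φ * dx ^ l
    = dx ^ l * contactField φ - (l : ℂ) • (mulOp e₁ * dx ^ l)
      - (l / 2 : ℂ) • (dxPow ((l : ℤ) - 1) * d₁) := by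
  induction l with
  | zero => simp
  | succ l ih =>
    have h1 : dx ^ l * mulOp e₁ = mulOp e₁ * dx ^ l :=
      ((show Commute dx (mulOp e₁) from F.dx_e₁).pow_left l).eq
    have h2 := smul_dxPow_sub_one_mul_dx l
    rw [dxPow_natCast] at h2
    have h3 : (l / 2 : ℂ) • (dxPow ((l : ℤ) - 1) * d₁ * dx) = (l / 2 : ℂ) • (dx ^ l * d₁) := by
      rw [mul_assoc, F.d₁_dx, ← mul_assoc, div_eq_inv_mul, mul_smul, mul_smul,
        ← smul_mul_assoc (l : ℂ), ← smul_mul_assoc (l : ℂ)]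
      exact congrArg (fun A => (2⁻¹ : ℂ) • (A * d₁)) h2
    rw [pow_succ, ← mul_assoc, ih, sub_mul, sub_mul, smul_mul_assoc, smul_mul_assoc, h3,
      mul_assoc (dx ^ l), F.field_dx, mul_sub, mul_sub, ← mul_assoc (dx ^ l) (mulOp e₁), h1,
      mul_smul_comm, mul_assoc (mulOp e₁), mul_assoc (dx ^ l) dx, ← mul_assoc (mulOp e₁),
      show ((l + 1 : ℕ) : ℤ) - 1 = l by push_cast; ring, dxPow_natCast]
    push_cast
    module

/-- Moving the action on densities past a word in `∂ₓ, d₁, d₂`: besides a word with the coefficient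
`e₁`, which shifts the weight, and a rotation by `e₂`, only words of smaller contact order with
constant coefficients appear. -/
theorem density_dxPow (F : Frame φ e₁ e₂ d₁ d₂) (lam mu : ℂ) (l : ℤ) :
    densityAction mu φ * dxPow l
    = dxPow l * densityAction lam φ + (mu - lam - l) • (mulOp e₁ * dxPow l)
      - (l / 2 : ℂ) • (dxPow (l - 1) * d₁) := by
  rcases lt_or_ge l 0 with h | h
  · simp [dxPow_neg h, dxPow_neg (show l - 1 < 0 by omega)]
  · lift l to ℕ using h
    have h1 : dx ^ l * mulOp e₁ = mulOp e₁ * dx ^ l :=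
      ((show Commute dx (mulOp e₁) from F.dx_e₁).pow_left l).eq
    rw [dxPow_natCast, F.density_eq, F.density_eq, add_mul, mul_add, F.field_dx_pow,
      smul_mul_assoc, mul_smul_comm, h1]
    push_cast
    module

theorem smul_dxPow_d₁_d₁ (F : Frame φ e₁ e₂ d₁ d₂) (l : ℤ) :
    (l : ℂ) • (dxPow (l - 1) * d₁ * d₁) = -((l : ℂ) • dxPow l) := by
  rw [mul_assoc, F.d₁_d₁, mul_neg, smul_neg, smul_dxPow_sub_one_mul_dx]

theorem dxPow_e₁ (F : Frame φ e₁ e₂ d₁ d₂) (l : ℤ) : dxPow l * mulOp e₁ = mulOp e₁ * dxPow l :=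
  (mul_dxPow_of_comm F.dx_e₁.symm l).symm

theorem dxPow_e₂ (F : Frame φ e₁ e₂ d₁ d₂) (l : ℤ) : dxPow l * mulOp e₂ = mulOp e₂ * dxPow l :=
  (mul_dxPow_of_comm F.dx_e₂.symm l).symm

theorem density_dxPow_d₁ (F : Frame φ e₁ e₂ d₁ d₂) (lam mu : ℂ) (l : ℤ) :
    densityAction mu φ * (dxPow l * d₁)
    = -(dxPow l * d₁ * densityAction lam φ)
      + (mu - lam - l - 1 / 2) • (mulOp e₁ * (dxPow l * d₁))
      + (1 / 2 : ℂ) • (mulOp e₂ * (dxPow l * d₂)) + (lam + l / 2) • dxPow l := by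
  have h := F.smul_dxPow_d₁_d₁ l
  rw [← mul_assoc, F.density_dxPow lam, sub_mul, add_mul, mul_assoc (dxPow l), F.density_d₁]
  simp only [mul_add, mul_sub, mul_neg, mul_smul_comm, smul_mul_assoc, mul_one, ← mul_assoc,
    F.dxPow_e₁, F.dxPow_e₂]
  linear_combination (norm := module) (-1 / 2 : ℂ) • h

theorem density_dxPow_d₂ (F : Frame φ e₁ e₂ d₁ d₂) (lam mu : ℂ) (l : ℤ) :
    densityAction mu φ * (dxPow l * d₂)
    = -(dxPow l * d₂ * densityAction lam φ)
      + (mu - lam - l - 1 / 2) • (mulOp e₁ * (dxPow l * d₂))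
      - (1 / 2 : ℂ) • (mulOp e₂ * (dxPow l * d₁))
      - (l / 2 : ℂ) • (dxPow (l - 1) * d₁ * d₂) := by
  rw [← mul_assoc, F.density_dxPow lam, sub_mul, add_mul, mul_assoc (dxPow l), F.density_d₂]
  simp only [mul_sub, mul_neg, mul_smul_comm, smul_mul_assoc, ← mul_assoc,
    F.dxPow_e₁, F.dxPow_e₂]
  module

theorem density_dxPow_d₁_d₂ (F : Frame φ e₁ e₂ d₁ d₂) (lam mu : ℂ) (l : ℤ) :
    densityAction mu φ * (dxPow l * d₁ * d₂)
    = dxPow l * d₁ * d₂ * densityAction lam φ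
      + (mu - lam - l - 1) • (mulOp e₁ * (dxPow l * d₁ * d₂))
      + (lam + (l + 1) / 2) • (dxPow l * d₂) := by
  have h1 := F.d₁_e₁
  have h2 : mulOp e₂ * dxPow l * d₂ * d₂ = mulOp e₂ * dxPow l * d₁ * d₁ := by
    rw [mul_assoc _ d₂, mul_assoc _ d₁, F.d₁_d₁, F.d₂_d₂]
  have h3 : dxPow l * d₁ * mulOp e₁ = dxPow l - mulOp e₁ * dxPow l * d₁ := by
    rw [mul_assoc, F.d₁_e₁, mul_sub, ← mul_assoc, F.dxPow_e₁, mul_one]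
  have h4 : dxPow l * d₁ * mulOp e₂ = -(mulOp e₂ * dxPow l * d₁) := by
    rw [mul_assoc, F.d₁_e₂, mul_neg, ← mul_assoc, F.dxPow_e₂]
  rw [← mul_assoc, F.density_dxPow_d₁ lam]
  simp only [add_mul, neg_mul, smul_mul_assoc]
  rw [mul_assoc (dxPow l * d₁) _ d₂, F.density_d₂]
  simp only [mul_sub, mul_neg, mul_smul_comm, ← mul_assoc, h3, h4, sub_mul, neg_mul, h2]
  module

theorem opAction_eq (F : Frame φ e₁ e₂ d₁ d₂) (lam mu : ℂ) (A : Op) : opAction lam mu φ A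
    = densityAction mu φ * A - opParity A * densityAction lam φ := by
  have h : densityAction lam 0 = 0 := by simp [densityAction, contactField_zero, mulOp_zero]
  rw [opAction_apply, F.evenPart_eq, F.oddPart_eq, h, mul_zero, sub_zero]

theorem density_mulOp (F : Frame φ e₁ e₂ d₁ d₂) (mu : ℂ) (a : SuperFun) :
    densityAction mu φ * mulOp a
    = mulOp (contactField φ a) + mulOp (parityInv a) * densityAction mu φ := by
  rw [F.density_eq, add_mul, mul_add, F.field_mul, smul_mul_assoc, mul_smul_comm, mulOp_mulOp,
    mulOp_mulOp, F.mul_e₁, add_assoc]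

theorem mulOp_density_apply (F : Frame φ e₁ e₂ d₁ d₂) (w : ℂ) (a : SuperFun) :
    mulOp (densityAction w φ a)
      = mulOp (contactField φ a) + w • (mulOp (parityInv a) * mulOp e₁) := by
  rw [F.density_eq, mulOp_mulOp, F.mul_e₁, ← mulOp_smul w (e₁ * a), ← mulOp_add]
  rfl

/-- The action on a word with a function as its coefficient: the coefficient is acted on as a
density of weight `μ - λ` minus the contact order of the word, and words of smaller order appear. -/
theorem opAction_dxPow (F : Frame φ e₁ e₂ d₁ d₂) (lam mu : ℂ) (a : SuperFun) (l : ℤ) :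
    opAction lam mu φ (mulOp a * dxPow l)
      = mulOp (densityAction (mu - lam - l) φ a) * dxPow l
        - (l / 2 : ℂ) • (mulOp (parityInv a) * (dxPow (l - 1) * d₁)) := by
  rw [F.opAction_eq, opParity_mul, opParity_mulOp, opParity_dxPow, ← mul_assoc, F.density_mulOp,
    add_mul, mul_assoc _ (densityAction mu φ), F.density_dxPow lam, F.mulOp_density_apply]
  simp only [mul_add, add_mul, mul_sub, mul_smul_comm, smul_mul_assoc, ← mul_assoc]
  module

theorem opAction_dxPow_d₁ (F : Frame φ e₁ e₂ d₁ d₂) (lam mu : ℂ) (a : SuperFun) (l : ℤ) :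
    opAction lam mu φ (mulOp a * (dxPow l * d₁))
      = mulOp (densityAction (mu - lam - l - 1 / 2) φ a) * (dxPow l * d₁)
        + (1 / 2 : ℂ) • (mulOp (e₂ * a) * (dxPow l * d₂))
        + (lam + l / 2) • (mulOp (parityInv a) * dxPow l) := by
  rw [F.opAction_eq, opParity_mul, opParity_mul, opParity_mulOp, opParity_dxPow, F.parity_d₁,
    ← mul_assoc, F.density_mulOp, ← F.mul_e₂, ← mulOp_mulOp,
    add_mul, mul_assoc _ (densityAction mu φ), F.density_dxPow_d₁ lam, F.mulOp_density_apply]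
  simp only [mul_add, add_mul, mul_smul_comm, smul_mul_assoc, ← mul_assoc, mul_neg,
    neg_mul]
  module

theorem opAction_dxPow_d₂ (F : Frame φ e₁ e₂ d₁ d₂) (lam mu : ℂ) (a : SuperFun) (l : ℤ) :
    opAction lam mu φ (mulOp a * (dxPow l * d₂))
      = mulOp (densityAction (mu - lam - l - 1 / 2) φ a) * (dxPow l * d₂)
        - (1 / 2 : ℂ) • (mulOp (e₂ * a) * (dxPow l * d₁))
        - (l / 2 : ℂ) • (mulOp (parityInv a) * (dxPow (l - 1) * d₁ * d₂)) := by
  rw [F.opAction_eq, opParity_mul, opParity_mul, opParity_mulOp, opParity_dxPow, F.parity_d₂,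
    ← mul_assoc, F.density_mulOp, ← F.mul_e₂, ← mulOp_mulOp,
    add_mul, mul_assoc _ (densityAction mu φ), F.density_dxPow_d₂ lam, F.mulOp_density_apply]
  simp only [mul_add, add_mul, mul_sub, mul_smul_comm, smul_mul_assoc, ← mul_assoc, mul_neg,
    neg_mul]
  module

theorem opAction_dxPow_d₁_d₂ (F : Frame φ e₁ e₂ d₁ d₂) (lam mu : ℂ) (a : SuperFun) (l : ℤ) :
    opAction lam mu φ (mulOp a * (dxPow l * d₁ * d₂))
      = mulOp (densityAction (mu - lam - l - 1) φ a) * (dxPow l * d₁ * d₂)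
        + (lam + (l + 1) / 2) • (mulOp (parityInv a) * (dxPow l * d₂)) := by
  rw [F.opAction_eq, opParity_mul, opParity_mul, opParity_mul, opParity_mulOp, opParity_dxPow,
    F.parity_d₁, F.parity_d₂, ← mul_assoc, F.density_mulOp,
    add_mul, mul_assoc _ (densityAction mu φ), F.density_dxPow_d₁_d₂ lam, F.mulOp_density_apply]
  simp only [mul_add, add_mul, mul_smul_comm, smul_mul_assoc, ← mul_assoc, mul_neg,
    neg_mul]
  module

end Frame

/-! ### The defect of equivariance of the terms of the formula -/

theorem parityInv_dxPow (l : ℤ) (a : SuperFun) :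
    parityInv (dxPow l a) = dxPow l (parityInv a) := by
  have h := LinearMap.congr_fun (opParity_dxPow l) (parityInv a)
  rwa [show opParity (dxPow l) (parityInv a)
    = parityInv (dxPow l ((parityInv * parityInv) a)) from rfl, parityInv_sq] at h

theorem parityInv_parityInv (a : SuperFun) : parityInv (parityInv a) = a :=
  LinearMap.congr_fun parityInv_sq a

namespace Frame

variable {φ e₁ e₂ : SuperFun} {d₁ d₂ : Op}

/-- The action on `∂ₓ^l a`, for a density `a` of weight `w`: at the weight `w + l` the terms with
the coefficient `e₁` cancel. -/
theorem density_dxPow_apply (F : Frame φ e₁ e₂ d₁ d₂) {w w' : ℂ} {l : ℤ} (h : w' = w + l)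
    (a : SuperFun) : densityAction w' φ (dxPow l a)
      = dxPow l (densityAction w φ a) - (l / 2 : ℂ) • dxPow (l - 1) (d₁ a) := by
  have := LinearMap.congr_fun (F.density_dxPow w w' l) a
  rw [show w' - w - l = 0 by rw [h]; ring, zero_smul, add_zero] at this
  exact this

theorem density_d₁_apply (F : Frame φ e₁ e₂ d₁ d₂) {w w' : ℂ} {l : ℤ} (h : w' = w + l + 1 / 2)
    (a : SuperFun) : densityAction w' φ (dxPow l (d₁ a))
      = -dxPow l (d₁ (densityAction w φ a)) + (1 / 2 : ℂ) • mulOp e₂ (dxPow l (d₂ a))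
        + (w + l / 2) • dxPow l a := by
  have := LinearMap.congr_fun (F.density_dxPow_d₁ w w' l) a
  rw [show w' - w - l - 1 / 2 = 0 by rw [h]; ring, zero_smul, add_zero] at this
  exact this

theorem density_d₂_apply (F : Frame φ e₁ e₂ d₁ d₂) {w w' : ℂ} {l : ℤ} (h : w' = w + l + 1 / 2)
    (a : SuperFun) : densityAction w' φ (dxPow l (d₂ a))
      = -dxPow l (d₂ (densityAction w φ a)) - (1 / 2 : ℂ) • mulOp e₂ (dxPow l (d₁ a))
        - (l / 2 : ℂ) • dxPow (l - 1) (d₁ (d₂ a)) := by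
  have := LinearMap.congr_fun (F.density_dxPow_d₂ w w' l) a
  rw [show w' - w - l - 1 / 2 = 0 by rw [h]; ring, zero_smul, add_zero] at this
  exact this

theorem density_d₁_d₂_apply (F : Frame φ e₁ e₂ d₁ d₂) {w w' : ℂ} {l : ℤ} (h : w' = w + l + 1)
    (a : SuperFun) : densityAction w' φ (dxPow l (d₁ (d₂ a)))
      = dxPow l (d₁ (d₂ (densityAction w φ a))) + (w + (l + 1) / 2) • dxPow l (d₂ a) := by
  have := LinearMap.congr_fun (F.density_dxPow_d₁_d₂ w w' l) a
  rw [show w' - w - l - 1 = 0 by rw [h]; ring, zero_smul, add_zero] at this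
  exact this

theorem parityInv_d₁ (F : Frame φ e₁ e₂ d₁ d₂) (a : SuperFun) :
    parityInv (d₁ (parityInv a)) = -d₁ a := LinearMap.congr_fun F.parity_d₁ a

theorem parityInv_d₂ (F : Frame φ e₁ e₂ d₁ d₂) (a : SuperFun) :
    parityInv (d₂ (parityInv a)) = -d₂ a := LinearMap.congr_fun F.parity_d₂ a

theorem parityInv_d₁_d₂ (F : Frame φ e₁ e₂ d₁ d₂) (a : SuperFun) :
    parityInv (d₁ (d₂ a)) = d₁ (d₂ (parityInv a)) := by
  have h1 := F.parityInv_d₁ (parityInv (d₂ a))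
  have h2 := F.parityInv_d₂ (parityInv a)
  rw [parityInv_parityInv] at h1 h2
  rw [h1, h2, map_neg, neg_neg]

theorem density_parity (F : Frame φ e₁ e₂ d₁ d₂) (w : ℂ) (a : SuperFun) :
    parityInv (densityAction w φ a) = -densityAction w φ (parityInv a) := by
  have h : opParity (densityAction w φ) = -densityAction w φ := by
    rw [F.density_eq, opParity_add, opParity_smul, F.field_parity, F.parity_e₁]
    module
  have := LinearMap.congr_fun h (parityInv a)
  rwa [show opParity (densityAction w φ) (parityInv a)
    = parityInv (densityAction w φ (parityInv (parityInv a))) from rfl,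
    parityInv_parityInv] at this

theorem e₂_parity (F : Frame φ e₁ e₂ d₁ d₂) (a : SuperFun) :
    parityInv (mulOp e₂ a) = -mulOp e₂ (parityInv a) := by
  have := LinearMap.congr_fun F.parity_e₂ (parityInv a)
  rwa [show opParity (mulOp e₂) (parityInv a)
    = parityInv (mulOp e₂ (parityInv (parityInv a))) from rfl,
    parityInv_parityInv] at this

theorem d₁_e₂_apply (F : Frame φ e₁ e₂ d₁ d₂) (a : SuperFun) :
    d₁ (mulOp e₂ a) = -mulOp e₂ (d₁ a) := LinearMap.congr_fun F.d₁_e₂ a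

theorem d₂_e₂_apply (F : Frame φ e₁ e₂ d₁ d₂) (a : SuperFun) :
    d₂ (mulOp e₂ a) = a - mulOp e₂ (d₂ a) := LinearMap.congr_fun F.d₂_e₂ a

theorem dxPow_e₂_apply (F : Frame φ e₁ e₂ d₁ d₂) (l : ℤ) (a : SuperFun) :
    dxPow l (mulOp e₂ a) = mulOp e₂ (dxPow l a) := LinearMap.congr_fun (F.dxPow_e₂ l) a

end Frame

/-- The four families of terms, with `q` derivatives and in the frame `(d₁, d₂)`, of an operator
with symbol `(F₁, F₂)` of integer contact order `K`, with undetermined coefficients. The sign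
`(-1)^p` is expressed by `parityInv`, which makes the terms linear in `(F₁, F₂)`. -/
def intTerm (d₁ d₂ : Op) (K q : ℤ) (α β γ ε u v : ℂ) (F₁ F₂ : SuperFun) : Op :=
  mulOp (α • dxPow q F₁ + β • dxPow (q - 1) (d₁ (d₂ F₂))) * dxPow (K - q)
    + mulOp (γ • dxPow q F₂ - ε • dxPow (q - 1) (d₁ (d₂ F₁))) * (dxPow (K - q - 1) * d₁ * d₂)
    + mulOp (-(u • dxPow q (d₁ (parityInv F₁)) + v • dxPow q (d₂ (parityInv F₂))))
      * (dxPow (K - q - 1) * d₁)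
    + mulOp (-(u • dxPow q (d₂ (parityInv F₁)) - v • dxPow q (d₁ (parityInv F₂))))
      * (dxPow (K - q - 1) * d₂)

/-- The common part of the defects of equivariance of the terms with `q - 1` and with `q`
derivatives in integer contact order; it enters them with opposite signs. -/
def intRemainder (d₁ d₂ : Op) (lam : ℂ) (K q : ℤ) (u v : ℂ) (F₁ F₂ : SuperFun) : Op :=
  (lam + (K - q) / 2) • (mulOp (u • dxPow (q - 1) (d₁ F₁) + v • dxPow (q - 1) (d₂ F₂))
      * dxPow (K - q))
    - ((K - q) / 2 : ℂ) • (mulOp (u • dxPow (q - 1) (d₂ F₁) - v • dxPow (q - 1) (d₁ F₂))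
      * (dxPow (K - q - 1) * d₁ * d₂))

/-- If the coefficients of the terms with `q` derivatives satisfy the given relations to each other
and to the coefficients `u', v'` of the terms with `q - 1` derivatives, the defect of equivariance
is the difference of two remainders with consecutive indices. -/
theorem Frame.opAction_intTerm {φ e₁ e₂ : SuperFun} {d₁ d₂ : Op} (F : Frame φ e₁ e₂ d₁ d₂)
    (lam mu : ℂ) (K q : ℤ) {N α β γ ε u v u' v' : ℂ} (hN : N = 2 * K - 2 * (mu - lam))
    (hα : α * q = (2 * lam + K - q) * u') (hβ : β * (N - q) = (2 * lam + K - q) * v')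
    (hγ : γ * q = (K - q) * v') (hε : ε * (N - q) = (K - q) * u')
    (hu : u * (N - q) = (K - q) * α) (hv : v * q = (K - q) * β)
    (hv' : v * (N - q) = (2 * lam + K - q) * γ) (hu' : u * q = (2 * lam + K - q) * ε)
    (F₁ F₂ : SuperFun) :
    opAction lam mu φ (intTerm d₁ d₂ K q α β γ ε u v F₁ F₂)
      - intTerm d₁ d₂ K q α β γ ε u v (densityAction (mu - lam - K) φ F₁)
          (densityAction (mu - lam - K) φ F₂)
      = intRemainder d₁ d₂ lam K (q + 1) u v F₁ F₂ - intRemainder d₁ d₂ lam K q u' v' F₁ F₂ := by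
  set w : ℂ := mu - lam - K with hw
  have hNw : N = -2 * w := by rw [hN, hw]; ring
  -- The action on the coefficient of each of the four words.
  have hA : densityAction (mu - lam - (K - q : ℤ)) φ
        (α • dxPow q F₁ + β • dxPow (q - 1) (d₁ (d₂ F₂)))
      = α • dxPow q (densityAction w φ F₁) + β • dxPow (q - 1) (d₁ (d₂ (densityAction w φ F₂)))
        - (lam + (K - q) / 2) • (u' • dxPow (q - 1) (d₁ F₁) + v' • dxPow (q - 1) (d₂ F₂)) := by
    rw [map_add, map_smul, map_smul,
      F.density_dxPow_apply (w := w) (by rw [hw]; push_cast; ring),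
      F.density_d₁_d₂_apply (w := w) (by rw [hw]; push_cast; ring)]
    push_cast
    match_scalars
    · ring
    · linear_combination (-1 / 2) * hα
    · ring
    · linear_combination (-1 / 2) * hβ + (β / 2) * hNw
  have hB : densityAction (mu - lam - (K - q - 1 : ℤ) - 1) φ
        (γ • dxPow q F₂ - ε • dxPow (q - 1) (d₁ (d₂ F₁)))
      = γ • dxPow q (densityAction w φ F₂) - ε • dxPow (q - 1) (d₁ (d₂ (densityAction w φ F₁)))
        + ((K - q) / 2 : ℂ) • (u' • dxPow (q - 1) (d₂ F₁) - v' • dxPow (q - 1) (d₁ F₂)) := by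
    rw [map_sub, map_smul, map_smul,
      F.density_dxPow_apply (w := w) (by rw [hw]; push_cast; ring),
      F.density_d₁_d₂_apply (w := w) (by rw [hw]; push_cast; ring)]
    push_cast
    match_scalars
    · ring
    · linear_combination (-1 / 2) * hγ
    · ring
    · linear_combination (1 / 2) * hε - (ε / 2) * hNw
  have hC : densityAction (mu - lam - (K - q - 1 : ℤ) - 1 / 2) φ
        (-(u • dxPow q (d₁ (parityInv F₁)) + v • dxPow q (d₂ (parityInv F₂))))
      = -(u • dxPow q (d₁ (parityInv (densityAction w φ F₁)))
          + v • dxPow q (d₂ (parityInv (densityAction w φ F₂))))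
        + (1 / 2 : ℂ) • mulOp e₂
            (-(u • dxPow q (d₂ (parityInv F₁)) - v • dxPow q (d₁ (parityInv F₂))))
        + ((K - q) / 2 : ℂ) • (α • dxPow q (parityInv F₁)
            + β • dxPow (q - 1) (d₁ (d₂ (parityInv F₂)))) := by
    simp only [map_neg, map_add, map_sub, map_smul, F.density_parity]
    rw [F.density_d₁_apply (w := w) (by rw [hw]; push_cast; ring),
      F.density_d₂_apply (w := w) (by rw [hw]; push_cast; ring)]
    match_scalars
    · ring
    · ring
    · linear_combination (1 / 2) * hu - (u / 2) * hNw
    · ring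
    · ring
    · linear_combination (1 / 2) * hv
  have hE : densityAction (mu - lam - (K - q - 1 : ℤ) - 1 / 2) φ
        (-(u • dxPow q (d₂ (parityInv F₁)) - v • dxPow q (d₁ (parityInv F₂))))
      = -(u • dxPow q (d₂ (parityInv (densityAction w φ F₁)))
          - v • dxPow q (d₁ (parityInv (densityAction w φ F₂))))
        - (1 / 2 : ℂ) • mulOp e₂
            (-(u • dxPow q (d₁ (parityInv F₁)) + v • dxPow q (d₂ (parityInv F₂))))
        - (lam + (K - q) / 2 : ℂ) • (γ • dxPow q (parityInv F₂)
            - ε • dxPow (q - 1) (d₁ (d₂ (parityInv F₁)))) := by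
    simp only [map_neg, map_add, map_sub, map_smul, F.density_parity]
    rw [F.density_d₁_apply (w := w) (by rw [hw]; push_cast; ring),
      F.density_d₂_apply (w := w) (by rw [hw]; push_cast; ring)]
    match_scalars
    · ring
    · ring
    · linear_combination (1 / 2) * hu'
    · ring
    · ring
    · linear_combination (-1 / 2) * hv' + (v / 2) * hNw
  unfold intTerm
  rw [map_add, map_add, map_add, F.opAction_dxPow, F.opAction_dxPow_d₁_d₂, F.opAction_dxPow_d₁,
    F.opAction_dxPow_d₂, hA, hB, hC, hE]
  unfold intRemainder
  rw [show K - (q + 1) = K - q - 1 by ring, add_sub_cancel_right]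
  simp only [← mulOp_apply e₂, map_add, map_sub, map_neg, map_smul, parityInv_dxPow,
    F.parityInv_d₁, F.parityInv_d₂, F.parityInv_d₁_d₂, mulOp_add, mulOp_sub, mulOp_neg,
    mulOp_smul, add_mul, sub_mul, neg_mul, smul_mul_assoc]
  push_cast
  module

/-- The terms with `q` derivatives, in the frame `(d₁, d₂)`, of an operator with symbol `(F₁, F₂)`
of half-integer contact order `K + 1/2`, with undetermined coefficients. -/
def halfTerm (d₁ d₂ : Op) (K q : ℤ) (α β c e : ℂ) (F₁ F₂ : SuperFun) : Op :=
  mulOp (α • dxPow q F₁ + β • dxPow (q - 1) (d₁ (d₂ F₂))) * (dxPow (K - q) * d₁)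
    + mulOp (α • dxPow q F₂ - β • dxPow (q - 1) (d₁ (d₂ F₁))) * (dxPow (K - q) * d₂)
    + mulOp (c • (dxPow q (d₁ (parityInv F₁)) + dxPow q (d₂ (parityInv F₂)))) * dxPow (K - q)
    + mulOp (e • (dxPow q (d₂ (parityInv F₁)) - dxPow q (d₁ (parityInv F₂))))
      * (dxPow (K - q - 1) * d₁ * d₂)

/-- The common part of the defects of equivariance of the terms with `q - 1` and with `q`
derivatives in half-integer contact order; it enters them with opposite signs. -/
def halfRemainder (d₁ d₂ : Op) (lam : ℂ) (K q : ℤ) (c e : ℂ) (F₁ F₂ : SuperFun) : Op :=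
  ((K - q + 1) / 2 : ℂ) • (mulOp (c • (dxPow (q - 1) (d₁ F₁) + dxPow (q - 1) (d₂ F₂)))
      * (dxPow (K - q) * d₁))
    - (lam + (K - q + 1) / 2) • (mulOp (e • (dxPow (q - 1) (d₂ F₁) - dxPow (q - 1) (d₁ F₂)))
      * (dxPow (K - q) * d₂))

/-- The analogue of `Frame.opAction_intTerm` for half-integer contact order. The components `F₁, F₂`
of the symbol are now rotated into one another by `e₂`. -/
theorem Frame.opAction_halfTerm {φ e₁ e₂ : SuperFun} {d₁ d₂ : Op} (F : Frame φ e₁ e₂ d₁ d₂)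
    (lam mu : ℂ) (K q : ℤ) {N α β c e c' e' : ℂ} (hN : N = 2 * K + 1 - 2 * (mu - lam))
    (hαβ : α * q + β = β * (N - q)) (hc' : β * (N - q) = (K - q + 1) * c')
    (he' : β * (N - q) = (2 * lam + K - q + 1) * e')
    (hc : c * (N - q - 1) = (2 * lam + K - q) * α) (hcq : c * q = (2 * lam + K - q) * β)
    (he : e * (N - q - 1) = (K - q) * α) (heq : e * q = (K - q) * β)
    (F₁ F₂ : SuperFun) :
    opAction lam mu φ (halfTerm d₁ d₂ K q α β c e F₁ F₂)
      - halfTerm d₁ d₂ K q α β c e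
          (densityAction (mu - lam - K - 1 / 2) φ F₁ - (1 / 2 : ℂ) • mulOp e₂ F₂)
          (densityAction (mu - lam - K - 1 / 2) φ F₂ + (1 / 2 : ℂ) • mulOp e₂ F₁)
      = halfRemainder d₁ d₂ lam K (q + 1) c e F₁ F₂ - halfRemainder d₁ d₂ lam K q c' e' F₁ F₂ := by
  set w : ℂ := mu - lam - K - 1 / 2 with hw
  have hNw : N = -2 * w := by rw [hN, hw]; ring
  -- The action on the coefficient of each of the four words.
  have hA : densityAction (mu - lam - (K - q : ℤ) - 1 / 2) φ
        (α • dxPow q F₁ + β • dxPow (q - 1) (d₁ (d₂ F₂)))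
      = α • dxPow q (densityAction w φ F₁ - (1 / 2 : ℂ) • mulOp e₂ F₂)
        + β • dxPow (q - 1) (d₁ (d₂ (densityAction w φ F₂ + (1 / 2 : ℂ) • mulOp e₂ F₁)))
        + (1 / 2 : ℂ) • mulOp e₂ (α • dxPow q F₂ - β • dxPow (q - 1) (d₁ (d₂ F₁)))
        - ((K - q + 1) / 2 : ℂ) • (c' • (dxPow (q - 1) (d₁ F₁) + dxPow (q - 1) (d₂ F₂))) := by
    simp only [map_add, map_sub, map_smul, F.d₁_e₂_apply, F.d₂_e₂_apply, F.dxPow_e₂_apply, map_neg]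
    rw [F.density_dxPow_apply (w := w) (by rw [hw]; push_cast; ring),
      F.density_d₁_d₂_apply (w := w) (by rw [hw]; push_cast; ring)]
    push_cast
    match_scalars
    · ring
    · linear_combination (-1 / 2) * hαβ + (-1 / 2) * hc'
    · ring
    · linear_combination (-1 / 2) * hc' + (β / 2) * hNw
    · ring
    · ring
  have hB : densityAction (mu - lam - (K - q : ℤ) - 1 / 2) φ
        (α • dxPow q F₂ - β • dxPow (q - 1) (d₁ (d₂ F₁)))
      = α • dxPow q (densityAction w φ F₂ + (1 / 2 : ℂ) • mulOp e₂ F₁)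
        - β • dxPow (q - 1) (d₁ (d₂ (densityAction w φ F₁ - (1 / 2 : ℂ) • mulOp e₂ F₂)))
        - (1 / 2 : ℂ) • mulOp e₂ (α • dxPow q F₁ + β • dxPow (q - 1) (d₁ (d₂ F₂)))
        + (lam + (K - q + 1) / 2) •
            (e' • (dxPow (q - 1) (d₂ F₁) - dxPow (q - 1) (d₁ F₂))) := by
    simp only [map_add, map_sub, map_smul, F.d₁_e₂_apply, F.d₂_e₂_apply, F.dxPow_e₂_apply, map_neg]
    rw [F.density_dxPow_apply (w := w) (by rw [hw]; push_cast; ring),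
      F.density_d₁_d₂_apply (w := w) (by rw [hw]; push_cast; ring)]
    push_cast
    match_scalars
    · ring
    · linear_combination (-1 / 2) * hαβ + (-1 / 2) * he'
    · ring
    · linear_combination (1 / 2) * he' - (β / 2) * hNw
    · ring
    · ring
  have hC : densityAction (mu - lam - (K - q : ℤ)) φ
        (c • (dxPow q (d₁ (parityInv F₁)) + dxPow q (d₂ (parityInv F₂))))
      = c • (dxPow q (d₁ (parityInv (densityAction w φ F₁ - (1 / 2 : ℂ) • mulOp e₂ F₂)))
          + dxPow q (d₂ (parityInv (densityAction w φ F₂ + (1 / 2 : ℂ) • mulOp e₂ F₁))))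
        - (lam + (K - q) / 2 : ℂ) • (α • dxPow q (parityInv F₁)
            + β • dxPow (q - 1) (d₁ (d₂ (parityInv F₂)))) := by
    simp only [map_neg, map_add, map_sub, map_smul, F.density_parity, F.d₁_e₂_apply,
      F.d₂_e₂_apply, F.dxPow_e₂_apply, F.e₂_parity]
    rw [F.density_d₁_apply (w := w) (by rw [hw]; push_cast; ring),
      F.density_d₂_apply (w := w) (by rw [hw]; push_cast; ring)]
    match_scalars
    · ring
    · ring
    · linear_combination (-1 / 2) * hc + (c / 2) * hNw
    · ring
    · ring
    · linear_combination (-1 / 2) * hcq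
  have hE : densityAction (mu - lam - (K - q - 1 : ℤ) - 1) φ
        (e • (dxPow q (d₂ (parityInv F₁)) - dxPow q (d₁ (parityInv F₂))))
      = e • (dxPow q (d₂ (parityInv (densityAction w φ F₁ - (1 / 2 : ℂ) • mulOp e₂ F₂)))
          - dxPow q (d₁ (parityInv (densityAction w φ F₂ + (1 / 2 : ℂ) • mulOp e₂ F₁))))
        + ((K - q) / 2 : ℂ) • (α • dxPow q (parityInv F₂)
            - β • dxPow (q - 1) (d₁ (d₂ (parityInv F₁)))) := by
    simp only [map_neg, map_add, map_sub, map_smul, F.density_parity, F.d₁_e₂_apply,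
      F.d₂_e₂_apply, F.dxPow_e₂_apply, F.e₂_parity]
    rw [F.density_d₁_apply (w := w) (by rw [hw]; push_cast; ring),
      F.density_d₂_apply (w := w) (by rw [hw]; push_cast; ring)]
    match_scalars
    · ring
    · ring
    · linear_combination (-1 / 2) * heq
    · ring
    · ring
    · linear_combination (1 / 2) * he - (e / 2) * hNw
  unfold halfTerm
  rw [map_add, map_add, map_add, F.opAction_dxPow, F.opAction_dxPow_d₁_d₂, F.opAction_dxPow_d₁,
    F.opAction_dxPow_d₂, hA, hB, hC, hE]
  unfold halfRemainder
  rw [show K - (q + 1) = K - q - 1 by ring, add_sub_cancel_right]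
  simp only [← mulOp_apply e₂, map_add, map_sub, map_neg, map_smul, parityInv_dxPow,
    F.parityInv_d₁, F.parityInv_d₂, F.parityInv_d₁_d₂, mulOp_add, mulOp_sub, mulOp_neg,
    mulOp_smul, add_mul, sub_mul, neg_mul, smul_mul_assoc]
  push_cast
  module

/-! ### The coefficients and their recursions -/

theorem gbinom_zero (z : ℂ) : gbinom z 0 = 1 := by simp [gbinom]

theorem gbinom_neg (z : ℂ) {m : ℤ} (h : m < 0) : gbinom z m = 0 := by simp [gbinom, not_le.2 h]

theorem succ_mul_gbinom_succ (z : ℂ) (m : ℤ) :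
    (m + 1) * gbinom z (m + 1) = (z - m) * gbinom z m := by
  rcases lt_trichotomy m (-1) with h | rfl | h
  · rw [gbinom_neg z (show m + 1 < 0 by omega), gbinom_neg z (show m < 0 by omega), mul_zero,
      mul_zero]
  · rw [gbinom_neg z (show (-1 : ℤ) < 0 by omega)]; simp
  · lift m to ℕ using (by omega)
    have h1 : ((m.factorial : ℕ) : ℂ) ≠ 0 := Nat.cast_ne_zero.2 m.factorial_ne_zero
    have h2 : (m + 1 : ℂ) ≠ 0 := Nat.cast_add_one_ne_zero m
    rw [gbinom, gbinom, if_pos (by omega), if_pos (by omega),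
      show ((m : ℤ) + 1).toNat = m + 1 by omega, Int.toNat_natCast, Finset.prod_range_succ,
      Nat.factorial_succ]
    push_cast
    field_simp

theorem mul_gbinom (z : ℂ) (m : ℤ) : m * gbinom z m = (z - m + 1) * gbinom z (m - 1) := by
  have h := succ_mul_gbinom_succ z (m - 1)
  rw [sub_add_cancel] at h
  push_cast at h
  linear_combination h

theorem gbinom_ne_zero {z : ℂ} {m : ℤ} (hm : 0 ≤ m) (h : ∀ i : ℕ, (i : ℤ) < m → z ≠ i) :
    gbinom z m ≠ 0 := by
  rw [gbinom, if_pos hm]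
  refine div_ne_zero (Finset.prod_ne_zero_iff.2 fun i hi => sub_ne_zero.2 (h i ?_))
    (Nat.cast_ne_zero.2 (Nat.factorial_ne_zero _))
  rw [Finset.mem_range] at hi
  omega

/-- Consecutive quotients of binomial coefficients. -/
theorem gbinom_div_gbinom_succ (z : ℂ) {N : ℂ} {q : ℤ} (h : gbinom N q ≠ 0)
    (h' : gbinom N (q + 1) ≠ 0) :
    gbinom z (q + 1) / gbinom N (q + 1) * (N - q) = (z - q) * (gbinom z q / gbinom N q) := by
  have h1 := succ_mul_gbinom_succ z q
  have h2 := succ_mul_gbinom_succ N q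
  field_simp
  linear_combination gbinom N (q + 1) * h1 - gbinom z (q + 1) * h2

/-! The identities below are the assumptions of `Frame.opAction_intTerm`. -/

section Coefficients

variable (lam N : ℂ) (K : ℕ) (q : ℤ)

/-- Coefficient of `∂^q F₁ ∂^{K-q}` in the quantization of integer contact order `K`. -/
def intα : ℂ := gbinom K q * gbinom (K - 1 + 2 * lam) q / gbinom N q
/-- Coefficient of `∂^{q-1} D̄₁ D̄₂ F₂ ∂^{K-q}`. -/
def intβ : ℂ := gbinom ((K : ℂ) - 1) (q - 1) * gbinom (K + 2 * lam) (q + 1) / gbinom N (q + 1)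
/-- Coefficient of `∂^q F₂ ∂^{K-q-1} D̄₁ D̄₂`. -/
def intγ : ℂ := gbinom ((K : ℂ) - 1) q * gbinom (K + 2 * lam) q / gbinom N q
/-- Coefficient of `-∂^{q-1} D̄₁ D̄₂ F₁ ∂^{K-q-1} D̄₁ D̄₂`. -/
def intε : ℂ := gbinom K (q + 1) * gbinom (K - 1 + 2 * lam) (q - 1) / gbinom N (q + 1)
/-- Coefficient of `∂^q D̄ᵢ F₁ ∂^{K-q-1} D̄ᵢ`, up to the sign `(-1)^{p+1}`. -/
def intu : ℂ := gbinom K (q + 1) * gbinom (K - 1 + 2 * lam) q / gbinom N (q + 1)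
/-- Coefficient of `± ∂^q D̄ⱼ F₂ ∂^{K-q-1} D̄ᵢ` with `j ≠ i`, up to the sign `(-1)^{p+1}`. -/
def intv : ℂ := gbinom ((K : ℂ) - 1) q * gbinom (K + 2 * lam) (q + 1) / gbinom N (q + 1)

variable {lam N K q}

theorem intα_mul : intα lam N K q * q = (2 * lam + K - q) * intu lam N K (q - 1) := by
  rw [intα, intu, sub_add_cancel]
  linear_combination (gbinom K q / gbinom N q) * mul_gbinom (K - 1 + 2 * lam) q

theorem intγ_mul : intγ lam N K q * q = (K - q) * intv lam N K (q - 1) := by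
  rw [intγ, intv, sub_add_cancel]
  linear_combination (gbinom (K + 2 * lam) q / gbinom N q) * mul_gbinom ((K : ℂ) - 1) q

theorem intv_mul : intv lam N K q * q = (K - q) * intβ lam N K q := by
  rw [intβ, intv]
  linear_combination (gbinom (K + 2 * lam) (q + 1) / gbinom N (q + 1)) *
    mul_gbinom ((K : ℂ) - 1) q

theorem intu_mul : intu lam N K q * q = (2 * lam + K - q) * intε lam N K q := by
  rw [intε, intu]
  linear_combination (gbinom K (q + 1) / gbinom N (q + 1)) * mul_gbinom (K - 1 + 2 * lam) q

theorem intβ_mul (h : gbinom N q ≠ 0) (h' : gbinom N (q + 1) ≠ 0) :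
    intβ lam N K q * (N - q) = (2 * lam + K - q) * intv lam N K (q - 1) := by
  rw [intβ, intv, sub_add_cancel]
  linear_combination gbinom ((K : ℂ) - 1) (q - 1) * gbinom_div_gbinom_succ (K + 2 * lam) h h'

theorem intε_mul (h : gbinom N q ≠ 0) (h' : gbinom N (q + 1) ≠ 0) :
    intε lam N K q * (N - q) = (K - q) * intu lam N K (q - 1) := by
  rw [intε, intu, sub_add_cancel]
  linear_combination gbinom (K - 1 + 2 * lam) (q - 1) * gbinom_div_gbinom_succ (K : ℂ) h h'

theorem intu_mul' (h : gbinom N q ≠ 0) (h' : gbinom N (q + 1) ≠ 0) :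
    intu lam N K q * (N - q) = (K - q) * intα lam N K q := by
  rw [intα, intu]
  linear_combination gbinom (K - 1 + 2 * lam) q * gbinom_div_gbinom_succ (K : ℂ) h h'

theorem intv_mul' (h : gbinom N q ≠ 0) (h' : gbinom N (q + 1) ≠ 0) :
    intv lam N K q * (N - q) = (2 * lam + K - q) * intγ lam N K q := by
  rw [intγ, intv]
  linear_combination gbinom ((K : ℂ) - 1) q * gbinom_div_gbinom_succ (K + 2 * lam) h h'

end Coefficients

/-! The identities below lead to the assumptions of `Frame.opAction_halfTerm`. -/

section HalfCoefficients

variable (lam N : ℂ) (K : ℕ) (q : ℤ)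

/-- The common factor of the coefficients of `∂^q Fᵢ` and of `∂^{q-1} D̄₁ D̄₂ Fᵢ` in the
quantization of half-integer contact order `K + 1/2`. -/
def halfg : ℂ := N / (N - 1) * gbinom K q * gbinom (K + 2 * lam) q / gbinom N q
/-- Coefficient of `∂^q Fᵢ ∂^{K-q} D̄ᵢ`. -/
def halfα : ℂ := halfg lam N K q * ((N - q - 1) / (N - q))
/-- Coefficient of `± ∂^{q-1} D̄₁ D̄₂ Fⱼ ∂^{K-q} D̄ᵢ` with `j ≠ i`. -/
def halfβ : ℂ := halfg lam N K q * (q / (N - q))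
/-- Coefficient of `∂^q (D̄₁ F₁ + D̄₂ F₂) ∂^{K-q}`, up to the sign `(-1)^p`. -/
def halfc : ℂ := N / (N - 1) * gbinom K q * gbinom (K + 2 * lam) (q + 1) / gbinom N (q + 1)
/-- Coefficient of `∂^q (D̄₂ F₁ - D̄₁ F₂) ∂^{K-q-1} D̄₁ D̄₂`, up to the sign `(-1)^p`. -/
def halfe : ℂ := N / (N - 1) * gbinom K (q + 1) * gbinom (K + 2 * lam) q / gbinom N (q + 1)

variable {lam N K q}

theorem halfβ_mul (h : N - q ≠ 0) : halfβ lam N K q * (N - q) = halfg lam N K q * q := by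
  rw [halfβ]; field_simp

theorem halfα_mul (h : N - q ≠ 0) :
    halfα lam N K q * (N - q) = halfg lam N K q * (N - q - 1) := by
  rw [halfα]; field_simp

theorem halfα_mul_add (h : N - q ≠ 0) :
    halfα lam N K q * q + halfβ lam N K q = halfβ lam N K q * (N - q) := by
  rw [halfα, halfβ]; field_simp; ring

theorem halfβ_mul_c (h : N - q ≠ 0) :
    halfβ lam N K q * (N - q) = (K - q + 1) * halfc lam N K (q - 1) := by
  rw [halfβ_mul h, halfg, halfc, sub_add_cancel]
  linear_combination (N / (N - 1) * gbinom (K + 2 * lam) q / gbinom N q) * mul_gbinom (K : ℂ) q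

theorem halfβ_mul_e (h : N - q ≠ 0) :
    halfβ lam N K q * (N - q) = (2 * lam + K - q + 1) * halfe lam N K (q - 1) := by
  rw [halfβ_mul h, halfg, halfe, sub_add_cancel]
  linear_combination (N / (N - 1) * gbinom K q / gbinom N q) * mul_gbinom (K + 2 * lam) q

theorem halfc_mul_sub (h0 : gbinom N q ≠ 0) (h1 : gbinom N (q + 1) ≠ 0) :
    halfc lam N K q * (N - q) = (2 * lam + K - q) * halfg lam N K q := by
  rw [halfc, halfg]
  linear_combination (N / (N - 1) * gbinom K q) * gbinom_div_gbinom_succ (K + 2 * lam) h0 h1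

theorem halfe_mul_sub (h0 : gbinom N q ≠ 0) (h1 : gbinom N (q + 1) ≠ 0) :
    halfe lam N K q * (N - q) = (K - q) * halfg lam N K q := by
  rw [halfe, halfg]
  linear_combination (N / (N - 1) * gbinom (K + 2 * lam) q) *
    gbinom_div_gbinom_succ (K : ℂ) h0 h1

theorem halfc_mul_α (h : N - q ≠ 0) (h0 : gbinom N q ≠ 0) (h1 : gbinom N (q + 1) ≠ 0) :
    halfc lam N K q * (N - q - 1) = (2 * lam + K - q) * halfα lam N K q := by
  apply mul_right_cancel₀ h
  linear_combination (N - q - 1) * halfc_mul_sub (lam := lam) (K := K) h0 h1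
    - (2 * lam + K - q) * halfα_mul (lam := lam) (K := K) h

theorem halfc_mul_β (h : N - q ≠ 0) (h0 : gbinom N q ≠ 0) (h1 : gbinom N (q + 1) ≠ 0) :
    halfc lam N K q * q = (2 * lam + K - q) * halfβ lam N K q := by
  apply mul_right_cancel₀ h
  linear_combination q * halfc_mul_sub (lam := lam) (K := K) h0 h1
    - (2 * lam + K - q) * halfβ_mul (lam := lam) (K := K) h

theorem halfe_mul_α (h : N - q ≠ 0) (h0 : gbinom N q ≠ 0) (h1 : gbinom N (q + 1) ≠ 0) :
    halfe lam N K q * (N - q - 1) = (K - q) * halfα lam N K q := by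
  apply mul_right_cancel₀ h
  linear_combination (N - q - 1) * halfe_mul_sub (lam := lam) (K := K) h0 h1
    - (K - q) * halfα_mul (lam := lam) (K := K) h

theorem halfe_mul_β (h : N - q ≠ 0) (h0 : gbinom N q ≠ 0) (h1 : gbinom N (q + 1) ≠ 0) :
    halfe lam N K q * q = (K - q) * halfβ lam N K q := by
  apply mul_right_cancel₀ h
  linear_combination q * halfe_mul_sub (lam := lam) (K := K) h0 h1
    - (K - q) * halfβ_mul (lam := lam) (K := K) h

end HalfCoefficients

theorem gbinom_ne_zero_of_le {N : ℂ} {K : ℕ} (hN : ∀ i : ℕ, i ≤ K → N ≠ i) {m : ℤ} (h0 : 0 ≤ m)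
    (hm : m ≤ K + 1) : gbinom N m ≠ 0 :=
  gbinom_ne_zero h0 fun i hi => hN i (by omega)

/-! ### The quantization map in a fixed contact order -/

/-- The terms look the same in the frame `(D̄₂, -D̄₁)`, in which the field of `xξ₂` acts as the
field of `xξ₁` does in the frame `(D̄₁, D̄₂)`. -/
theorem intTerm_rotate (K q : ℤ) (α β γ ε u v : ℂ) (F₁ F₂ : SuperFun) :
    intTerm Dbar2 (-Dbar1) K q α β γ ε u v F₁ F₂
      = intTerm Dbar1 Dbar2 K q α β γ ε u v F₁ F₂ := by
  have h (a : SuperFun) : Dbar2 (Dbar1 a) = -Dbar1 (Dbar2 a) := LinearMap.congr_fun Dbar2_Dbar1 a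
  have h' (l : ℤ) : dxPow l * Dbar2 * Dbar1 = -(dxPow l * Dbar1 * Dbar2) := by
    rw [mul_assoc, Dbar2_Dbar1, mul_neg, mul_assoc]
  simp only [intTerm, LinearMap.neg_apply, map_neg, h, neg_neg, mul_neg, h', mulOp_neg, mulOp_add,
    mulOp_sub, mulOp_smul, smul_neg, neg_mul, add_mul, sub_mul, smul_mul_assoc]
  module

/-- In half-integer contact order the change of frame rotates the components of the symbol as
well. -/
theorem halfTerm_rotate (K q : ℤ) (α β c e : ℂ) (F₁ F₂ : SuperFun) :
    halfTerm Dbar2 (-Dbar1) K q α β c e F₂ (-F₁) = halfTerm Dbar1 Dbar2 K q α β c e F₁ F₂ := by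
  have h (a : SuperFun) : Dbar2 (Dbar1 a) = -Dbar1 (Dbar2 a) := LinearMap.congr_fun Dbar2_Dbar1 a
  have h' (l : ℤ) : dxPow l * Dbar2 * Dbar1 = -(dxPow l * Dbar1 * Dbar2) := by
    rw [mul_assoc, Dbar2_Dbar1, mul_neg, mul_assoc]
  simp only [halfTerm, LinearMap.neg_apply, map_neg, h, neg_neg, mul_neg, h', mulOp_neg, mulOp_add,
    mulOp_sub, mulOp_smul, smul_neg, neg_mul, add_mul, sub_mul, smul_mul_assoc]
  module

/-- The terms of the quantization of a symbol of integer contact order `K`, as a linear map. -/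
def intTermLin (d₁ d₂ : Op) (K q : ℤ) (α β γ ε u v : ℂ) : SuperFun × SuperFun →ₗ[ℂ] Op where
  toFun F := intTerm d₁ d₂ K q α β γ ε u v F.1 F.2
  map_add' F G := by
    simp only [intTerm, Prod.fst_add, Prod.snd_add, map_add, mulOp_neg, mulOp_add,
      mulOp_sub, mulOp_smul, neg_mul, add_mul, sub_mul, smul_mul_assoc]
    module
  map_smul' c F := by
    simp only [intTerm, Prod.smul_fst, Prod.smul_snd, map_smul, mulOp_neg, mulOp_add,
      mulOp_sub, mulOp_smul, neg_mul, add_mul, sub_mul, smul_mul_assoc, RingHom.id_apply]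
    module

/-- The terms of the quantization of a symbol of contact order `K + 1/2`, as a linear map. -/
def halfTermLin (d₁ d₂ : Op) (K q : ℤ) (α β c e : ℂ) : SuperFun × SuperFun →ₗ[ℂ] Op where
  toFun F := halfTerm d₁ d₂ K q α β c e F.1 F.2
  map_add' F G := by
    simp only [halfTerm, Prod.fst_add, Prod.snd_add, map_add, mulOp_add,
      mulOp_sub, mulOp_smul, add_mul, sub_mul, smul_mul_assoc]
    module
  map_smul' c F := by
    simp only [halfTerm, Prod.smul_fst, Prod.smul_snd, map_smul, mulOp_add,
      mulOp_sub, mulOp_smul, add_mul, sub_mul, smul_mul_assoc, RingHom.id_apply]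
    module

/-- The quantization of the symbols of integer contact order `K`, in the frame `(d₁, d₂)`. -/
def intQuant (d₁ d₂ : Op) (lam mu : ℂ) (K : ℕ) : SuperFun × SuperFun →ₗ[ℂ] Op :=
  let N : ℂ := 2 * K - 2 * (mu - lam)
  ∑ q ∈ Finset.range (K + 1), intTermLin d₁ d₂ K q (intα lam N K q) (intβ lam N K q)
    (intγ lam N K q) (intε lam N K q) (intu lam N K q) (intv lam N K q)

/-- The quantization of the symbols of contact order `K + 1/2`, in the frame `(d₁, d₂)`. -/
def halfQuant (d₁ d₂ : Op) (lam mu : ℂ) (K : ℕ) : SuperFun × SuperFun →ₗ[ℂ] Op :=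
  let N : ℂ := 2 * K + 1 - 2 * (mu - lam)
  ∑ q ∈ Finset.range (K + 1), halfTermLin d₁ d₂ K q (halfα lam N K q) (halfβ lam N K q)
    (halfc lam N K q) (halfe lam N K q)

theorem intQuant_apply (d₁ d₂ : Op) (lam mu : ℂ) (K : ℕ) (F : SuperFun × SuperFun) :
    intQuant d₁ d₂ lam mu K F = ∑ q ∈ Finset.range (K + 1), intTerm d₁ d₂ K q
      (intα lam (2 * K - 2 * (mu - lam)) K q) (intβ lam (2 * K - 2 * (mu - lam)) K q)
      (intγ lam (2 * K - 2 * (mu - lam)) K q) (intε lam (2 * K - 2 * (mu - lam)) K q)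
      (intu lam (2 * K - 2 * (mu - lam)) K q) (intv lam (2 * K - 2 * (mu - lam)) K q) F.1 F.2 := by
  rw [intQuant, LinearMap.sum_apply]
  rfl

theorem halfQuant_apply (d₁ d₂ : Op) (lam mu : ℂ) (K : ℕ) (F : SuperFun × SuperFun) :
    halfQuant d₁ d₂ lam mu K F = ∑ q ∈ Finset.range (K + 1), halfTerm d₁ d₂ K q
      (halfα lam (2 * K + 1 - 2 * (mu - lam)) K q) (halfβ lam (2 * K + 1 - 2 * (mu - lam)) K q)
      (halfc lam (2 * K + 1 - 2 * (mu - lam)) K q) (halfe lam (2 * K + 1 - 2 * (mu - lam)) K q)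
      F.1 F.2 := by
  rw [halfQuant, LinearMap.sum_apply]
  rfl

theorem Frame.opAction_intQuant {φ e₁ e₂ : SuperFun} {d₁ d₂ : Op} (F : Frame φ e₁ e₂ d₁ d₂)
    {lam mu : ℂ} {K : ℕ} (hN : ∀ i : ℕ, i ≤ K → 2 * K - 2 * (mu - lam) ≠ i)
    (G : SuperFun × SuperFun) :
    opAction lam mu φ (intQuant d₁ d₂ lam mu K G)
      = intQuant d₁ d₂ lam mu K (densityAction (mu - lam - K) φ G.1,
          densityAction (mu - lam - K) φ G.2) := by
  rw [← sub_eq_zero, intQuant_apply, intQuant_apply, map_sum, ← Finset.sum_sub_distrib]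
  set N := 2 * K - 2 * (mu - lam) with hNdef
  -- The defects of equivariance of the individual terms telescope. The remainders with the indices
  -- `0` and `K + 1` that are left vanish, because they contain negative powers of `∂ₓ`.
  rw [Finset.sum_congr rfl (g := fun q : ℕ =>
    intRemainder d₁ d₂ lam K ((q + 1 : ℕ) : ℤ) (intu lam N K ((q + 1 : ℕ) - 1 : ℤ))
        (intv lam N K ((q + 1 : ℕ) - 1 : ℤ)) G.1 G.2
      - intRemainder d₁ d₂ lam K q (intu lam N K (q - 1)) (intv lam N K (q - 1)) G.1 G.2) ?_,
    Finset.sum_range_sub (fun q : ℕ => intRemainder d₁ d₂ lam K q (intu lam N K (q - 1))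
      (intv lam N K (q - 1)) G.1 G.2)]
  · simp [intRemainder, dxPow_neg, mulOp_zero]
  · intro q hq
    rw [Finset.mem_range] at hq
    have h := gbinom_ne_zero_of_le hN (m := (q : ℤ)) (by omega) (by omega)
    have h' := gbinom_ne_zero_of_le hN (m := (q : ℤ) + 1) (by omega) (by omega)
    have := F.opAction_intTerm lam mu K q (N := N) (by rw [hNdef, Int.cast_natCast])
      (by simpa using intα_mul (lam := lam) (N := N) (K := K) (q := q))
      (by simpa using intβ_mul (lam := lam) (K := K) h h')
      (by simpa using intγ_mul (lam := lam) (N := N) (K := K) (q := q))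
      (by simpa using intε_mul (lam := lam) (K := K) h h')
      (by simpa using intu_mul' (lam := lam) (K := K) h h')
      (by simpa using intv_mul (lam := lam) (N := N) (K := K) (q := q))
      (by simpa using intv_mul' (lam := lam) (K := K) h h')
      (by simpa using intu_mul (lam := lam) (N := N) (K := K) (q := q)) G.1 G.2
    rw [Int.cast_natCast] at this
    rw [this]
    push_cast
    rw [add_sub_cancel_right]

theorem Frame.opAction_halfQuant {φ e₁ e₂ : SuperFun} {d₁ d₂ : Op} (F : Frame φ e₁ e₂ d₁ d₂)
    {lam mu : ℂ} {K : ℕ} (hN : ∀ i : ℕ, i ≤ K → 2 * K + 1 - 2 * (mu - lam) ≠ i)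
    (G : SuperFun × SuperFun) :
    opAction lam mu φ (halfQuant d₁ d₂ lam mu K G)
      = halfQuant d₁ d₂ lam mu K
          (densityAction (mu - lam - K - 1 / 2) φ G.1 - (1 / 2 : ℂ) • mulOp e₂ G.2,
            densityAction (mu - lam - K - 1 / 2) φ G.2 + (1 / 2 : ℂ) • mulOp e₂ G.1) := by
  rw [← sub_eq_zero, halfQuant_apply, halfQuant_apply, map_sum, ← Finset.sum_sub_distrib]
  set N := 2 * K + 1 - 2 * (mu - lam) with hNdef
  -- The defects telescope, as in integer contact order.
  rw [Finset.sum_congr rfl (g := fun q : ℕ =>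
    halfRemainder d₁ d₂ lam K ((q + 1 : ℕ) : ℤ) (halfc lam N K ((q + 1 : ℕ) - 1 : ℤ))
        (halfe lam N K ((q + 1 : ℕ) - 1 : ℤ)) G.1 G.2
      - halfRemainder d₁ d₂ lam K q (halfc lam N K (q - 1)) (halfe lam N K (q - 1)) G.1 G.2) ?_,
    Finset.sum_range_sub (fun q : ℕ => halfRemainder d₁ d₂ lam K q (halfc lam N K (q - 1))
      (halfe lam N K (q - 1)) G.1 G.2)]
  · simp [halfRemainder, dxPow_neg, mulOp_zero]
  · intro q hq
    rw [Finset.mem_range] at hq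
    have h := gbinom_ne_zero_of_le hN (m := (q : ℤ)) (by omega) (by omega)
    have h' := gbinom_ne_zero_of_le hN (m := (q : ℤ) + 1) (by omega) (by omega)
    have hq : N - ((q : ℤ) : ℂ) ≠ 0 := by simpa using sub_ne_zero.2 (hN q (by omega))
    have := F.opAction_halfTerm lam mu K q (N := N) (by rw [hNdef, Int.cast_natCast])
      (by simpa using halfα_mul_add (lam := lam) (K := K) hq)
      (by simpa using halfβ_mul_c (lam := lam) (K := K) hq)
      (by simpa using halfβ_mul_e (lam := lam) (K := K) hq)
      (by simpa using halfc_mul_α (lam := lam) (K := K) hq h h')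
      (by simpa using halfc_mul_β (lam := lam) (K := K) hq h h')
      (by simpa using halfe_mul_α (lam := lam) (K := K) hq h h')
      (by simpa using halfe_mul_β (lam := lam) (K := K) hq h h') G.1 G.2
    rw [Int.cast_natCast] at this
    rw [this]
    push_cast
    rw [add_sub_cancel_right]

/-! ### Normal forms of differential operators -/

/-- The odd parts `1, D̄₁, D̄₂, D̄₁ D̄₂` of the words `∂ₓ^l D̄₁^m D̄₂^n`. -/
def oddWord : Fin 4 → Op := ![1, Dbar1, Dbar2, Dbar1 * Dbar2]

/-- Twice the contact order of `oddWord`. -/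
def oddOrder : Fin 4 → ℕ := ![0, 1, 1, 2]

/-- The operator with the coefficients `c l s`, `l < N`, with respect to the words
`∂ₓ^l * oddWord s`. -/
def normalForm (N : ℕ) (c : ℕ → Fin 4 → SuperFun) : Op :=
  ∑ l ∈ Finset.range N, ∑ s, mulOp (c l s) * dx ^ l * oddWord s

theorem normalForm_add (N : ℕ) (c c' : ℕ → Fin 4 → SuperFun) :
    normalForm N (c + c') = normalForm N c + normalForm N c' := by
  simp only [normalForm, ← Finset.sum_add_distrib, Pi.add_apply, mulOp_add, add_mul]

theorem normalForm_smul (N : ℕ) (z : ℂ) (c : ℕ → Fin 4 → SuperFun) :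
    normalForm N (z • c) = z • normalForm N c := by
  simp only [normalForm, Finset.smul_sum, Pi.smul_apply, mulOp_smul, smul_mul_assoc]

theorem normalForm_sub (N : ℕ) (c c' : ℕ → Fin 4 → SuperFun) :
    normalForm N (c - c') = normalForm N c - normalForm N c' := by
  simp only [normalForm, ← Finset.sum_sub_distrib, Pi.sub_apply, mulOp_sub, sub_mul]

theorem normalForm_single {N l : ℕ} (hl : l < N) (s : Fin 4) (a : SuperFun) :
    normalForm N (Pi.single l (Pi.single s a)) = mulOp a * dx ^ l * oddWord s := by
  rw [normalForm, Finset.sum_eq_single_of_mem l (Finset.mem_range.2 hl),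
    Finset.sum_eq_single_of_mem s (Finset.mem_univ s)]
  · simp
  · intro t _ ht
    simp [ht, mulOp_zero]
  · intro k _ hk
    simp [hk, mulOp_zero]

theorem oddWord_commute (s : Fin 4) : dx * oddWord s = oddWord s * dx := by
  fin_cases s
  · simp [oddWord]
  · exact Dbar1_dx.symm
  · exact Dbar2_dx.symm
  · change dx * (Dbar1 * Dbar2) = Dbar1 * Dbar2 * dx
    rw [mul_assoc, Dbar2_dx, ← mul_assoc, ← mul_assoc, Dbar1_dx]

theorem normalForm_succ (N : ℕ) (c : ℕ → Fin 4 → SuperFun) :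
    normalForm (N + 1) c
      = normalForm N (fun l => c (l + 1)) * dx + ∑ s, mulOp (c 0 s) * oddWord s := by
  rw [normalForm, Finset.sum_range_succ', normalForm, Finset.sum_mul]
  congr 1
  · refine Finset.sum_congr rfl fun l _ => ?_
    rw [Finset.sum_mul]
    refine Finset.sum_congr rfl fun s _ => ?_
    rw [pow_succ, mul_assoc, mul_assoc, oddWord_commute, mul_assoc, mul_assoc]

/-- The monomials `x^j (a + ξ₁ b + ξ₂ c + ξ₁ ξ₂ d)`, with constants `a, b, c, d`. -/
def monomial (j : ℕ) (a b c d : ℂ) : SuperFun :=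
  ⟨a • coordX ^ j, b • coordX ^ j, c • coordX ^ j, d • coordX ^ j⟩

theorem dx_monomial_succ (j : ℕ) (a b c d : ℂ) :
    dx (monomial (j + 1) a b c d) = ((j : ℂ) + 1) • monomial j a b c d := by
  have h (z : ℂ) : partialX (z • coordX ^ (j + 1)) = ((j : ℂ) + 1) • z • coordX ^ j := by
    rw [Derivation.map_smul, Derivation.leibniz_pow, partialX_coordX, smul_comm]
    simp [← Nat.cast_smul_eq_nsmul ℂ, add_smul]
  ext1 <;> simp [dx_apply, monomial, h]

theorem dx_monomial_zero (a b c d : ℂ) : dx (monomial 0 a b c d) = 0 := by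
  ext1 <;> simp [dx_apply, monomial]

/-- A differential operator that vanishes on all monomials has zero coefficients. -/
theorem normalForm_coeff_eq_zero {N : ℕ} {c : ℕ → Fin 4 → SuperFun}
    (h : ∀ j a₁ a₂ a₃ a₄, normalForm N c (monomial j a₁ a₂ a₃ a₄) = 0) :
    ∀ l < N, ∀ s, c l s = 0 := by
  induction N generalizing c with
  | zero => intro l hl; omega
  | succ N ih =>
    rw [normalForm_succ] at h
    -- On monomials of degree zero only the coefficients of the words without `∂ₓ` contribute. They
    -- vanish, and the other words are applied to the derivative, a monomial of smaller degree.
    have h0 (a₁ a₂ a₃ a₄ : ℂ) :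
        (∑ s, mulOp (c 0 s) * oddWord s : Op) (monomial 0 a₁ a₂ a₃ a₄) = 0 := by
      have := h 0 a₁ a₂ a₃ a₄
      rwa [LinearMap.add_apply, Module.End.mul_apply, dx_monomial_zero, map_zero, zero_add] at this
    have hc : ∀ s, c 0 s = 0 := by
      have e1 := h0 1 0 0 0
      have e2 := h0 0 1 0 0
      have e3 := h0 0 0 1 0
      have e4 := h0 0 0 0 1
      simp only [Fin.sum_univ_four, oddWord, Matrix.cons_val_zero, Matrix.cons_val_one,
        Matrix.cons_val, LinearMap.add_apply, Module.End.mul_apply, mulOp_apply, monomial,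
        Dbar1_apply, Dbar2_apply, Module.End.one_apply, SuperFun.ext_iff, pow_zero,
        add_f0, add_f1, add_f2, add_f12, mul_f0, mul_f1, mul_f2, mul_f12,
        zero_f0, zero_f1, zero_f2, zero_f12] at e1 e2 e3 e4
      simp at e1 e2 e3 e4
      have hh : ∀ s, (c 0 s).f0 = 0 ∧ (c 0 s).f1 = 0 ∧ (c 0 s).f2 = 0 ∧ (c 0 s).f12 = 0 := by
        intro s
        fin_cases s <;> simp <;> grind
      intro s
      ext1
      exacts [(hh s).1, (hh s).2.1, (hh s).2.2.1, (hh s).2.2.2]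
    have h1 : ∀ j a₁ a₂ a₃ a₄,
        normalForm N (fun l => c (l + 1)) (monomial j a₁ a₂ a₃ a₄) = 0 := by
      intro j a₁ a₂ a₃ a₄
      have := h (j + 1) a₁ a₂ a₃ a₄
      simp only [hc, mulOp_zero, zero_mul, Finset.sum_const_zero, add_zero,
        Module.End.mul_apply, dx_monomial_succ, map_smul] at this
      exact (smul_eq_zero.1 this).resolve_left (Nat.cast_add_one_ne_zero j)
    intro l hl s
    cases l with
    | zero => exact hc s
    | succ l => exact ih h1 l (by omega) s

theorem exists_normalForm {i N : ℕ} (hN : i < N) {A : Op} (hA : A ∈ diffOps i) :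
    ∃ c : ℕ → Fin 4 → SuperFun, (∀ l s, i < 2 * l + oddOrder s → c l s = 0) ∧
      normalForm N c = A := by
  induction hA using Submodule.span_induction with
  | mem A hA =>
    obtain ⟨a, l, m, n, hm, hn, hi, rfl⟩ := hA
    obtain ⟨s, hs, hs'⟩ : ∃ s : Fin 4, oddWord s = Dbar1 ^ m * Dbar2 ^ n ∧ oddOrder s = m + n := by
      obtain rfl | rfl : m = 0 ∨ m = 1 := by omega
      all_goals obtain rfl | rfl : n = 0 ∨ n = 1 := by omega
      · exact ⟨0, by simp [oddWord, oddOrder]⟩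
      · exact ⟨2, by simp [oddWord, oddOrder]⟩
      · exact ⟨1, by simp [oddWord, oddOrder]⟩
      · exact ⟨3, by simp [oddWord, oddOrder]⟩
    refine ⟨Pi.single l (Pi.single s a), fun k t hk => ?_, ?_⟩
    · by_cases hkl : k = l
      · subst hkl
        rw [Pi.single_eq_same]
        by_cases hst : t = s
        · subst hst
          omega
        · simp [hst]
      · rw [Pi.single_eq_of_ne hkl]
        rfl
    · rw [normalForm_single (by omega), hs, mul_assoc _ (Dbar1 ^ m)]
  | zero => exact ⟨0, fun _ _ _ => rfl, by simp [normalForm, mulOp_zero]⟩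
  | add A B _ _ hA hB =>
    obtain ⟨c, hc, rfl⟩ := hA
    obtain ⟨c', hc', rfl⟩ := hB
    exact ⟨c + c', fun l s h => by simp [hc l s h, hc' l s h], normalForm_add N c c'⟩
  | smul z A _ hA =>
    obtain ⟨c, hc, rfl⟩ := hA
    exact ⟨z • c, fun l s h => by simp [hc l s h], normalForm_smul N z c⟩

/-- The words of a given contact order are linearly independent modulo lower order. -/
theorem normalForm_coeff_of_mem {i N : ℕ} {c : ℕ → Fin 4 → SuperFun}
    (h : normalForm N c ∈ prevDiffOps i) {l : ℕ} (hl : l < N) {s : Fin 4}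
    (hs : i ≤ 2 * l + oddOrder s) (hN : i < N) : c l s = 0 := by
  cases i with
  | zero =>
    have h0 : normalForm N c = 0 := h
    exact normalForm_coeff_eq_zero (fun _ _ _ _ _ => by rw [h0]; rfl) l hl s
  | succ i =>
    obtain ⟨c', hc', hcc⟩ := exists_normalForm (N := N) (by omega) (show _ ∈ diffOps i from h)
    have h0 : normalForm N (c - c') = 0 := by rw [normalForm_sub, hcc, sub_self]
    have := normalForm_coeff_eq_zero (fun _ _ _ _ _ => by rw [h0]; rfl) l hl s
    rwa [Pi.sub_apply, Pi.sub_apply, hc' l s (by omega), sub_zero] at this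

/-! ### Coordinates on the symbols -/

/-- The operator without lower-order terms that has the symbol `(F₁, F₂)` of contact order `i/2`. -/
def topPair (i : ℕ) : SuperFun × SuperFun →ₗ[ℂ] Op where
  toFun F := if i % 2 = 0 then
      mulOp F.1 * dx ^ (i / 2) + mulOp F.2 * dxPow ((i / 2 : ℕ) - 1) * Dbar1 * Dbar2
    else mulOp F.1 * dx ^ (i / 2) * Dbar1 + mulOp F.2 * dx ^ (i / 2) * Dbar2
  map_add' F G := by
    simp only [Prod.fst_add, Prod.snd_add, mulOp_add, add_mul]
    split_ifs <;> abel
  map_smul' z F := by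
    simp only [Prod.smul_fst, Prod.smul_snd, mulOp_smul, smul_mul_assoc, RingHom.id_apply]
    split_ifs <;> rw [smul_add]

theorem topPair_even (K : ℕ) (F : SuperFun × SuperFun) : topPair (2 * K) F
    = mulOp F.1 * dx ^ K + mulOp F.2 * dxPow ((K : ℤ) - 1) * Dbar1 * Dbar2 := by
  simp [topPair]

theorem topPair_odd (K : ℕ) (F : SuperFun × SuperFun) : topPair (2 * K + 1) F
    = mulOp F.1 * dx ^ K * Dbar1 + mulOp F.2 * dx ^ K * Dbar2 := by
  have h1 : (2 * K + 1) % 2 = 1 := by omega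
  have h2 : (2 * K + 1) / 2 = K := by omega
  simp [topPair, h1, h2]

theorem topPair_mem (i : ℕ) (F : SuperFun × SuperFun) : topPair i F ∈ diffOps i := by
  obtain ⟨K, rfl | rfl⟩ := Nat.even_or_odd' i
  · rw [topPair_even]
    exact topInt_mem K F.1 F.2
  · rw [topPair_odd]
    exact topHalf_mem K F.1 F.2

theorem topPair_zero (F : SuperFun × SuperFun) : topPair 0 F = mulOp F.1 := by
  simp [topPair, dxPow_neg]

/-- A symbol determines its components. -/
theorem topPair_injective {i : ℕ} {F : SuperFun × SuperFun} (h : topPair i F ∈ prevDiffOps i) :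
    F.1 = 0 ∧ (i ≠ 0 → F.2 = 0) := by
  obtain ⟨K, rfl | rfl⟩ := Nat.even_or_odd' i
  · rw [topPair_even] at h
    cases K with
    | zero =>
      have h' : normalForm 1 (Pi.single 0 (Pi.single 0 F.1)) ∈ prevDiffOps (2 * 0) := by
        rw [normalForm_single (by simp)]
        simpa [oddWord, dxPow_neg] using h
      have := normalForm_coeff_of_mem h' (l := 0) (by simp) (s := 0) (by simp) (by simp)
      exact ⟨by simpa using this, fun h => absurd rfl h⟩
    | succ K =>
      have h' : normalForm (2 * (K + 1) + 1) (Pi.single (K + 1) (Pi.single 0 F.1)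
          + Pi.single K (Pi.single 3 F.2)) ∈ prevDiffOps (2 * (K + 1)) := by
        rw [normalForm_add, normalForm_single (by omega), normalForm_single (by omega)]
        rw [show ((K + 1 : ℕ) : ℤ) - 1 = (K : ℤ) by push_cast; ring, dxPow_natCast] at h
        simpa [oddWord, mul_assoc] using h
      have h1 := normalForm_coeff_of_mem h' (l := K + 1) (by omega) (s := 0) (by simp) (by omega)
      have h2 := normalForm_coeff_of_mem h' (l := K) (by omega) (s := 3)
        (by simp [oddOrder]; omega) (by omega)
      exact ⟨by simpa using h1, fun _ => by simpa using h2⟩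
  · rw [topPair_odd] at h
    have h' : normalForm (2 * K + 2) (Pi.single K (Pi.single 1 F.1)
        + Pi.single K (Pi.single 2 F.2)) ∈ prevDiffOps (2 * K + 1) := by
      rw [normalForm_add, normalForm_single (by omega), normalForm_single (by omega)]
      simpa [oddWord] using h
    have h1 := normalForm_coeff_of_mem h' (l := K) (by omega) (s := 1) (by simp [oddOrder])
      (by omega)
    have h2 := normalForm_coeff_of_mem h' (l := K) (by omega) (s := 2) (by simp [oddOrder])
      (by omega)
    exact ⟨by simpa using h1, fun _ => by simpa using h2⟩

theorem word_mem_prev (a : SuperFun) {l m n i : ℕ} (hm : m ≤ 1) (hn : n ≤ 1)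
    (hi : 2 * l + m + n < i) : mulOp a * dx ^ l * Dbar1 ^ m * Dbar2 ^ n ∈ prevDiffOps i := by
  cases i with
  | zero => omega
  | succ i => exact word_mem a hm hn (by omega)

/-- Every operator has a principal symbol with two components. -/
theorem exists_topPair {i : ℕ} {A : Op} (hA : A ∈ diffOps i) :
    ∃ F, A - topPair i F ∈ prevDiffOps i := by
  have : diffOps i ≤ LinearMap.range (topPair i) ⊔ prevDiffOps i := by
    refine Submodule.span_le.2 ?_
    rintro A ⟨a, l, m, n, hm, hn, hi, rfl⟩
    rcases hi.lt_or_eq with hi | hi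
    · exact Submodule.mem_sup_right (word_mem_prev a hm hn hi)
    · refine Submodule.mem_sup_left ?_
      obtain rfl | rfl : m = 0 ∨ m = 1 := by omega
      all_goals obtain rfl | rfl : n = 0 ∨ n = 1 := by omega
      all_goals subst hi
      · exact ⟨(a, 0), by simp [topPair_even, mulOp_zero]⟩
      · exact ⟨(0, a), by simp [topPair_odd, mulOp_zero]⟩
      · exact ⟨(a, 0), by simp [topPair_odd, mulOp_zero]⟩
      · refine ⟨(0, a), ?_⟩
        rw [show 2 * l + 1 + 1 = 2 * (l + 1) by ring, topPair_even]
        simp [mulOp_zero, dxPow_natCast]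
  obtain ⟨_, ⟨F, rfl⟩, B, hB, h⟩ := Submodule.mem_sup.1 (this hA)
  exact ⟨F, by rwa [← h, add_sub_cancel_left]⟩

/-! ### Equivariance of the quantization in a fixed contact order -/

/-- The properties of the contact Hamiltonians `ξ₁` and `ξ₂` by which their contact fields
(super-)commute with `D̄₁`, `D̄₂`, and `∂ₓ`. -/
structure IsTranslation (ψ : SuperFun) : Prop where
  evenPart_eq : evenPart ψ = 0
  oddPart_eq : oddPart ψ = ψ
  dx_eq : dx ψ = 0
  Dbar_eq : Dbar1 (Dbar2 ψ) = 0

theorem isTranslation_xi1 : IsTranslation xi1 where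
  evenPart_eq := rfl
  oddPart_eq := rfl
  dx_eq := dx_xi1
  Dbar_eq := by rw [Dbar2_xi1, map_zero]

theorem isTranslation_xi2 : IsTranslation xi2 where
  evenPart_eq := rfl
  oddPart_eq := rfl
  dx_eq := dx_xi2
  Dbar_eq := by ext1 <;> simp [Dbar1_apply, Dbar2_apply, xi2]

namespace IsTranslation

variable {ψ : SuperFun}

theorem density_eq (h : IsTranslation ψ) (w : ℂ) : densityAction w ψ = contactField ψ := by
  rw [densityAction, h.dx_eq, mulOp_zero, smul_zero, add_zero]

theorem field_Dbar1 (h : IsTranslation ψ) :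
    contactField ψ * Dbar1 = -(Dbar1 * contactField ψ) := by
  rw [SuperCircle.field_Dbar1 h.oddPart_eq, h.dx_eq, h.Dbar_eq, mulOp_zero]
  simp

theorem field_Dbar2 (h : IsTranslation ψ) :
    contactField ψ * Dbar2 = -(Dbar2 * contactField ψ) := by
  rw [SuperCircle.field_Dbar2 h.oddPart_eq, h.dx_eq, h.Dbar_eq, mulOp_zero]
  simp

theorem field_dx (h : IsTranslation ψ) : contactField ψ * dx = dx * contactField ψ := by
  have e : dx = -(Dbar1 * Dbar1) := by rw [Dbar1_sq, neg_neg]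
  rw [e, mul_neg, ← mul_assoc, h.field_Dbar1, neg_mul, mul_assoc, h.field_Dbar1, mul_neg, neg_neg,
    neg_mul, mul_assoc]

theorem field_dxPow (h : IsTranslation ψ) (l : ℤ) :
    contactField ψ * dxPow l = dxPow l * contactField ψ := mul_dxPow_of_comm h.field_dx l

theorem field_dxPow_Dbar1 (h : IsTranslation ψ) (l : ℤ) :
    contactField ψ * (dxPow l * Dbar1) = -(dxPow l * Dbar1 * contactField ψ) := by
  rw [← mul_assoc, h.field_dxPow, mul_assoc, h.field_Dbar1, mul_neg, mul_assoc]

theorem field_dxPow_Dbar2 (h : IsTranslation ψ) (l : ℤ) :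
    contactField ψ * (dxPow l * Dbar2) = -(dxPow l * Dbar2 * contactField ψ) := by
  rw [← mul_assoc, h.field_dxPow, mul_assoc, h.field_Dbar2, mul_neg, mul_assoc]

theorem field_dxPow_Dbar1_Dbar2 (h : IsTranslation ψ) (l : ℤ) :
    contactField ψ * (dxPow l * Dbar1 * Dbar2) = dxPow l * Dbar1 * Dbar2 * contactField ψ := by
  rw [← mul_assoc, h.field_dxPow_Dbar1, neg_mul, mul_assoc _ _ Dbar2, h.field_Dbar2, mul_neg,
    neg_neg, mul_assoc _ Dbar2]

/-- The field `X_ψ` acts on the coefficient of a word only, if it supercommutes with the word. -/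
theorem opAction_mulOp_mul (h : IsTranslation ψ) (lam mu : ℂ) (a : SuperFun) {W : Op}
    (hW : contactField ψ * W = opParity W * contactField ψ) :
    opAction lam mu ψ (mulOp a * W) = mulOp (contactField ψ a) * W := by
  have h0 : densityAction lam 0 = 0 := by simp [densityAction, contactField_zero, mulOp_zero]
  rw [opAction_apply, h.evenPart_eq, h.oddPart_eq, h0, mul_zero, sub_zero, h.density_eq,
    h.density_eq, ← mul_assoc, contactField_odd_mulOp h.oddPart_eq, opParity_mul, opParity_mulOp,
    add_mul, mul_assoc (mulOp (parityInv a)), hW, mul_assoc, add_sub_cancel_right]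

theorem field_dxPow_apply (h : IsTranslation ψ) (l : ℤ) (a : SuperFun) :
    dxPow l (contactField ψ a) = contactField ψ (dxPow l a) :=
  (LinearMap.congr_fun (h.field_dxPow l) a).symm

theorem field_Dbar1_apply (h : IsTranslation ψ) (a : SuperFun) :
    Dbar1 (contactField ψ a) = -contactField ψ (Dbar1 a) := by
  rw [show contactField ψ (Dbar1 a) = _ from LinearMap.congr_fun h.field_Dbar1 a,
    LinearMap.neg_apply, neg_neg]
  rfl

theorem field_Dbar2_apply (h : IsTranslation ψ) (a : SuperFun) :
    Dbar2 (contactField ψ a) = -contactField ψ (Dbar2 a) := by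
  rw [show contactField ψ (Dbar2 a) = _ from LinearMap.congr_fun h.field_Dbar2 a,
    LinearMap.neg_apply, neg_neg]
  rfl

theorem field_parityInv_apply (h : IsTranslation ψ) (a : SuperFun) :
    parityInv (contactField ψ a) = -contactField ψ (parityInv a) := by
  have := LinearMap.congr_fun (contactField_parity h.oddPart_eq) (parityInv a)
  rwa [show opParity (contactField ψ) (parityInv a)
    = parityInv (contactField ψ (parityInv (parityInv a))) from rfl,
    parityInv_parityInv] at this

theorem opAction_dxPow (h : IsTranslation ψ) (lam mu : ℂ) (a : SuperFun) (l : ℤ) :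
    opAction lam mu ψ (mulOp a * dxPow l) = mulOp (contactField ψ a) * dxPow l :=
  h.opAction_mulOp_mul lam mu a (by rw [opParity_dxPow, h.field_dxPow])

theorem opAction_dxPow_Dbar1 (h : IsTranslation ψ) (lam mu : ℂ) (a : SuperFun) (l : ℤ) :
    opAction lam mu ψ (mulOp a * (dxPow l * Dbar1))
      = mulOp (contactField ψ a) * (dxPow l * Dbar1) :=
  h.opAction_mulOp_mul lam mu a (by
    rw [opParity_mul, opParity_dxPow, opParity_Dbar1, h.field_dxPow_Dbar1, mul_neg, neg_mul])

theorem opAction_dxPow_Dbar2 (h : IsTranslation ψ) (lam mu : ℂ) (a : SuperFun) (l : ℤ) :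
    opAction lam mu ψ (mulOp a * (dxPow l * Dbar2))
      = mulOp (contactField ψ a) * (dxPow l * Dbar2) :=
  h.opAction_mulOp_mul lam mu a (by
    rw [opParity_mul, opParity_dxPow, opParity_Dbar2, h.field_dxPow_Dbar2, mul_neg, neg_mul])

theorem opAction_dxPow_Dbar1_Dbar2 (h : IsTranslation ψ) (lam mu : ℂ) (a : SuperFun) (l : ℤ) :
    opAction lam mu ψ (mulOp a * (dxPow l * Dbar1 * Dbar2))
      = mulOp (contactField ψ a) * (dxPow l * Dbar1 * Dbar2) :=
  h.opAction_mulOp_mul lam mu a (by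
    rw [opParity_mul, opParity_mul, opParity_dxPow, opParity_Dbar1, opParity_Dbar2,
      h.field_dxPow_Dbar1_Dbar2, mul_neg, mul_neg, neg_mul, neg_mul, neg_mul, neg_neg])

theorem opAction_intTerm (h : IsTranslation ψ) (lam mu : ℂ) (K q : ℤ) (α β γ ε u v : ℂ)
    (F₁ F₂ : SuperFun) :
    opAction lam mu ψ (intTerm Dbar1 Dbar2 K q α β γ ε u v F₁ F₂)
      = intTerm Dbar1 Dbar2 K q α β γ ε u v (contactField ψ F₁) (contactField ψ F₂) := by
  simp only [intTerm, map_add, h.opAction_dxPow, h.opAction_dxPow_Dbar1, h.opAction_dxPow_Dbar2,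
    h.opAction_dxPow_Dbar1_Dbar2, map_sub, map_neg, map_smul, h.field_dxPow_apply,
    h.field_Dbar1_apply, h.field_Dbar2_apply, h.field_parityInv_apply, neg_neg]

theorem opAction_halfTerm (h : IsTranslation ψ) (lam mu : ℂ) (K q : ℤ) (α β c e : ℂ)
    (F₁ F₂ : SuperFun) :
    opAction lam mu ψ (halfTerm Dbar1 Dbar2 K q α β c e F₁ F₂)
      = halfTerm Dbar1 Dbar2 K q α β c e (contactField ψ F₁) (contactField ψ F₂) := by
  simp only [halfTerm, map_add, h.opAction_dxPow, h.opAction_dxPow_Dbar1, h.opAction_dxPow_Dbar2,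
    h.opAction_dxPow_Dbar1_Dbar2, map_sub, map_neg, map_smul, h.field_dxPow_apply,
    h.field_Dbar1_apply, h.field_Dbar2_apply, h.field_parityInv_apply, neg_neg]

end IsTranslation

/-- The action of `X_f` on pairs of functions that describes its action on symbols, for `f` in the
span of `ξ₁, ξ₂, xξ₁, xξ₂`: two `w`-densities, which are rotated into one another at the rate
`ε D̄₁ D̄₂(f) / 2`. -/
def pairAction (w ε : ℂ) (f : SuperFun) : SuperFun × SuperFun →ₗ[ℂ] SuperFun × SuperFun where
  toFun F := (densityAction w f F.1 - (ε / 2) • mulOp (Dbar1 (Dbar2 f)) F.2,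
    densityAction w f F.2 + (ε / 2) • mulOp (Dbar1 (Dbar2 f)) F.1)
  map_add' F G := by ext1 <;> simp only [Prod.fst_add, Prod.snd_add, map_add] <;> module
  map_smul' z F := by
    ext1 <;> simp only [Prod.smul_fst, Prod.smul_snd, map_smul, RingHom.id_apply] <;> module

theorem pairAction_apply (w ε : ℂ) (f : SuperFun) (F : SuperFun × SuperFun) : pairAction w ε f F
    = (densityAction w f F.1 - (ε / 2) • mulOp (Dbar1 (Dbar2 f)) F.2,
      densityAction w f F.2 + (ε / 2) • mulOp (Dbar1 (Dbar2 f)) F.1) := rfl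

/-- The odd Hamiltonians that generate `osp(2|2)`. -/
def oddGenerators : Set SuperFun := {xi1, xi2, funX * xi1, funX * xi2}

/-- The quantization of the symbols of contact order `i/2`. -/
def quantPair (lam mu : ℂ) (i : ℕ) : SuperFun × SuperFun →ₗ[ℂ] Op :=
  if i % 2 = 0 then intQuant Dbar1 Dbar2 lam mu (i / 2) else halfQuant Dbar1 Dbar2 lam mu (i / 2)

theorem quantPair_even (lam mu : ℂ) (K : ℕ) :
    quantPair lam mu (2 * K) = intQuant Dbar1 Dbar2 lam mu K := by simp [quantPair]

theorem quantPair_odd (lam mu : ℂ) (K : ℕ) :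
    quantPair lam mu (2 * K + 1) = halfQuant Dbar1 Dbar2 lam mu K := by
  have h1 : (2 * K + 1) % 2 = 1 := by omega
  have h2 : (2 * K + 1) / 2 = K := by omega
  simp [quantPair, h1, h2]

/-- The denominators `gbinom N q` in integer contact order do not vanish. -/
theorem even_ne_of_nonresonant {lam mu : ℂ} (hres : ∀ j : ℕ, mu - lam ≠ (j : ℂ) / 2) (K i : ℕ)
    (hi : i ≤ K) : 2 * (K : ℂ) - 2 * (mu - lam) ≠ i := by
  intro h
  refine hres (2 * K - i) ?_
  rw [Nat.cast_sub (by omega)]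
  push_cast
  linear_combination (-1 / 2) * h

/-- The denominators `gbinom N q`, `N - q`, `N - 1` in half-integer contact order do not vanish. -/
theorem odd_ne_of_nonresonant {lam mu : ℂ} (hres : ∀ j : ℕ, mu - lam ≠ (j : ℂ) / 2) (K i : ℕ)
    (hi : i ≤ K + 1) : 2 * (K : ℂ) + 1 - 2 * (mu - lam) ≠ i := by
  intro h
  refine hres (2 * K + 1 - i) ?_
  rw [Nat.cast_sub (by omega)]
  push_cast
  linear_combination (-1 / 2) * h

theorem intQuant_rotate (lam mu : ℂ) (K : ℕ) (F₁ F₂ : SuperFun) :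
    intQuant Dbar2 (-Dbar1) lam mu K (F₁, F₂) = intQuant Dbar1 Dbar2 lam mu K (F₁, F₂) := by
  rw [intQuant_apply, intQuant_apply]
  exact Finset.sum_congr rfl fun q _ => intTerm_rotate _ _ _ _ _ _ _ _ _ _

theorem halfQuant_rotate (lam mu : ℂ) (K : ℕ) (F₁ F₂ : SuperFun) :
    halfQuant Dbar2 (-Dbar1) lam mu K (F₂, -F₁) = halfQuant Dbar1 Dbar2 lam mu K (F₁, F₂) := by
  rw [halfQuant_apply, halfQuant_apply]
  exact Finset.sum_congr rfl fun q _ => halfTerm_rotate _ _ _ _ _ _ _ _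

/-- The quantization intertwines the action of the odd generators on pairs of functions with their
action on operators. -/
theorem opAction_quantPair {lam mu : ℂ} (hres : ∀ j : ℕ, mu - lam ≠ (j : ℂ) / 2) {f : SuperFun}
    (hf : f ∈ oddGenerators) (i : ℕ) (F : SuperFun × SuperFun) :
    opAction lam mu f (quantPair lam mu i F)
      = quantPair lam mu i (pairAction (mu - lam - i / 2) (i % 2 : ℕ) f F) := by
  have trans {ψ : SuperFun} (h : IsTranslation ψ) : opAction lam mu ψ (quantPair lam mu i F)
      = quantPair lam mu i (pairAction (mu - lam - i / 2) (i % 2 : ℕ) ψ F) := by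
    rw [pairAction_apply, h.density_eq, h.Dbar_eq, mulOp_zero]
    obtain ⟨K, rfl | rfl⟩ := Nat.even_or_odd' i
    · rw [quantPair_even, intQuant_apply, map_sum, intQuant_apply]
      simp [h.opAction_intTerm]
    · rw [quantPair_odd, halfQuant_apply, map_sum, halfQuant_apply]
      simp [h.opAction_halfTerm]
  obtain ⟨F₁, F₂⟩ := F
  rcases hf with rfl | rfl | rfl | rfl
  · exact trans isTranslation_xi1
  · exact trans isTranslation_xi2
  · rw [pairAction_apply, Dbar_funX_xi1]
    obtain ⟨K, rfl | rfl⟩ := Nat.even_or_odd' i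
    · rw [quantPair_even, frame_xi1.opAction_intQuant (even_ne_of_nonresonant hres K)]
      simp
    · rw [quantPair_odd,
        frame_xi1.opAction_halfQuant fun j hj => odd_ne_of_nonresonant hres K j (by omega)]
      simp [Nat.add_mod, add_div, sub_sub, add_assoc]
  · rw [pairAction_apply, Dbar_funX_xi2]
    obtain ⟨K, rfl | rfl⟩ := Nat.even_or_odd' i
    · rw [quantPair_even, ← intQuant_rotate, ← intQuant_rotate,
        frame_xi2.opAction_intQuant (even_ne_of_nonresonant hres K)]
      simp
    · rw [quantPair_odd, ← halfQuant_rotate, ← halfQuant_rotate,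
        frame_xi2.opAction_halfQuant fun j hj => odd_ne_of_nonresonant hres K j (by omega)]
      congr 1
      ext1
      · simp [Nat.add_mod, add_div, sub_sub, add_assoc]
      · simp [Nat.add_mod, add_div, sub_sub, add_assoc]
        abel

/-! ### Principal symbols of the quantization -/

theorem dxPow_word_mem (a : SuperFun) {l : ℤ} {m n i : ℕ} (hm : m ≤ 1) (hn : n ≤ 1)
    (hi : 2 * l + m + n < i) : mulOp a * (dxPow l * Dbar1 ^ m * Dbar2 ^ n) ∈ prevDiffOps i := by
  rcases lt_or_ge l 0 with h | h
  · simp [dxPow_neg h]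
  · lift l to ℕ using h
    rw [dxPow_natCast, ← mul_assoc, ← mul_assoc]
    exact word_mem_prev a hm hn (by omega)

theorem mulOp_dxPow_mem (a : SuperFun) {l : ℤ} {i : ℕ} (hi : 2 * l < i) :
    mulOp a * dxPow l ∈ prevDiffOps i := by
  simpa using dxPow_word_mem a (m := 0) (n := 0) (by simp) (by simp) (by simpa using hi)

theorem mulOp_dxPow_Dbar1_mem (a : SuperFun) {l : ℤ} {i : ℕ} (hi : 2 * l + 1 < i) :
    mulOp a * (dxPow l * Dbar1) ∈ prevDiffOps i := by
  simpa using dxPow_word_mem a (m := 1) (n := 0) (by simp) (by simp) (by simpa using hi)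

theorem mulOp_dxPow_Dbar2_mem (a : SuperFun) {l : ℤ} {i : ℕ} (hi : 2 * l + 1 < i) :
    mulOp a * (dxPow l * Dbar2) ∈ prevDiffOps i := by
  simpa using dxPow_word_mem a (m := 0) (n := 1) (by simp) (by simp) (by simpa using hi)

theorem mulOp_dxPow_Dbar1_Dbar2_mem (a : SuperFun) {l : ℤ} {i : ℕ} (hi : 2 * l + 2 < i) :
    mulOp a * (dxPow l * Dbar1 * Dbar2) ∈ prevDiffOps i := by
  simpa using dxPow_word_mem a (m := 1) (n := 1) (by simp) (by simp) (by push_cast; omega)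

/-- The quantization of `(F₁, F₂)` has the principal symbol `(F₁, F₂)`: the terms with `q = 0` have
the coefficient `1`, and all the others are of smaller contact order. -/
theorem quantPair_sub_topPair {lam mu : ℂ} (hres : ∀ j : ℕ, mu - lam ≠ (j : ℂ) / 2) (i : ℕ)
    (F : SuperFun × SuperFun) : quantPair lam mu i F - topPair i F ∈ prevDiffOps i := by
  obtain ⟨K, rfl | rfl⟩ := Nat.even_or_odd' i
  · rw [quantPair_even, intQuant_apply, Finset.sum_range_succ', add_sub_assoc]
    refine add_mem (Submodule.sum_mem _ fun q hq => ?_) ?_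
    · refine add_mem (add_mem (add_mem ?_ ?_) ?_) ?_
      · exact mulOp_dxPow_mem _ (by push_cast; omega)
      · exact mulOp_dxPow_Dbar1_Dbar2_mem _ (by push_cast; omega)
      · exact mulOp_dxPow_Dbar1_mem _ (by push_cast; omega)
      · exact mulOp_dxPow_Dbar2_mem _ (by push_cast; omega)
    · rw [topPair_even, intTerm, add_assoc, add_sub_right_comm]
      refine add_mem ?_ (add_mem ?_ ?_)
      · convert zero_mem (prevDiffOps (2 * K))
        simp [intα, intγ, gbinom_zero, dxPow_neg, dxPow_natCast, mul_assoc,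
          show dxPow 0 = 1 from by simp [dxPow]]
      · exact mulOp_dxPow_Dbar1_mem _ (by push_cast; omega)
      · exact mulOp_dxPow_Dbar2_mem _ (by push_cast; omega)
  · have h0 := odd_ne_of_nonresonant hres K 0 (by omega)
    have h1 := odd_ne_of_nonresonant hres K 1 (by omega)
    rw [quantPair_odd, halfQuant_apply, Finset.sum_range_succ', add_sub_assoc]
    refine add_mem (Submodule.sum_mem _ fun q hq => ?_) ?_
    · refine add_mem (add_mem (add_mem ?_ ?_) ?_) ?_
      · exact mulOp_dxPow_Dbar1_mem _ (by push_cast; omega)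
      · exact mulOp_dxPow_Dbar2_mem _ (by push_cast; omega)
      · exact mulOp_dxPow_mem _ (by push_cast; omega)
      · exact mulOp_dxPow_Dbar1_Dbar2_mem _ (by push_cast; omega)
    · set N : ℂ := 2 * K + 1 - 2 * (mu - lam)
      have hα : halfα lam N K ((0 : ℕ) : ℤ) = 1 := by
        have h1' : N - 1 ≠ 0 := sub_ne_zero.2 (by simpa using h1)
        have h0' : N ≠ 0 := by simpa using h0
        simp [halfα, halfg, gbinom_zero]
        field_simp
      rw [topPair_odd, halfTerm, add_assoc, add_sub_right_comm]
      refine add_mem ?_ (add_mem ?_ ?_)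
      · convert zero_mem (prevDiffOps (2 * K + 1))
        rw [hα]
        simp [dxPow_neg, dxPow_natCast, mul_assoc, show dxPow 0 = 1 from by simp [dxPow]]
      · exact mulOp_dxPow_mem _ (by push_cast; omega)
      · exact mulOp_dxPow_Dbar1_Dbar2_mem _ (by push_cast; omega)

theorem quantPair_zero_snd (lam mu : ℂ) (a : SuperFun) : quantPair lam mu 0 (0, a) = 0 := by
  have h := quantPair_even lam mu 0
  rw [mul_zero] at h
  rw [h, intQuant_apply]
  simp [intTerm, dxPow_neg, mulOp_zero]

/-! ### The odd generators of `osp(2|2)` -/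

theorem densityAction_apply (w : ℂ) (f g : SuperFun) :
    densityAction w f g = contactField f g + w • (dx f * g) := rfl

theorem densityAction_xi1_apply (w : ℂ) (g : SuperFun) : densityAction w xi1 g
    = (1 / 2 : ℂ) • ⟨g.f1, partialX g.f0, g.f12, partialX g.f2⟩ := by
  have h := half_add_half
  have h2 : algebraMap ℂ CircleFun 2 = 2 := map_ofNat _ 2
  rw [densityAction_apply, contactField_apply, dx_xi1]
  ext1 <;> simp [Dbar1_apply, Dbar2_apply, dx_apply, parityInv_apply, xi1, Algebra.smul_def] <;>
    simp only [← one_div] <;> grind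

theorem densityAction_xi2_apply (w : ℂ) (g : SuperFun) : densityAction w xi2 g
    = (1 / 2 : ℂ) • ⟨g.f2, -g.f12, partialX g.f0, -partialX g.f1⟩ := by
  have h := half_add_half
  have h2 : algebraMap ℂ CircleFun 2 = 2 := map_ofNat _ 2
  rw [densityAction_apply, contactField_apply, dx_xi2]
  ext1 <;> simp [Dbar1_apply, Dbar2_apply, dx_apply, parityInv_apply, xi2, Algebra.smul_def] <;>
    simp only [← one_div] <;> grind

theorem densityAction_funX_xi1_apply (w : ℂ) (g : SuperFun) : densityAction w (funX * xi1) g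
    = (1 / 2 : ℂ) • ⟨coordX * g.f1, coordX * partialX g.f0 + (2 * w) • g.f0, coordX * g.f12,
        coordX * partialX g.f2 + (1 + 2 * w) • g.f2⟩ := by
  have h := half_add_half
  have h2 : algebraMap ℂ CircleFun 2 = 2 := map_ofNat _ 2
  rw [densityAction_apply, contactField_apply, dx_funX_xi1]
  ext1 <;> simp [Dbar1_apply, Dbar2_apply, dx_apply, parityInv_apply, xi1, funX, partialX_coordX,
    Algebra.smul_def] <;> simp only [← one_div] <;> grind

theorem densityAction_funX_xi2_apply (w : ℂ) (g : SuperFun) : densityAction w (funX * xi2) g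
    = (1 / 2 : ℂ) • ⟨coordX * g.f2, -(coordX * g.f12), coordX * partialX g.f0 + (2 * w) • g.f0,
        -(coordX * partialX g.f1 + (1 + 2 * w) • g.f1)⟩ := by
  have h := half_add_half
  have h2 : algebraMap ℂ CircleFun 2 = 2 := map_ofNat _ 2
  rw [densityAction_apply, contactField_apply, dx_funX_xi2]
  ext1 <;> simp [Dbar1_apply, Dbar2_apply, dx_apply, parityInv_apply, xi2, funX, partialX_coordX,
    Algebra.smul_def] <;> simp only [← one_div] <;> grind

/-- `h` is the contact bracket of the odd functions `f` and `g`, as far as the action on densities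
is concerned. -/
structure IsOddBracket (f g h : SuperFun) : Prop where
  left_even : evenPart f = 0
  left_odd : oddPart f = f
  right_even : evenPart g = 0
  right_odd : oddPart g = g
  even : evenPart h = h
  odd : oddPart h = 0
  bracket (w : ℂ) : densityAction w f * densityAction w g + densityAction w g * densityAction w f
    = densityAction w h

theorem isOddBracket_xi1_xi1 : IsOddBracket xi1 xi1 ((1 / 2 : ℂ) • funOne) where
  left_even := rfl
  left_odd := rfl
  right_even := rfl
  right_odd := rfl
  even := by ext1 <;> simp [evenPart, funOne]
  odd := by ext1 <;> simp [oddPart, funOne]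
  bracket w := by
    refine LinearMap.ext fun g => ?_
    have h := half_add_half
    have h2 : algebraMap ℂ CircleFun 2 = 2 := map_ofNat _ 2
    simp only [LinearMap.add_apply, Module.End.mul_apply, densityAction_xi1_apply]
    rw [densityAction_apply, contactField_apply]
    ext1 <;> simp [Dbar1_apply, Dbar2_apply, dx_apply, parityInv_apply, funOne,
      Algebra.smul_def] <;> simp only [← one_div] <;> grind

theorem isOddBracket_xi1_funX_xi1 : IsOddBracket xi1 (funX * xi1) ((1 / 2 : ℂ) • funX) where
  left_even := rfl
  left_odd := rfl
  right_even := frame_xi1.evenPart_eq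
  right_odd := frame_xi1.oddPart_eq
  even := by ext1 <;> simp [evenPart, funX]
  odd := by ext1 <;> simp [oddPart, funX]
  bracket w := by
    refine LinearMap.ext fun g => ?_
    have h := half_add_half
    have h2 : algebraMap ℂ CircleFun 2 = 2 := map_ofNat _ 2
    simp only [LinearMap.add_apply, Module.End.mul_apply, densityAction_xi1_apply,
      densityAction_funX_xi1_apply]
    rw [densityAction_apply, contactField_apply]
    ext1 <;> simp [Dbar1_apply, Dbar2_apply, dx_apply, parityInv_apply, funX,
      Derivation.leibniz, partialX_coordX, Algebra.smul_def] <;> simp only [← one_div] <;> grind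

theorem isOddBracket_xi1_funX_xi2 :
    IsOddBracket xi1 (funX * xi2) ((1 / 2 : ℂ) • (xi1 * xi2)) where
  left_even := rfl
  left_odd := rfl
  right_even := frame_xi2.evenPart_eq
  right_odd := frame_xi2.oddPart_eq
  even := by ext1 <;> simp [evenPart, xi1, xi2]
  odd := by ext1 <;> simp [oddPart, xi1, xi2]
  bracket w := by
    refine LinearMap.ext fun g => ?_
    have h := half_add_half
    have h2 : algebraMap ℂ CircleFun 2 = 2 := map_ofNat _ 2
    simp only [LinearMap.add_apply, Module.End.mul_apply, densityAction_xi1_apply,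
      densityAction_funX_xi2_apply]
    rw [densityAction_apply, contactField_apply]
    ext1 <;> simp [Dbar1_apply, Dbar2_apply, dx_apply, parityInv_apply, xi1, xi2,
      Derivation.leibniz, partialX_coordX, Algebra.smul_def] <;> simp only [← one_div] <;> grind

theorem isOddBracket_funX_xi1_funX_xi1 :
    IsOddBracket (funX * xi1) (funX * xi1) ((1 / 2 : ℂ) • (funX * funX)) where
  left_even := frame_xi1.evenPart_eq
  left_odd := frame_xi1.oddPart_eq
  right_even := frame_xi1.evenPart_eq
  right_odd := frame_xi1.oddPart_eq
  even := by ext1 <;> simp [evenPart, funX]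
  odd := by ext1 <;> simp [oddPart, funX]
  bracket w := by
    refine LinearMap.ext fun g => ?_
    have h := half_add_half
    have h2 : algebraMap ℂ CircleFun 2 = 2 := map_ofNat _ 2
    simp only [LinearMap.add_apply, Module.End.mul_apply, densityAction_funX_xi1_apply]
    rw [densityAction_apply, contactField_apply]
    ext1 <;> simp [Dbar1_apply, Dbar2_apply, dx_apply, parityInv_apply, funX,
      Derivation.leibniz, partialX_coordX, Algebra.smul_def] <;> simp only [← one_div] <;> grind

/-! ### Linearity of the action in the Hamiltonian, and brackets -/

theorem opAction_add_left (lam mu : ℂ) (f g : SuperFun) (A : Op) :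
    opAction lam mu (f + g) A = opAction lam mu f A + opAction lam mu g A := by
  have hd (w : ℂ) (f g : SuperFun) :
      densityAction w (f + g) = densityAction w f + densityAction w g := by
    simp only [densityAction, contactField_add, map_add, mulOp_add]
    module
  have he : evenPart (f + g) = evenPart f + evenPart g := by ext1 <;> simp [evenPart]
  have ho : oddPart (f + g) = oddPart f + oddPart g := by ext1 <;> simp [oddPart]
  simp only [opAction_apply, hd, he, ho, add_mul, mul_add]
  abel

theorem contactField_smul (z : ℂ) (f : SuperFun) :
    contactField (z • f) = z • contactField f := by
  simp only [contactField, map_smul, mulOp_smul, smul_mul_assoc]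
  module

theorem opAction_smul_left (lam mu z : ℂ) (f : SuperFun) (A : Op) :
    opAction lam mu (z • f) A = z • opAction lam mu f A := by
  have hd (w : ℂ) (f : SuperFun) : densityAction w (z • f) = z • densityAction w f := by
    simp only [densityAction, contactField_smul, map_smul, mulOp_smul]
    module
  have he : evenPart (z • f) = z • evenPart f := by ext1 <;> simp [evenPart]
  have ho : oddPart (z • f) = z • oddPart f := by ext1 <;> simp [oddPart]
  simp only [opAction_apply, hd, he, ho, smul_mul_assoc, mul_smul_comm, smul_sub]

theorem densityAction_zero_right (w : ℂ) : densityAction w 0 = 0 := by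
  simp [densityAction, contactField_zero, mulOp_zero]

theorem opAction_of_odd {f : SuperFun} (h0 : evenPart f = 0) (h1 : oddPart f = f) (lam mu : ℂ)
    (A : Op) : opAction lam mu f A
      = densityAction mu f * A - opParity A * densityAction lam f := by
  rw [opAction_apply, h0, h1, densityAction_zero_right, mul_zero, sub_zero]

theorem densityAction_parity {f : SuperFun} (h1 : oddPart f = f) (w : ℂ) :
    opParity (densityAction w f) = -densityAction w f := by
  have h2 : parityInv (dx f) = -dx f := by
    rw [← h1]; ext1 <;> simp [parityInv_apply, dx_apply, oddPart]
  rw [densityAction, opParity_add, opParity_smul, contactField_parity h1, opParity_mulOp, h2,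
    mulOp_neg, smul_neg, neg_add]

theorem opParity_opParity (A : Op) : opParity (opParity A) = A := by
  change parityInv * (parityInv * A * parityInv) * parityInv = A
  have : parityInv * (parityInv * A * parityInv) * parityInv
      = parityInv * parityInv * A * (parityInv * parityInv) := by simp only [mul_assoc]
  rw [this, parityInv_sq, one_mul, mul_one]

theorem opParity_sub (A B : Op) : opParity (A - B) = opParity A - opParity B := by
  rw [sub_eq_add_neg, opParity_add, opParity_neg, sub_eq_add_neg]

/-- The action on operators respects the bracket. -/
theorem IsOddBracket.opAction_eq {f g h : SuperFun} (H : IsOddBracket f g h) (lam mu : ℂ)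
    (A : Op) : opAction lam mu h A
      = opAction lam mu f (opAction lam mu g A) + opAction lam mu g (opAction lam mu f A) := by
  rw [opAction_of_odd H.left_even H.left_odd, opAction_of_odd H.right_even H.right_odd,
    opAction_of_odd H.left_even H.left_odd, opAction_of_odd H.right_even H.right_odd,
    opParity_sub, opParity_sub, opParity_mul, opParity_mul, opParity_mul, opParity_mul,
    densityAction_parity H.left_odd, densityAction_parity H.left_odd,
    densityAction_parity H.right_odd, densityAction_parity H.right_odd, opParity_opParity,
    opAction_apply, H.even, H.odd, densityAction_zero_right, mul_zero, sub_zero, ← H.bracket,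
    ← H.bracket]
  noncomm_ring

/-! ### The quantization map -/

theorem principalSymbol_eq_iff {i : ℕ} (A B : diffOps i) :
    principalSymbol i A = principalSymbol i B ↔ (A : Op) - B ∈ prevDiffOps i :=
  Submodule.Quotient.eq _

/-- The symbol of contact order `i/2` with the components `(F₁, F₂)`. -/
def topSymbol (i : ℕ) : SuperFun × SuperFun →ₗ[ℂ] Gr i :=
  principalSymbol i ∘ₗ (topPair i).codRestrict (diffOps i) (topPair_mem i)

theorem topSymbol_eq_iff {i : ℕ} (F : SuperFun × SuperFun) (A : diffOps i) :
    principalSymbol i A = topSymbol i F ↔ (A : Op) - topPair i F ∈ prevDiffOps i :=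
  principalSymbol_eq_iff A ⟨topPair i F, topPair_mem i F⟩

theorem exists_topSymbol {i : ℕ} (s : Gr i) : ∃ F, topSymbol i F = s := by
  obtain ⟨A, rfl⟩ := Submodule.mkQ_surjective _ s
  obtain ⟨F, hF⟩ := exists_topPair A.2
  exact ⟨F, ((topSymbol_eq_iff F A).2 hF).symm⟩

theorem topSymbol_eq_zero {i : ℕ} {F : SuperFun × SuperFun} (h : topSymbol i F = 0) :
    F.1 = 0 ∧ (i ≠ 0 → F.2 = 0) := by
  rw [← map_zero (principalSymbol i), eq_comm, topSymbol_eq_iff] at h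
  refine topPair_injective ?_
  rw [← neg_mem_iff]
  simpa using h

theorem topSymbol_zero (a : SuperFun) : topSymbol 0 (0, a) = 0 := by
  rw [← map_zero (principalSymbol 0), eq_comm, topSymbol_eq_iff, topPair_zero, mulOp_zero]
  simp

/-- The components of a symbol exist and are unique, except that a symbol of order `0` has no
second component; it is set to `0`. -/
theorem exists_coords (i : ℕ) : ∃ c : Gr i →ₗ[ℂ] SuperFun × SuperFun,
    (∀ s, topSymbol i (c s) = s) ∧ (i = 0 → ∀ s, (c s).2 = 0) := by
  obtain ⟨c, hc⟩ := (topSymbol i).exists_rightInverse_of_surjective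
    (LinearMap.range_eq_top.2 exists_topSymbol)
  have hc' (s : Gr i) : topSymbol i (c s) = s := LinearMap.congr_fun hc s
  by_cases hi : i = 0
  · subst hi
    refine ⟨(LinearMap.inl ℂ SuperFun SuperFun ∘ₗ LinearMap.fst ℂ SuperFun SuperFun) ∘ₗ c,
      fun s => ?_, fun _ _ => rfl⟩
    have h : c s = ((c s).1, 0) + (0, (c s).2) := by simp
    have h' := hc' s
    rw [h, map_add, topSymbol_zero, add_zero] at h'
    exact h'
  · exact ⟨c, hc', fun h => absurd h hi⟩

/-- The components of a symbol of contact order `i/2`. -/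
def coords (i : ℕ) : Gr i →ₗ[ℂ] SuperFun × SuperFun := (exists_coords i).choose

theorem topSymbol_coords {i : ℕ} (s : Gr i) : topSymbol i (coords i s) = s :=
  (exists_coords i).choose_spec.1 s

theorem coords_zero_snd (s : Gr 0) : (coords 0 s).2 = 0 :=
  (exists_coords 0).choose_spec.2 rfl s

theorem coords_topSymbol_fst {i : ℕ} (F : SuperFun × SuperFun) :
    (coords i (topSymbol i F)).1 = F.1 := by
  have h : topSymbol i (coords i (topSymbol i F) - F) = 0 := by
    rw [map_sub, topSymbol_coords, sub_self]
  exact sub_eq_zero.1 (topSymbol_eq_zero h).1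

theorem coords_topSymbol_snd {i : ℕ} (hi : i ≠ 0) (F : SuperFun × SuperFun) :
    (coords i (topSymbol i F)).2 = F.2 := by
  have h : topSymbol i (coords i (topSymbol i F) - F) = 0 := by
    rw [map_sub, topSymbol_coords, sub_self]
  exact sub_eq_zero.1 ((topSymbol_eq_zero h).2 hi)

/-- The quantization of the symbols of contact order `i/2`. -/
def quantGr (lam mu : ℂ) (i : ℕ) : Gr i →ₗ[ℂ] Op := quantPair lam mu i ∘ₗ coords i

theorem quantGr_topSymbol (lam mu : ℂ) {i : ℕ} (F : SuperFun × SuperFun) :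
    quantGr lam mu i (topSymbol i F) = quantPair lam mu i F := by
  change quantPair lam mu i (coords i (topSymbol i F)) = _
  rcases eq_or_ne i 0 with rfl | hi
  · obtain ⟨F₁, F₂⟩ := F
    have h : (F₁, F₂) = coords 0 (topSymbol 0 (F₁, F₂)) + (0, F₂) := by
      ext1
      · simp [coords_topSymbol_fst]
      · simp [coords_zero_snd]
    conv_rhs => rw [h]
    rw [map_add, quantPair_zero_snd, add_zero]
  · exact congrArg _ (Prod.ext (coords_topSymbol_fst F) (coords_topSymbol_snd hi F))

theorem quantGr_mem {lam mu : ℂ} (hres : ∀ j : ℕ, mu - lam ≠ (j : ℂ) / 2) {i : ℕ} (s : Gr i) :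
    quantGr lam mu i s ∈ diffOps i := by
  have h := prevDiffOps_le i (quantPair_sub_topPair hres i (coords i s))
  have h' := add_mem h (topPair_mem i (coords i s))
  rwa [sub_add_cancel] at h'

theorem principalSymbol_quantGr {lam mu : ℂ} (hres : ∀ j : ℕ, mu - lam ≠ (j : ℂ) / 2) {i : ℕ}
    (s : Gr i) : principalSymbol i ⟨quantGr lam mu i s, quantGr_mem hres s⟩ = s := by
  conv_rhs => rw [← topSymbol_coords s]
  rw [topSymbol_eq_iff]
  exact quantPair_sub_topPair hres i (coords i s)

theorem grAction_principalSymbol (lam mu : ℂ) (f : SuperFun) {i : ℕ} (A : diffOps i) :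
    grAction lam mu f i (principalSymbol i A)
      = principalSymbol i ⟨opAction lam mu f A, opAction_mem lam mu f A.2⟩ := rfl

/-- The action of the odd generators on the components of a symbol. It is read off from the
equivariance of the quantization: an operator and the quantization of its symbol have the same
symbol. -/
theorem grAction_topSymbol {lam mu : ℂ} (hres : ∀ j : ℕ, mu - lam ≠ (j : ℂ) / 2) {f : SuperFun}
    (hf : f ∈ oddGenerators) {i : ℕ} (F : SuperFun × SuperFun) :
    grAction lam mu f i (topSymbol i F)
      = topSymbol i (pairAction (mu - lam - i / 2) (i % 2 : ℕ) f F) := by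
  change principalSymbol i ⟨opAction lam mu f (topPair i F), _⟩ = _
  rw [topSymbol_eq_iff]
  have h1 := opAction_mem_prev lam mu f (quantPair_sub_topPair hres i F)
  have h2 := quantPair_sub_topPair hres i (pairAction (mu - lam - i / 2) (i % 2 : ℕ) f F)
  rw [map_sub, opAction_quantPair hres hf] at h1
  simpa using sub_mem h2 h1

theorem quantGr_grAction_of_mem {lam mu : ℂ} (hres : ∀ j : ℕ, mu - lam ≠ (j : ℂ) / 2)
    {f : SuperFun} (hf : f ∈ oddGenerators) {i : ℕ} (s : Gr i) :
    quantGr lam mu i (grAction lam mu f i s) = opAction lam mu f (quantGr lam mu i s) := by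
  obtain ⟨F, rfl⟩ := exists_topSymbol s
  rw [grAction_topSymbol hres hf, quantGr_topSymbol, quantGr_topSymbol, opAction_quantPair hres hf]

/-- The Hamiltonians under whose contact fields a family of linear maps from symbols to operators is
equivariant. -/
def equivariantHamiltonians (lam mu : ℂ) (q : ∀ i, Gr i →ₗ[ℂ] Op) : Submodule ℂ SuperFun where
  carrier := {f | ∀ i s, q i (grAction lam mu f i s) = opAction lam mu f (q i s)}
  add_mem' {f g} hf hg i s := by
    obtain ⟨A, rfl⟩ := Submodule.mkQ_surjective _ s
    have : grAction lam mu (f + g) i (principalSymbol i A)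
        = grAction lam mu f i (principalSymbol i A)
          + grAction lam mu g i (principalSymbol i A) := by
      simp only [grAction_principalSymbol, ← map_add]
      exact congrArg _ (Subtype.ext (opAction_add_left lam mu f g A))
    have hf' := hf i (principalSymbol i A)
    have hg' := hg i (principalSymbol i A)
    change q i (grAction lam mu (f + g) i (principalSymbol i A))
      = opAction lam mu (f + g) (q i (principalSymbol i A))
    rw [this, map_add, hf', hg', opAction_add_left]
  zero_mem' i s := by
    obtain ⟨A, rfl⟩ := Submodule.mkQ_surjective _ s
    have h0 (B : Op) : opAction lam mu 0 B = 0 := by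
      rw [← zero_smul ℂ (0 : SuperFun), opAction_smul_left, zero_smul]
    have : grAction lam mu 0 i (principalSymbol i A) = 0 := by
      rw [grAction_principalSymbol, ← map_zero (principalSymbol i)]
      exact congrArg _ (Subtype.ext (h0 A))
    change q i (grAction lam mu 0 i (principalSymbol i A)) = _
    rw [this, map_zero, h0]
  smul_mem' z f hf i s := by
    obtain ⟨A, rfl⟩ := Submodule.mkQ_surjective _ s
    have : grAction lam mu (z • f) i (principalSymbol i A)
        = z • grAction lam mu f i (principalSymbol i A) := by
      simp only [grAction_principalSymbol, ← map_smul]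
      exact congrArg _ (Subtype.ext (opAction_smul_left lam mu z f A))
    have hf' := hf i (principalSymbol i A)
    change q i (grAction lam mu (z • f) i (principalSymbol i A))
      = opAction lam mu (z • f) (q i (principalSymbol i A))
    rw [this, map_smul, hf', opAction_smul_left]

/-- Equivariance passes to brackets. -/
theorem IsOddBracket.mem_equivariantHamiltonians {f g h : SuperFun} (H : IsOddBracket f g h)
    {lam mu : ℂ} {q : ∀ i, Gr i →ₗ[ℂ] Op} (hf : f ∈ equivariantHamiltonians lam mu q)
    (hg : g ∈ equivariantHamiltonians lam mu q) : h ∈ equivariantHamiltonians lam mu q := by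
  intro i s
  have : grAction lam mu h i s = grAction lam mu f i (grAction lam mu g i s)
      + grAction lam mu g i (grAction lam mu f i s) := by
    obtain ⟨A, rfl⟩ := Submodule.mkQ_surjective _ s
    exact congrArg (principalSymbol i) (Subtype.ext (H.opAction_eq lam mu A))
  rw [this, map_add, hf, hg, hg, hf, H.opAction_eq]

/-- The odd generators generate `osp(2|2)`: equivariance under them implies equivariance under all
of it. -/
theorem ospHamiltonians_le {lam mu : ℂ} {q : ∀ i, Gr i →ₗ[ℂ] Op}
    (h : oddGenerators ⊆ equivariantHamiltonians lam mu q) :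
    ospHamiltonians ≤ equivariantHamiltonians lam mu q := by
  have h1 : xi1 ∈ equivariantHamiltonians lam mu q := h (by simp [oddGenerators])
  have h2 : xi2 ∈ equivariantHamiltonians lam mu q := h (by simp [oddGenerators])
  have h3 : funX * xi1 ∈ equivariantHamiltonians lam mu q := h (by simp [oddGenerators])
  have h4 : funX * xi2 ∈ equivariantHamiltonians lam mu q := h (by simp [oddGenerators])
  have half {f : SuperFun} (hf : (1 / 2 : ℂ) • f ∈ equivariantHamiltonians lam mu q) :
      f ∈ equivariantHamiltonians lam mu q :=
    (Submodule.smul_mem_iff _ (by norm_num)).1 hf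
  refine Submodule.span_le.2 ?_
  rintro f (rfl | rfl | rfl | rfl | rfl | rfl | rfl | rfl)
  · exact half (isOddBracket_xi1_xi1.mem_equivariantHamiltonians h1 h1)
  · exact h1
  · exact h2
  · exact half (isOddBracket_xi1_funX_xi1.mem_equivariantHamiltonians h1 h3)
  · exact half (isOddBracket_xi1_funX_xi2.mem_equivariantHamiltonians h1 h4)
  · exact h3
  · exact h4
  · exact half (isOddBracket_funX_xi1_funX_xi1.mem_equivariantHamiltonians h3 h3)

theorem diffOps_le_all (i : ℕ) : diffOps i ≤ allDiffOps := le_iSup diffOps i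

/-- The quantization map. -/
def quantMap {lam mu : ℂ} (hres : ∀ j : ℕ, mu - lam ≠ (j : ℂ) / 2) : Symbols →ₗ[ℂ] allDiffOps :=
  DirectSum.toModule ℂ ℕ allDiffOps fun i =>
    (quantGr lam mu i).codRestrict allDiffOps fun s => diffOps_le_all i (quantGr_mem hres s)

theorem quantMap_lof {lam mu : ℂ} (hres : ∀ j : ℕ, mu - lam ≠ (j : ℂ) / 2) (i : ℕ) (s : Gr i) :
    (quantMap hres (DirectSum.lof ℂ ℕ Gr i s) : Op) = quantGr lam mu i s := by
  rw [quantMap, DirectSum.toModule_lof]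
  rfl

theorem symbolAction_lof (lam mu : ℂ) (f : SuperFun) (i : ℕ) (s : Gr i) :
    symbolAction lam mu f (DirectSum.lof ℂ ℕ Gr i s)
      = DirectSum.lof ℂ ℕ Gr i (grAction lam mu f i s) :=
  DirectSum.lmap_lof _ _ _

/-- A linear map that preserves principal symbols is bijective, by induction along the contact
filtration: the component of highest order of a symbol is determined by its image, and an operator
can be corrected to smaller order by the image of its principal symbol. -/
theorem bijective_of_principalSymbol {Q : Symbols →ₗ[ℂ] allDiffOps}
    (hQ : ∀ (i : ℕ) (s : Gr i), ∃ h : (Q (DirectSum.lof ℂ ℕ Gr i s) : Op) ∈ diffOps i,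
      principalSymbol i ⟨(Q (DirectSum.lof ℂ ℕ Gr i s) : Op), h⟩ = s) :
    Function.Bijective Q := by
  constructor
  · have key : ∀ n (s : Symbols), (∀ i, n ≤ i → s i = 0) →
        (Q s : Op) ∈ prevDiffOps n ∧ (Q s = 0 → s = 0) := by
      intro n
      induction n with
      | zero =>
        intro s hs
        have : s = 0 := DFinsupp.ext fun i => hs i (Nat.zero_le i)
        subst this
        simp
      | succ n ih =>
        intro s hs
        set t : Symbols := s + (-1 : ℂ) • DirectSum.lof ℂ ℕ Gr n (s n) with ht
        have hst : s = t + DirectSum.lof ℂ ℕ Gr n (s n) := by rw [ht]; module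
        have htn : ∀ i, n ≤ i → t i = 0 := by
          intro i hi
          rw [ht, DirectSum.add_apply, DirectSum.smul_apply]
          rcases hi.eq_or_lt with rfl | hi
          · rw [DirectSum.lof_apply]
            module
          · rw [hs i hi, DirectSum.lof_eq_of, DirectSum.of_eq_of_ne _ _ _ (by omega), smul_zero,
              add_zero]
        obtain ⟨h1, h2⟩ := ih t htn
        obtain ⟨hm, hp⟩ := hQ n (s n)
        have hQs : (Q s : Op) = (Q t : Op) + Q (DirectSum.lof ℂ ℕ Gr n (s n)) := by
          conv_lhs => rw [hst, map_add]
          rfl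
        refine ⟨?_, fun h => ?_⟩
        · rw [hQs]
          exact add_mem (prevDiffOps_le n h1) hm
        · have hs0 : s n = 0 := by
            rw [← hp, ← map_zero (principalSymbol n), principalSymbol_eq_iff]
            have : (Q (DirectSum.lof ℂ ℕ Gr n (s n)) : Op) = -(Q t : Op) := by
              rw [h] at hQs
              exact (neg_eq_of_add_eq_zero_right hQs.symm).symm
            simpa [this] using h1
          have hst' : s = t := by rw [ht, hs0, map_zero]; module
          rw [hst']
          exact h2 (by rw [← hst', h])
    intro a b hab
    set s : Symbols := a + (-1 : ℂ) • b with hsdef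
    have hs : Q s = 0 := by
      rw [hsdef, map_add, map_smul, hab]
      module
    obtain ⟨n, hn⟩ : ∃ n, ∀ i, n ≤ i → s i = 0 := by
      classical
      refine ⟨s.support.sup id + 1, fun i hi => ?_⟩
      by_contra h
      have := Finset.le_sup (f := id) (DFinsupp.mem_support_iff.2 h)
      simp only [id] at this
      omega
    have h0 : a + (-1 : ℂ) • b = 0 := (key n s hn).2 hs
    calc a = a + (-1 : ℂ) • b + b := by module
      _ = b := by rw [h0, zero_add]
  · have key : ∀ n, ∀ A ∈ prevDiffOps n, ∃ s, (Q s : Op) = A := by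
      intro n
      induction n with
      | zero =>
        intro A hA
        have : A = 0 := hA
        exact ⟨0, by simp [this]⟩
      | succ n ih =>
        intro A hA
        obtain ⟨hm, hp⟩ := hQ n (principalSymbol n ⟨A, hA⟩)
        obtain ⟨s, hs⟩ := ih _ ((principalSymbol_eq_iff _ _).1 hp)
        refine ⟨DirectSum.lof ℂ ℕ Gr n (principalSymbol n ⟨A, hA⟩) + (-1 : ℂ) • s, ?_⟩
        rw [map_add, map_smul, Submodule.coe_add, Submodule.coe_smul, hs]
        module
    rintro ⟨A, hA⟩
    obtain ⟨i, hi⟩ := (Submodule.mem_iSup_of_directed _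
      (monotone_nat_of_le_succ fun i => diffOps_mono (Nat.le_succ i)).directed_le).1 hA
    obtain ⟨s, hs⟩ := key (i + 1) A hi
    exact ⟨s, Subtype.ext hs⟩

theorem isQuantizationMap_quantMap {lam mu : ℂ} (hres : ∀ j : ℕ, mu - lam ≠ (j : ℂ) / 2) :
    IsQuantizationMap (quantMap hres) := by
  have h : ∀ (i : ℕ) (s : Gr i),
      ∃ h : (quantMap hres (DirectSum.lof ℂ ℕ Gr i s) : Op) ∈ diffOps i,
        principalSymbol i ⟨(quantMap hres (DirectSum.lof ℂ ℕ Gr i s) : Op), h⟩ = s := by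
    intro i s
    simp only [quantMap_lof]
    exact ⟨quantGr_mem hres s, principalSymbol_quantGr hres s⟩
  exact ⟨bijective_of_principalSymbol h, h⟩

theorem isOspEquivariant_quantMap {lam mu : ℂ} (hres : ∀ j : ℕ, mu - lam ≠ (j : ℂ) / 2) :
    IsOspEquivariant lam mu (quantMap hres) := by
  intro f hf s
  have hf' := ospHamiltonians_le (lam := lam) (mu := mu) (q := quantGr lam mu)
    (fun g hg i s => quantGr_grAction_of_mem hres hg s) hf
  induction s using DirectSum.induction_on with
  | zero => simp
  | of i s =>
    rw [← DirectSum.lof_eq_of ℂ, symbolAction_lof, quantMap_lof, quantMap_lof]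
    exact hf' i s
  | add s t hs ht => simp only [map_add, Submodule.coe_add, hs, ht]

/-! ### Uniqueness -/

section PairActionFormulas

variable (w ε : ℂ) (F : SuperFun × SuperFun)

theorem pairAction_xi1 : pairAction w ε xi1 F = (1 / 2 : ℂ) •
    ((⟨F.1.f1, partialX F.1.f0, F.1.f12, partialX F.1.f2⟩,
      ⟨F.2.f1, partialX F.2.f0, F.2.f12, partialX F.2.f2⟩) : SuperFun × SuperFun) := by
  rw [pairAction_apply, isTranslation_xi1.Dbar_eq, mulOp_zero, densityAction_xi1_apply,
    densityAction_xi1_apply]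
  simp

theorem pairAction_xi2 : pairAction w ε xi2 F = (1 / 2 : ℂ) •
    ((⟨F.1.f2, -F.1.f12, partialX F.1.f0, -partialX F.1.f1⟩,
      ⟨F.2.f2, -F.2.f12, partialX F.2.f0, -partialX F.2.f1⟩) : SuperFun × SuperFun) := by
  rw [pairAction_apply, isTranslation_xi2.Dbar_eq, mulOp_zero, densityAction_xi2_apply,
    densityAction_xi2_apply]
  simp

theorem pairAction_funX_xi1 : pairAction w ε (funX * xi1) F = (1 / 2 : ℂ) •
    ((⟨coordX * F.1.f1, coordX * partialX F.1.f0 + (2 * w) • F.1.f0,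
        coordX * F.1.f12 - ε • F.2.f0,
        coordX * partialX F.1.f2 + (1 + 2 * w) • F.1.f2 + ε • F.2.f1⟩,
      ⟨coordX * F.2.f1, coordX * partialX F.2.f0 + (2 * w) • F.2.f0,
        coordX * F.2.f12 + ε • F.1.f0,
        coordX * partialX F.2.f2 + (1 + 2 * w) • F.2.f2 - ε • F.1.f1⟩) :
      SuperFun × SuperFun) := by
  rw [pairAction_apply, Dbar_funX_xi1, densityAction_funX_xi1_apply, densityAction_funX_xi1_apply]
  ext1 <;> ext1 <;> simp [mulOp_apply, xi2] <;> module

theorem pairAction_funX_xi2 : pairAction w ε (funX * xi2) F = (1 / 2 : ℂ) •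
    ((⟨coordX * F.1.f2, -(coordX * F.1.f12) + ε • F.2.f0,
        coordX * partialX F.1.f0 + (2 * w) • F.1.f0,
        -(coordX * partialX F.1.f1 + (1 + 2 * w) • F.1.f1) + ε • F.2.f2⟩,
      ⟨coordX * F.2.f2, -(coordX * F.2.f12) - ε • F.1.f0,
        coordX * partialX F.2.f0 + (2 * w) • F.2.f0,
        -(coordX * partialX F.2.f1 + (1 + 2 * w) • F.2.f1) - ε • F.1.f2⟩) :
      SuperFun × SuperFun) := by
  rw [pairAction_apply, Dbar_funX_xi2, densityAction_funX_xi2_apply, densityAction_funX_xi2_apply]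
  ext1 <;> ext1 <;> simp [mulOp_apply, xi1] <;> module

end PairActionFormulas

/-- The pair `(ξ₁ ξ₂ a, ξ₁ ξ₂ b)`. -/
def topComponents (a b : CircleFun) : SuperFun × SuperFun := (⟨0, 0, 0, a⟩, ⟨0, 0, 0, b⟩)

theorem topComponents_add (a b a' b' : CircleFun) :
    topComponents (a + a') (b + b') = topComponents a b + topComponents a' b' := by
  ext1 <;> ext1 <;> simp [topComponents]

theorem topComponents_smul (z : ℂ) (a b : CircleFun) :
    topComponents (z • a) (z • b) = z • topComponents a b := by
  ext1 <;> ext1 <;> simp [topComponents]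

/-- Under the contact fields of the odd generators, the pairs `(ξ₁ ξ₂ a, ξ₁ ξ₂ b)` generate all
pairs of functions. -/
theorem eq_zero_of_topComponents {w ε w' ε' : ℂ}
    {Φ : SuperFun × SuperFun →ₗ[ℂ] SuperFun × SuperFun}
    (hΦ : ∀ f ∈ oddGenerators, ∀ F, Φ (pairAction w ε f F) = pairAction w' ε' f (Φ F))
    (h : ∀ a b, Φ (topComponents a b) = 0) : Φ = 0 := by
  have t1 (F) (hF : Φ F = 0) : Φ (pairAction w ε xi1 F) = 0 := by
    rw [hΦ _ (by simp [oddGenerators]), hF, map_zero]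
  have t2 (F) (hF : Φ F = 0) : Φ (pairAction w ε xi2 F) = 0 := by
    rw [hΦ _ (by simp [oddGenerators]), hF, map_zero]
  refine LinearMap.ext fun F => ?_
  have e : F = topComponents F.1.f12 F.2.f12
      + (2 : ℂ) • pairAction w ε xi1 (topComponents F.1.f2 F.2.f2)
      - (2 : ℂ) • pairAction w ε xi2 (topComponents F.1.f1 F.2.f1)
      - (4 : ℂ) • pairAction w ε xi1 (pairAction w ε xi2 (topComponents F.1.f0 F.2.f0)) := by
    simp only [pairAction_xi1, pairAction_xi2, topComponents]
    ext1 <;> ext1 <;> simp <;> module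
  rw [e, map_sub, map_sub, map_add, map_smul, map_smul, map_smul, h, t1 _ (h _ _), t2 _ (h _ _),
    t1 _ (t2 _ (h _ _))]
  simp

/-- Non-existence of nonzero intertwining maps between modules of pairs, unless the weights and the
rates of rotation are special. The images `r a b` of the pairs `(ξ₁ ξ₂ a, ξ₁ ξ₂ b)` are shown to
vanish, component by component. -/
theorem intertwiner_eq_zero {w ε w' ε' : ℂ}
    {Φ : SuperFun × SuperFun →ₗ[ℂ] SuperFun × SuperFun}
    (hΦ : ∀ f ∈ oddGenerators, ∀ F, Φ (pairAction w ε f F) = pairAction w' ε' f (Φ F))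
    (hw' : 4 * w' ^ 2 ≠ ε' ^ 2) (hne : w ≠ w')
    (hcase : w + w' ≠ 0 ∨ (ε = 0 ∧ ε' ≠ 0) ∨ (ε ≠ 0 ∧ ε' = 0)) : Φ = 0 := by
  have half {F G : SuperFun × SuperFun} (h : (1 / 2 : ℂ) • F = (1 / 2 : ℂ) • G) : F = G :=
    smul_right_injective _ (by norm_num : (1 / 2 : ℂ) ≠ 0) h
  set r : CircleFun → CircleFun → SuperFun × SuperFun := fun a b => Φ (topComponents a b) with hr
  have r_add (a b a' b') : r (a + a') (b + b') = r a b + r a' b' := by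
    simp only [hr, topComponents_add, map_add]
  have r_smul (z : ℂ) (a b) : r (z • a) (z • b) = z • r a b := by
    simp only [hr, topComponents_smul, map_smul]
  have g1 : xi1 ∈ oddGenerators := by simp [oddGenerators]
  have g2 : xi2 ∈ oddGenerators := by simp [oddGenerators]
  have g3 : funX * xi1 ∈ oddGenerators := by simp [oddGenerators]
  have g4 : funX * xi2 ∈ oddGenerators := by simp [oddGenerators]
  -- On `ξ₁ ξ₂ a`, the field of `xξᵢ` acts as the field of `ξᵢ` acts on `ξ₁ ξ₂ x a`.
  have I1 (a b) : pairAction w' ε' (funX * xi1) (r a b)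
      = pairAction w' ε' xi1 (r (coordX * a) (coordX * b)) := by
    rw [← hΦ _ g3, ← hΦ _ g1, pairAction_funX_xi1, pairAction_xi1]
    simp [topComponents]
  have I2 (a b) : pairAction w' ε' (funX * xi2) (r a b)
      = pairAction w' ε' xi2 (r (coordX * a) (coordX * b)) := by
    rw [← hΦ _ g4, ← hΦ _ g2, pairAction_funX_xi2, pairAction_xi2]
    simp [topComponents]
  -- The field of `1`, from the square of the field of `ξ₁`.
  have I0 (a b) : (4 : ℂ) • pairAction w' ε' xi1 (pairAction w' ε' xi1 (r a b))
      = r (partialX a) (partialX b) := by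
    rw [← hΦ _ g1, ← hΦ _ g1, ← map_smul, pairAction_xi1, pairAction_xi1]
    refine congrArg Φ ?_
    ext1 <;> ext1 <;> simp [topComponents] <;> module
  -- The field of `x`, from the bracket of `ξ₁` and `xξ₁`.
  have Ix (a b) : (2 : ℂ) • (pairAction w' ε' xi1 (pairAction w' ε' (funX * xi1) (r a b))
        + pairAction w' ε' (funX * xi1) (pairAction w' ε' xi1 (r a b)))
      = r (coordX * partialX a + (1 + w) • a) (coordX * partialX b + (1 + w) • b) := by
    rw [← hΦ _ g1, ← hΦ _ g3, ← hΦ _ g3, ← hΦ _ g1, ← map_add, ← map_smul]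
    refine congrArg Φ ?_
    simp only [pairAction_xi1, pairAction_funX_xi1]
    ext1 <;> ext1 <;> simp [topComponents, partialX_coordX] <;> module
  -- The field of `ξ₁ ξ₂`, from the bracket of `ξ₁` and `xξ₂`.
  have Iz (a b) : (4 : ℂ) • (pairAction w' ε' xi1 (pairAction w' ε' (funX * xi2) (r a b))
        + pairAction w' ε' (funX * xi2) (pairAction w' ε' xi1 (r a b)))
      = ε • r b (-a) := by
    rw [← hΦ _ g1, ← hΦ _ g4, ← hΦ _ g4, ← hΦ _ g1, ← map_add, ← map_smul, hr, ← map_smul]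
    refine congrArg Φ ?_
    simp only [pairAction_xi1, pairAction_funX_xi2]
    ext1 <;> ext1 <;> simp [topComponents] <;> module
  simp only [pairAction_xi1, pairAction_xi2, pairAction_funX_xi1, pairAction_funX_xi2]
    at I1 I2 I0 Ix Iz
  replace I1 (a b) := half (I1 a b)
  replace I2 (a b) := half (I2 a b)
  simp only [Prod.ext_iff, SuperFun.ext_iff] at I1 I2 I0 Ix Iz
  simp [-one_div, partialX_coordX] at I1 I2 I0 Ix Iz
  -- The components along `ξ₁` and `ξ₂`: `I1` and `I2` give the components of `r (x a) (x b)` and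
  -- the derivatives of these components. Their comparison is a homogeneous linear system with the
  -- determinant `(4 w' ^ 2 - ε' ^ 2) ^ 2`, up to sign.
  have h12 (a b) : ((r a b).1.f1 = 0 ∧ (r a b).1.f2 = 0) ∧ (r a b).2.f1 = 0 ∧ (r a b).2.f2 = 0 := by
    obtain ⟨⟨p1, -, -, p2⟩, p3, -, -, p4⟩ := I1 a b
    obtain ⟨⟨q1, -, -, q2⟩, q3, -, -, q4⟩ := I2 a b
    rw [← q1, Derivation.leibniz, partialX_coordX, smul_eq_mul, smul_eq_mul, mul_one] at p2
    rw [← q3, Derivation.leibniz, partialX_coordX, smul_eq_mul, smul_eq_mul, mul_one] at p4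
    rw [← p1, Derivation.leibniz, partialX_coordX, smul_eq_mul, smul_eq_mul, mul_one] at q2
    rw [← p3, Derivation.leibniz, partialX_coordX, smul_eq_mul, smul_eq_mul, mul_one] at q4
    have A : (2 * w') • (r a b).1.f2 + ε' • (r a b).2.f1 = 0 := by
      linear_combination (norm := module) p2
    have B : (2 * w') • (r a b).2.f2 - ε' • (r a b).1.f1 = 0 := by
      linear_combination (norm := module) p4
    have C : (2 * w') • (r a b).1.f1 - ε' • (r a b).2.f2 = 0 := by
      linear_combination (norm := module) -q2
    have D : (2 * w') • (r a b).2.f1 + ε' • (r a b).1.f2 = 0 := by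
      linear_combination (norm := module) -q4
    have z {c : CircleFun} (h : (4 * w' ^ 2 - ε' ^ 2) • c = 0) : c = 0 :=
      (smul_eq_zero.1 h).resolve_left (sub_ne_zero.2 hw')
    refine ⟨⟨z ?_, z ?_⟩, z ?_, z ?_⟩
    · linear_combination (norm := module) (2 * w') • C + ε' • B
    · linear_combination (norm := module) (2 * w') • A - ε' • D
    · linear_combination (norm := module) (2 * w') • D - ε' • A
    · linear_combination (norm := module) (2 * w') • B + ε' • C
  -- `∂ₓ ∘ x = x ∂ₓ + 1`, and the field of `x` acts as `x ∂ₓ` plus a constant.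
  have hx (a b) : r (partialX (coordX * a)) (partialX (coordX * b))
      = r (coordX * partialX a) (coordX * partialX b) + r a b := by
    rw [← r_add]
    simp [Derivation.leibniz, partialX_coordX]
  have hw (a b) : r (coordX * partialX a + (1 + w) • a) (coordX * partialX b + (1 + w) • b)
      = r (coordX * partialX a) (coordX * partialX b) + (1 + w) • r a b := by
    rw [r_add, r_smul]
  -- The components of degree zero: `I1` with `I0`, and `Ix`, both compute the operator `r ∘ x ∂ₓ`,
  -- with constants that differ by `w + w'`. The field of `ξ₁ ξ₂` acts on these components by the
  -- rotations of rates `ε` and `ε'`, so they vanish if exactly one of the rates is zero.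
  have h0 (a b) : (r a b).1.f0 = 0 ∧ (r a b).2.f0 = 0 := by
    rcases hcase with h | ⟨h, h'⟩ | ⟨h, h'⟩
    · obtain ⟨⟨-, p1, -⟩, -, p2, -⟩ := I1 a b
      obtain ⟨⟨q1, -⟩, q2, -⟩ := I0 (coordX * a) (coordX * b)
      obtain ⟨⟨s1, -⟩, s2, -⟩ := Ix a b
      rw [hx] at q1 q2
      rw [hw] at s1 s2
      simp at q1 q2 s1 s2
      have z {c : CircleFun} (h' : (w + w') • c = 0) : c = 0 := (smul_eq_zero.1 h').resolve_left h
      constructor <;> apply z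
      · linear_combination (norm := module) p1 + q1 - s1
      · linear_combination (norm := module) p2 + q2 - s2
    · obtain ⟨⟨p1, -⟩, p2, -⟩ := Iz a b
      rw [h, zero_smul] at p1 p2
      constructor
      · refine (smul_eq_zero.1 (?_ : ε' • (r a b).1.f0 = 0)).resolve_left h'
        linear_combination (norm := module) -p2
      · refine (smul_eq_zero.1 (?_ : ε' • (r a b).2.f0 = 0)).resolve_left h'
        linear_combination (norm := module) p1
    · obtain ⟨⟨p1, -⟩, -⟩ := Iz (-b) a
      obtain ⟨-, p2, -⟩ := Iz (-b) a
      rw [h', neg_neg, zero_smul] at p1 p2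
      constructor
      · refine (smul_eq_zero.1 (?_ : ε • (r a b).1.f0 = 0)).resolve_left h
        linear_combination (norm := module) -p1
      · refine (smul_eq_zero.1 (?_ : ε • (r a b).2.f0 = 0)).resolve_left h
        linear_combination (norm := module) -p2
  -- The components along `ξ₁ ξ₂`: the same comparison, with constants that differ by `w - w'`.
  have h3 (a b) : (r a b).1.f12 = 0 ∧ (r a b).2.f12 = 0 := by
    obtain ⟨⟨-, -, p1, -⟩, -, -, p2, -⟩ := I1 a b
    obtain ⟨⟨-, -, -, q1⟩, -, -, -, q2⟩ := I0 (coordX * a) (coordX * b)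
    obtain ⟨⟨-, -, -, s1⟩, -, -, -, s2⟩ := Ix a b
    rw [hx] at q1 q2
    rw [hw] at s1 s2
    simp only [(h0 a b).1, (h0 a b).2] at p1 p2 s1 s2
    rw [← p1] at q1
    rw [← p2] at q2
    simp [Derivation.leibniz, partialX_coordX] at q1 q2 s1 s2
    have z {c : CircleFun} (h' : (w - w') • c = 0) : c = 0 :=
      (smul_eq_zero.1 h').resolve_left (sub_ne_zero.2 hne)
    constructor <;> apply z
    · linear_combination (norm := module) q1 - s1
    · linear_combination (norm := module) q2 - s2
  refine eq_zero_of_topComponents hΦ fun a b => ?_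
  change r a b = 0
  obtain ⟨⟨e1, e2⟩, e3, e4⟩ := h12 a b
  ext1 <;> ext1
  exacts [(h0 a b).1, e1, e2, (h3 a b).1, (h0 a b).2, e3, e4, (h3 a b).2]

theorem coords_grAction {lam mu : ℂ} (hres : ∀ j : ℕ, mu - lam ≠ (j : ℂ) / 2) {f : SuperFun}
    (hf : f ∈ oddGenerators) {i : ℕ} (s : Gr i) :
    coords i (grAction lam mu f i s)
      = pairAction (mu - lam - i / 2) (i % 2 : ℕ) f (coords i s) := by
  have h : grAction lam mu f i s
      = topSymbol i (pairAction (mu - lam - i / 2) (i % 2 : ℕ) f (coords i s)) := by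
    rw [← grAction_topSymbol hres hf, topSymbol_coords]
  refine Prod.ext ?_ ?_
  · rw [h, coords_topSymbol_fst]
  · rcases eq_or_ne i 0 with rfl | hi
    · rw [coords_zero_snd, pairAction_apply, coords_zero_snd]
      simp
    · rw [h, coords_topSymbol_snd hi]

/-- The weights of the modules of symbols of contact orders `j/2 < k/2` satisfy the assumptions of
`intertwiner_eq_zero`. -/
theorem weights_of_nonresonant {lam mu : ℂ} (hres : ∀ j : ℕ, mu - lam ≠ (j : ℂ) / 2) {j k : ℕ}
    (hjk : j < k) :
    4 * (mu - lam - j / 2) ^ 2 ≠ ((j % 2 : ℕ) : ℂ) ^ 2 ∧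
      mu - lam - k / 2 ≠ mu - lam - j / 2 ∧
      ((mu - lam - k / 2) + (mu - lam - j / 2) ≠ 0 ∨
        (((k % 2 : ℕ) : ℂ) = 0 ∧ ((j % 2 : ℕ) : ℂ) ≠ 0) ∨
        (((k % 2 : ℕ) : ℂ) ≠ 0 ∧ ((j % 2 : ℕ) : ℂ) = 0)) := by
  refine ⟨fun h => ?_, fun h => ?_, ?_⟩
  · have h' : (2 * (mu - lam - j / 2) - ((j % 2 : ℕ) : ℂ))
        * (2 * (mu - lam - j / 2) + ((j % 2 : ℕ) : ℂ)) = 0 := by linear_combination h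
    rcases mul_eq_zero.1 h' with h | h
    · refine hres (j + j % 2) ?_
      push_cast
      linear_combination (1 / 2) * h
    · refine hres (j - j % 2) ?_
      rw [Nat.cast_sub (Nat.mod_le _ _)]
      linear_combination (1 / 2) * h
  · have : (j : ℂ) = k := by linear_combination 2 * h
    exact hjk.ne (Nat.cast_injective this)
  · rcases Nat.mod_two_eq_zero_or_one k with hk | hk <;>
      rcases Nat.mod_two_eq_zero_or_one j with hj | hj
    · left
      intro h
      obtain ⟨m, hm⟩ : ∃ m, k + j = 2 * m := ⟨(k + j) / 2, by omega⟩
      have hm' : (k : ℂ) + j = 2 * m := by exact_mod_cast hm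
      exact hres m (by linear_combination (1 / 2) * h + (1 / 4) * hm')
    · right; left; simp [hk, hj]
    · right; right; simp [hk, hj]
    · left
      intro h
      obtain ⟨m, hm⟩ : ∃ m, k + j = 2 * m := ⟨(k + j) / 2, by omega⟩
      have hm' : (k : ℂ) + j = 2 * m := by exact_mod_cast hm
      exact hres m (by linear_combination (1 / 2) * h + (1 / 4) * hm')

/-- An equivariant map from the symbols of contact order `k/2` to operators of smaller contact order
vanishes: it induces an intertwining map into every graded piece. -/
theorem eq_zero_of_equivariant {lam mu : ℂ} (hres : ∀ j : ℕ, mu - lam ≠ (j : ℂ) / 2) {k : ℕ}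
    {R : Gr k →ₗ[ℂ] Op}
    (hR : ∀ f ∈ oddGenerators, ∀ s, R (grAction lam mu f k s) = opAction lam mu f (R s)) (j : ℕ)
    (hj : j ≤ k) (hm : ∀ s, R s ∈ prevDiffOps j) (s : Gr k) : R s = 0 := by
  induction j with
  | zero => exact hm s
  | succ j ih =>
    refine ih (by omega) fun s => ?_
    set Ψ : Gr k →ₗ[ℂ] Gr j := principalSymbol j ∘ₗ R.codRestrict (diffOps j) hm
    have hΨ (f) (hf : f ∈ oddGenerators) (s) :
        Ψ (grAction lam mu f k s) = grAction lam mu f j (Ψ s) :=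
      congrArg (principalSymbol j) (Subtype.ext (hR f hf s))
    obtain ⟨c1, c2, c3⟩ := weights_of_nonresonant hres (show j < k by omega)
    have h0 : coords j ∘ₗ Ψ ∘ₗ topSymbol k = 0 :=
      intertwiner_eq_zero (w := mu - lam - k / 2) (ε := (k % 2 : ℕ)) (w' := mu - lam - j / 2)
        (ε' := (j % 2 : ℕ)) (fun f hf F => by
          simp only [LinearMap.comp_apply]
          rw [← grAction_topSymbol hres hf, hΨ f hf, coords_grAction hres hf]) c1 c2 c3
    have h1 : principalSymbol j ⟨R s, hm s⟩ = principalSymbol j 0 := by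
      change Ψ s = _
      obtain ⟨F, rfl⟩ := exists_topSymbol s
      rw [← topSymbol_coords (Ψ (topSymbol k F)), map_zero (principalSymbol j)]
      have : coords j (Ψ (topSymbol k F)) = 0 := LinearMap.congr_fun h0 F
      rw [this, map_zero]
    simpa using (principalSymbol_eq_iff _ _).1 h1

theorem oddGenerators_subset : oddGenerators ⊆ (ospHamiltonians : Set SuperFun) := by
  rintro f (rfl | rfl | rfl | rfl) <;> exact Submodule.subset_span (by simp)

/-- Two equivariant quantization maps are equal: on symbols of contact order `k/2` they differ by an
equivariant map into operators of smaller contact order. -/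
theorem quantization_unique {lam mu : ℂ} (hres : ∀ j : ℕ, mu - lam ≠ (j : ℂ) / 2)
    {Q Q' : Symbols →ₗ[ℂ] allDiffOps} (hQ : IsQuantizationMap Q) (hQ' : IsQuantizationMap Q')
    (hE : IsOspEquivariant lam mu Q) (hE' : IsOspEquivariant lam mu Q') : Q' = Q := by
  refine DirectSum.linearMap_ext ℂ fun k => LinearMap.ext fun s => Subtype.ext ?_
  set R : Gr k →ₗ[ℂ] Op := allDiffOps.subtype ∘ₗ (Q' - Q) ∘ₗ DirectSum.lof ℂ ℕ Gr k
  have h : R s = 0 := by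
    refine eq_zero_of_equivariant hres (fun f hf s => ?_) k le_rfl (fun s => ?_) s
    · have h1 := hE f (oddGenerators_subset hf) (DirectSum.lof ℂ ℕ Gr k s)
      have h2 := hE' f (oddGenerators_subset hf) (DirectSum.lof ℂ ℕ Gr k s)
      rw [symbolAction_lof] at h1 h2
      change (Q' _ : Op) - Q _ = opAction lam mu f ((Q' _ : Op) - Q _)
      rw [h1, h2, map_sub]
    · obtain ⟨_, h1⟩ := hQ.2 k s
      obtain ⟨_, h2⟩ := hQ'.2 k s
      exact (principalSymbol_eq_iff _ _).1 (h2.trans h1.symm)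
  exact sub_eq_zero.1 h

/-! ### The explicit formula -/

theorem symbolInt_eq (K : ℕ) (F₁ F₂ : SuperFun) :
    symbolInt K F₁ F₂ = DirectSum.lof ℂ ℕ Gr (2 * K) (topSymbol (2 * K) (F₁, F₂)) :=
  congrArg (fun A => DirectSum.lof ℂ ℕ Gr (2 * K) (principalSymbol (2 * K) A))
    (Subtype.ext (topPair_even K (F₁, F₂)).symm)

theorem symbolHalf_eq (K : ℕ) (F₁ F₂ : SuperFun) :
    symbolHalf K F₁ F₂ = DirectSum.lof ℂ ℕ Gr (2 * K + 1) (topSymbol (2 * K + 1) (F₁, F₂)) :=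
  congrArg (fun A => DirectSum.lof ℂ ℕ Gr (2 * K + 1) (principalSymbol (2 * K + 1) A))
    (Subtype.ext (topPair_odd K (F₁, F₂)).symm)

theorem quantMap_symbolInt {lam mu : ℂ} (hres : ∀ j : ℕ, mu - lam ≠ (j : ℂ) / 2) (K p : ℕ)
    {F₁ F₂ : SuperFun} (h₁ : HasParity F₁ p) (h₂ : HasParity F₂ p) :
    (quantMap hres (symbolInt K F₁ F₂) : Op) = quantIntCancelled lam mu K p F₁ F₂ := by
  rw [symbolInt_eq, quantMap_lof, quantGr_topSymbol, quantPair_even, intQuant_apply,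
    quantIntCancelled]
  refine Finset.sum_congr rfl fun q _ => ?_
  have h₁' : parityInv F₁ = (-1 : ℂ) ^ p • F₁ := h₁
  have h₂' : parityInv F₂ = (-1 : ℂ) ^ p • F₂ := h₂
  simp only [intTerm, pairing, h₁', h₂', map_smul, intα, intβ, intγ, intε, intu, intv, mulOp_neg,
    mulOp_add, mulOp_sub, mulOp_smul, neg_mul, add_mul, sub_mul, smul_mul_assoc, pow_succ]
  module

theorem quantMap_symbolHalf {lam mu : ℂ} (hres : ∀ j : ℕ, mu - lam ≠ (j : ℂ) / 2) (K p : ℕ)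
    {F₁ F₂ : SuperFun} (h₁ : HasParity F₁ p) (h₂ : HasParity F₂ p) :
    (quantMap hres (symbolHalf K F₁ F₂) : Op) = quantHalfCancelled lam mu K p F₁ F₂ := by
  rw [symbolHalf_eq, quantMap_lof, quantGr_topSymbol, quantPair_odd, halfQuant_apply,
    quantHalfCancelled]
  refine Finset.sum_congr rfl fun q _ => ?_
  have h₁' : parityInv F₁ = (-1 : ℂ) ^ p • F₁ := h₁
  have h₂' : parityInv F₂ = (-1 : ℂ) ^ p • F₂ := h₂
  simp only [halfTerm, pairing, h₁', h₂', map_smul, halfα, halfβ, halfg, halfc, halfe,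
    mulOp_add, mulOp_sub, mulOp_smul, add_mul, sub_mul, smul_mul_assoc, Int.cast_natCast]
  module

/-- A sum over `n < 2K` as a sum over `n = 2q` and `n = 2q + 1` with `q < K`. -/
theorem sum_range_two_mul {M : Type*} [AddCommMonoid M] (f : ℕ → M) (K : ℕ) :
    ∑ n ∈ Finset.range (2 * K), f n
      = ∑ q ∈ Finset.range K, (f (2 * q) + f (2 * q + 1)) := by
  induction K with
  | zero => simp
  | succ K ih =>
    rw [show 2 * (K + 1) = 2 * K + 1 + 1 by ring, Finset.sum_range_succ, Finset.sum_range_succ, ih,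
      Finset.sum_range_succ, add_assoc]

section

variable (lam mu : ℂ) (K q : ℕ)

theorem quantCoeff_even_even : quantCoeff lam mu (2 * K) (2 * q)
    = gbinom K q * gbinom (K - 1 + 2 * lam) q / gbinom (2 * K - 2 * (mu - lam)) q := by
  have h1 : ((2 * K : ℕ) : ℤ) / 2 = K := by omega
  have h2 : (((2 * K : ℕ) : ℤ) - 1) / 2 = (K : ℤ) - 1 := by omega
  have h3 : (2 * ((2 * q : ℕ) : ℤ) + 1 + 1) / 4 = q := by omega
  have h4 : (2 * ((2 * q : ℕ) : ℤ) + 1 - 1) / 4 = q := by omega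
  have h5 : (((2 * q : ℕ) : ℤ) + 1) / 2 = q := by omega
  rw [quantCoeff, Even.neg_one_pow (even_two_mul K), h1, h2, h3, h4, h5]
  push_cast
  rfl

theorem quantCoeff_even_odd : quantCoeff lam mu (2 * K) (2 * q + 1)
    = gbinom K (q + 1) * gbinom (K - 1 + 2 * lam) q / gbinom (2 * K - 2 * (mu - lam)) (q + 1) := by
  have h1 : ((2 * K : ℕ) : ℤ) / 2 = K := by omega
  have h2 : (((2 * K : ℕ) : ℤ) - 1) / 2 = (K : ℤ) - 1 := by omega
  have h3 : (2 * ((2 * q + 1 : ℕ) : ℤ) + 1 + 1) / 4 = q + 1 := by omega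
  have h4 : (2 * ((2 * q + 1 : ℕ) : ℤ) + 1 - 1) / 4 = q := by omega
  have h5 : (((2 * q + 1 : ℕ) : ℤ) + 1) / 2 = q + 1 := by omega
  rw [quantCoeff, Even.neg_one_pow (even_two_mul K), h1, h2, h3, h4, h5]
  push_cast
  rfl

theorem quantCoeff_odd_even : quantCoeff lam mu (2 * K + 1) (2 * q)
    = gbinom K q * gbinom (K + 2 * lam) q / gbinom (2 * K + 1 - 2 * (mu - lam)) q := by
  have h1 : ((2 * K + 1 : ℕ) : ℤ) / 2 = K := by omega
  have h2 : (((2 * K + 1 : ℕ) : ℤ) - 1) / 2 = (K : ℤ) := by omega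
  have h3 : (2 * ((2 * q : ℕ) : ℤ) + 1 + -1) / 4 = q := by omega
  have h4 : (2 * ((2 * q : ℕ) : ℤ) + 1 - -1) / 4 = q := by omega
  have h5 : (((2 * q : ℕ) : ℤ) + 1) / 2 = q := by omega
  rw [quantCoeff, Odd.neg_one_pow (odd_two_mul_add_one K), h1, h2, h3, h4, h5]
  push_cast
  rfl

theorem quantCoeff_odd_odd : quantCoeff lam mu (2 * K + 1) (2 * q + 1)
    = gbinom K q * gbinom (K + 2 * lam) (q + 1)
      / gbinom (2 * K + 1 - 2 * (mu - lam)) (q + 1) := by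
  have h1 : ((2 * K + 1 : ℕ) : ℤ) / 2 = K := by omega
  have h2 : (((2 * K + 1 : ℕ) : ℤ) - 1) / 2 = (K : ℤ) := by omega
  have h3 : (2 * ((2 * q + 1 : ℕ) : ℤ) + 1 + -1) / 4 = q := by omega
  have h4 : (2 * ((2 * q + 1 : ℕ) : ℤ) + 1 - -1) / 4 = q + 1 := by omega
  have h5 : (((2 * q + 1 : ℕ) : ℤ) + 1) / 2 = q + 1 := by omega
  rw [quantCoeff, Odd.neg_one_pow (odd_two_mul_add_one K), h1, h2, h3, h4, h5]
  push_cast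
  rfl

end

/-! ### Cancellation of the denominators -/

theorem mul_gbinom_sub_one (z : ℂ) (m : ℤ) : z * gbinom (z - 1) m = (z - m) * gbinom z m := by
  rcases lt_or_ge m 0 with h | h
  · simp [gbinom_neg _ h]
  · lift m to ℕ using h
    induction m with
    | zero => simp [gbinom_zero]
    | succ m ih =>
      have h0 : ((m : ℂ) + 1) ≠ 0 := Nat.cast_add_one_ne_zero m
      have h1 := succ_mul_gbinom_succ z m
      have h2 := succ_mul_gbinom_succ (z - 1) m
      push_cast at h1 h2 ih ⊢
      apply mul_left_cancel₀ h0
      linear_combination z * h2 + (z - 1 - m) * ih - (z - (m + 1)) * h1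

theorem mul_gbinom_sub_one_sub_one (z : ℂ) (m : ℤ) :
    z * gbinom (z - 1) (m - 1) = m * gbinom z m := by
  have h := mul_gbinom_sub_one z (m - 1)
  push_cast at h
  linear_combination h - mul_gbinom z m

theorem smul_pairing (z : ℂ) (G : SuperFun × SuperFun) (d : Op × Op) :
    z • pairing G d = pairing (z • G) d := by
  simp only [pairing, Prod.smul_fst, Prod.smul_snd, mulOp_smul, smul_mul_assoc, smul_add]

section

variable {lam mu : ℂ} {K q : ℕ}

/-- The term with `n = 2q` of `quantInt` is the corresponding term of the cancelled form. -/
theorem quantInt_term_even (hres : ∀ j : ℕ, mu - lam ≠ (j : ℂ) / 2)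
    (hlam : ∀ j : ℕ, j ≤ K → (j : ℂ) + 2 * lam ≠ 0) (hK : 1 ≤ K) (hq : q ≤ K) (p : ℕ)
    (F₁ F₂ : SuperFun) :
    quantCoeff lam mu (2 * K) (2 * q) •
        pairing (DIVInt lam mu K p (2 * q) F₁ F₂) (divInt K (2 * q))
      = pairing
          (intα lam (2 * K - 2 * (mu - lam)) K q • dxPow q F₁
              + intβ lam (2 * K - 2 * (mu - lam)) K q • dxPow (q - 1) (Dbar1 (Dbar2 F₂)),
            intγ lam (2 * K - 2 * (mu - lam)) K q • dxPow q F₂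
              - intε lam (2 * K - 2 * (mu - lam)) K q • dxPow (q - 1) (Dbar1 (Dbar2 F₁)))
          (dxPow (K - q), dxPow (K - q - 1) * Dbar1 * Dbar2) := by
  have hd : divInt K (2 * q) = (dxPow (K - q), dxPow (K - q - 1) * Dbar1 * Dbar2) := by
    simp [divInt]
  rw [smul_pairing, hd, quantCoeff_even_even]
  congr 1
  have hN := even_ne_of_nonresonant hres K
  set N : ℂ := 2 * K - 2 * (mu - lam) with hNdef
  have hg0 : gbinom N q ≠ 0 := gbinom_ne_zero_of_le hN (by omega) (by omega)
  have hg1 : gbinom N (q + 1) ≠ 0 := gbinom_ne_zero_of_le hN (by omega) (by omega)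
  have hNq : N - q ≠ 0 := sub_ne_zero.2 (hN q hq)
  have hK0 : (K : ℂ) ≠ 0 := Nat.cast_ne_zero.2 (by omega)
  have hl : (K - q + 2 * lam : ℂ) ≠ 0 := by simpa [Nat.cast_sub hq] using hlam (K - q) (by omega)
  have ht : 2 * (mu - lam) + q - 2 * K = -(N - q) := by rw [hNdef]; ring
  have a1 : (K : ℂ) * gbinom (K - 1) (q - 1) = q * gbinom K q := by
    simpa using mul_gbinom_sub_one_sub_one K q
  have a2 : (K : ℂ) * gbinom (K - 1) q = (K - q) * gbinom K q := by
    simpa using mul_gbinom_sub_one K q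
  have a3 : (K + 2 * lam) * gbinom (K - 1 + 2 * lam) q
      = (K + 2 * lam - q) * gbinom (K + 2 * lam) q := by
    have := mul_gbinom_sub_one (K + 2 * lam) q
    rwa [add_sub_right_comm, Int.cast_natCast] at this
  have b1 := intβ_mul (lam := lam) (K := K) hg0 hg1
  have b2 := intε_mul (lam := lam) (K := K) hg0 hg1
  have b3 := intα_mul (lam := lam) (N := N) (K := K) (q := q)
  have b4 : intv lam N K (q - 1)
      = gbinom (K - 1) (q - 1) * gbinom (K + 2 * lam) q / gbinom N q := by
    rw [intv, sub_add_cancel]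
  rw [Int.cast_natCast] at b1 b2 b3
  change _ • (DIVInt lam mu K p (2 * q) F₁ F₂) = _
  have hα : intα lam N K q = gbinom K q * gbinom (K - 1 + 2 * lam) q / gbinom N q := rfl
  have hβ : intα lam N K q * ((K + 2 * lam) * q / (K * -(N - q))) = -intβ lam N K q := by
    rw [b4] at b1
    rw [hα, mul_div_assoc', div_eq_iff (mul_ne_zero hK0 (neg_ne_zero.2 hNq))]
    linear_combination gbinom K q * q / gbinom N q * a3
      - (K + 2 * lam - q) * gbinom (K + 2 * lam) q / gbinom N q * a1 - K * b1
  have hγ : intα lam N K q * ((K + 2 * lam) * (K - q) / (K * (K - q + 2 * lam)))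
      = intγ lam N K q := by
    rw [hα, intγ, mul_div_assoc', div_eq_iff (mul_ne_zero hK0 hl)]
    linear_combination gbinom K q * (K - q) / gbinom N q * a3
      - (K + 2 * lam - q) * gbinom (K + 2 * lam) q / gbinom N q * a2
  have hε : intα lam N K q * (q * (K - q) / (-(N - q) * (K - q + 2 * lam))) = -intε lam N K q := by
    rw [mul_div_assoc', div_eq_iff (mul_ne_zero (neg_ne_zero.2 hNq) hl)]
    linear_combination (K - q) * b3 - (K - q + 2 * lam) * b2
  rw [← hα]
  have hDIV : DIVInt lam mu K p (2 * q) F₁ F₂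
      = (dxPow q F₁ - ((K + 2 * lam) * q / (K * -(N - q))) • dxPow ((q : ℤ) - 1) (Dbar1 (Dbar2 F₂)),
      ((K + 2 * lam) * (K - q) / (K * (K - q + 2 * lam))) • dxPow q F₂
        + (q * (K - q) / (-(N - q) * (K - q + 2 * lam))) •
          dxPow ((q : ℤ) - 1) (Dbar1 (Dbar2 F₁))) := by
    simp [DIVInt, ht]
  rw [hDIV]
  ext1
  · simp only [Prod.smul_fst, smul_sub, smul_smul, hβ]
    module
  · simp only [Prod.smul_snd, smul_add, smul_smul, hγ, hε]
    module

theorem quantInt_term_odd (hK : 1 ≤ K) (p : ℕ) (F₁ F₂ : SuperFun) :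
    quantCoeff lam mu (2 * K) (2 * q + 1) •
        pairing (DIVInt lam mu K p (2 * q + 1) F₁ F₂) (divInt K (2 * q + 1))
      = (-1 : ℂ) ^ (p + 1) • pairing
          (intu lam (2 * K - 2 * (mu - lam)) K q • dxPow q (Dbar1 F₁)
              + intv lam (2 * K - 2 * (mu - lam)) K q • dxPow q (Dbar2 F₂),
            intu lam (2 * K - 2 * (mu - lam)) K q • dxPow q (Dbar2 F₁)
              - intv lam (2 * K - 2 * (mu - lam)) K q • dxPow q (Dbar1 F₂))
          (dxPow (K - q - 1) * Dbar1, dxPow (K - q - 1) * Dbar2) := by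
  have hq2 : (2 * q + 1) / 2 = q := by omega
  have hq2' : (2 * (q : ℤ) + 1) / 2 = q := by omega
  have hd : divInt K (2 * q + 1) = (dxPow (K - q - 1) * Dbar1, dxPow (K - q - 1) * Dbar2) := by
    simp [divInt, hq2', Nat.add_mod]
  rw [smul_pairing, smul_pairing, hd, quantCoeff_even_odd]
  congr 1
  set N : ℂ := 2 * K - 2 * (mu - lam) with hNdef
  have hK0 : (K : ℂ) ≠ 0 := Nat.cast_ne_zero.2 (by omega)
  have hq0 : ((q : ℂ) + 1) ≠ 0 := Nat.cast_add_one_ne_zero q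
  have a1 : (K : ℂ) * gbinom (K - 1) q = (q + 1) * gbinom K (q + 1) := by
    simpa using mul_gbinom_sub_one_sub_one K (q + 1)
  have a3 : (K + 2 * lam) * gbinom (K - 1 + 2 * lam) q
      = (q + 1) * gbinom (K + 2 * lam) (q + 1) := by
    have := mul_gbinom_sub_one_sub_one (K + 2 * lam) (q + 1)
    rw [add_sub_right_comm, add_sub_cancel_right] at this
    simpa using this
  have hu : gbinom K (q + 1) * gbinom (K - 1 + 2 * lam) q / gbinom N (q + 1) = intu lam N K q := rfl
  have hv : intu lam N K q * ((K + 2 * lam) / K) = intv lam N K q := by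
    rw [intu, intv, div_mul_div_comm, mul_comm (gbinom N _), ← div_div]
    congr 1
    rw [div_eq_iff hK0]
    apply mul_left_cancel₀ hq0
    linear_combination (q + 1) * gbinom K (q + 1) * a3 - (q + 1) * gbinom (K + 2 * lam) (q + 1) * a1
  rw [hu]
  have hDIV : DIVInt lam mu K p (2 * q + 1) F₁ F₂
      = (-1 : ℂ) ^ (p + 1) • (((K + 2 * lam) / K) • dxPow q (Dbar2 F₂) + dxPow q (Dbar1 F₁),
        dxPow q (Dbar2 F₁) - ((K + 2 * lam) / K) • dxPow q (Dbar1 F₂)) := by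
    simp [DIVInt, hq2, Nat.add_mod]
  rw [hDIV, smul_comm]
  congr 1
  ext1
  · simp only [Prod.smul_fst, smul_add, smul_smul, hv]
    module
  · simp only [Prod.smul_snd, smul_sub, smul_smul, hv]

theorem quantHalf_term_even (hres : ∀ j : ℕ, mu - lam ≠ (j : ℂ) / 2) (hq : q ≤ K) (p : ℕ)
    (F₁ F₂ : SuperFun) :
    quantCoeff lam mu (2 * K + 1) (2 * q) •
        pairing (DIVHalf lam mu K p (2 * q) F₁ F₂) (divHalf K (2 * q))
      = halfg lam (2 * K + 1 - 2 * (mu - lam)) K q • pairing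
          (((2 * K + 1 - 2 * (mu - lam) - q - 1) / (2 * K + 1 - 2 * (mu - lam) - q)) • dxPow q F₁
              + (q / (2 * K + 1 - 2 * (mu - lam) - q)) • dxPow (q - 1) (Dbar1 (Dbar2 F₂)),
            ((2 * K + 1 - 2 * (mu - lam) - q - 1) / (2 * K + 1 - 2 * (mu - lam) - q)) • dxPow q F₂
              - (q / (2 * K + 1 - 2 * (mu - lam) - q)) • dxPow (q - 1) (Dbar1 (Dbar2 F₁)))
          (dxPow (K - q) * Dbar1, dxPow (K - q) * Dbar2) := by
  have hd : divHalf K (2 * q) = (dxPow (K - q) * Dbar1, dxPow (K - q) * Dbar2) := by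
    simp [divHalf]
  rw [smul_pairing, smul_pairing, hd, quantCoeff_odd_even]
  congr 1
  have hN := odd_ne_of_nonresonant hres K
  set N : ℂ := 2 * K + 1 - 2 * (mu - lam) with hNdef
  have hNq : N - q ≠ 0 := sub_ne_zero.2 (hN q (by omega))
  have hr : (2 * (mu - lam) - (2 * K + 1)) / (2 * (mu - lam) - 2 * K) = N / (N - 1) := by
    rw [show 2 * (mu - lam) - (2 * K + 1) = -N by rw [hNdef]; ring,
      show 2 * (mu - lam) - 2 * K = -(N - 1) by rw [hNdef]; ring, neg_div_neg_eq]
  have ht : 2 * (mu - lam) + q - (2 * K + 1) = -(N - q) := by rw [hNdef]; ring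
  have ht' : 2 * (mu - lam) + q - 2 * K = -(N - q - 1) := by rw [hNdef]; ring
  have hDIV : DIVHalf lam mu K p (2 * q) F₁ F₂
      = (N / (N - 1)) • (((N - q - 1) / (N - q)) • dxPow q F₁
              + (q / (N - q)) • dxPow (q - 1) (Dbar1 (Dbar2 F₂)),
            ((N - q - 1) / (N - q)) • dxPow q F₂
              - (q / (N - q)) • dxPow (q - 1) (Dbar1 (Dbar2 F₁))) := by
    have hq2 : 2 * q / 2 = q := by omega
    simp only [DIVHalf, hr]
    rw [if_neg (by omega), hq2, ht, ht', neg_div_neg_eq, div_neg]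
    ext1 <;> simp [sub_eq_add_neg]
  rw [hDIV, smul_smul]
  congr 1
  rw [halfg]
  ring

theorem quantHalf_term_odd (hlam : ∀ j : ℕ, j ≤ K → (j : ℂ) + 2 * lam ≠ 0) (hq : q ≤ K) (p : ℕ)
    (F₁ F₂ : SuperFun) :
    quantCoeff lam mu (2 * K + 1) (2 * q + 1) •
        pairing (DIVHalf lam mu K p (2 * q + 1) F₁ F₂) (divHalf K (2 * q + 1))
      = (-1 : ℂ) ^ p • pairing
          (halfc lam (2 * K + 1 - 2 * (mu - lam)) K q • (dxPow q (Dbar1 F₁) + dxPow q (Dbar2 F₂)),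
            halfe lam (2 * K + 1 - 2 * (mu - lam)) K q • (dxPow q (Dbar2 F₁) - dxPow q (Dbar1 F₂)))
          (dxPow (K - q), dxPow (K - q - 1) * Dbar1 * Dbar2) := by
  have hq2 : (2 * q + 1) / 2 = q := by omega
  have hq2' : (2 * (q : ℤ) + 1) / 2 = q := by omega
  have hd : divHalf K (2 * q + 1) = (dxPow (K - q), dxPow (K - q - 1) * Dbar1 * Dbar2) := by
    simp [divHalf, hq2', Nat.add_mod]
  rw [smul_pairing, smul_pairing, hd, quantCoeff_odd_odd]
  congr 1
  set N : ℂ := 2 * K + 1 - 2 * (mu - lam) with hNdef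
  have hl : (K - q + 2 * lam : ℂ) ≠ 0 := by simpa [Nat.cast_sub hq] using hlam (K - q) (by omega)
  have hr : (2 * (mu - lam) - (2 * K + 1)) / (2 * (mu - lam) - 2 * K) = N / (N - 1) := by
    rw [show 2 * (mu - lam) - (2 * K + 1) = -N by rw [hNdef]; ring,
      show 2 * (mu - lam) - 2 * K = -(N - 1) by rw [hNdef]; ring, neg_div_neg_eq]
  have a1 := succ_mul_gbinom_succ (K : ℂ) q
  have a2 := succ_mul_gbinom_succ (K + 2 * lam) q
  rw [Int.cast_natCast] at a1 a2
  have hq0 : ((q : ℂ) + 1) ≠ 0 := Nat.cast_add_one_ne_zero q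
  have hc : gbinom K q * gbinom (K + 2 * lam) (q + 1) / gbinom N (q + 1) * (N / (N - 1))
      = halfc lam N K q := by rw [halfc]; ring
  have he : halfc lam N K q * ((K - q) / (K - q + 2 * lam)) = halfe lam N K q := by
    rw [halfc, halfe, div_mul_div_comm, mul_comm (gbinom N _), ← div_div]
    congr 1
    rw [div_eq_iff hl]
    apply mul_left_cancel₀ hq0
    linear_combination N / (N - 1) * (gbinom K q * (K - q) * a2
      - gbinom (K + 2 * lam) q * (K - q + 2 * lam) * a1)
  have hDIV : DIVHalf lam mu K p (2 * q + 1) F₁ F₂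
      = ((-1 : ℂ) ^ p * (N / (N - 1))) • (dxPow q (Dbar1 F₁) + dxPow q (Dbar2 F₂),
        ((K - q) / (K - q + 2 * lam) : ℂ) • (dxPow q (Dbar2 F₁) - dxPow q (Dbar1 F₂))) := by
    simp only [DIVHalf, hr]
    simp [hq2, Nat.add_mod, smul_smul, add_comm (dxPow q (Dbar1 F₁))]
  rw [hDIV, smul_smul, ← mul_assoc, mul_right_comm, hc, mul_comm, mul_smul]
  congr 1
  ext1
  · rfl
  · simp only [Prod.smul_snd, smul_smul, he]

theorem quantInt_eq_cancelled (hres : ∀ j : ℕ, mu - lam ≠ (j : ℂ) / 2)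
    (hlam : ∀ j : ℕ, j ≤ K → (j : ℂ) + 2 * lam ≠ 0) (hK : 1 ≤ K) (p : ℕ) (F₁ F₂ : SuperFun) :
    quantInt lam mu K p F₁ F₂ = quantIntCancelled lam mu K p F₁ F₂ := by
  -- The term with `n = 2K + 1` can be added, because it contains `∂ₓ^{-1}`.
  have hlast : quantCoeff lam mu (2 * K) (2 * K + 1) •
      pairing (DIVInt lam mu K p (2 * K + 1) F₁ F₂) (divInt K (2 * K + 1)) = 0 := by
    rw [quantInt_term_odd hK]
    simp [pairing, dxPow_neg]
  rw [quantInt, ← add_zero (Finset.sum _ _), ← hlast,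
    ← Finset.sum_range_succ (fun n => quantCoeff lam mu (2 * K) n •
      pairing (DIVInt lam mu K p n F₁ F₂) (divInt K n)),
    show 2 * K + 1 + 1 = 2 * (K + 1) by ring, sum_range_two_mul]
  refine Finset.sum_congr rfl fun q hq => ?_
  rw [Finset.mem_range] at hq
  rw [quantInt_term_even hres hlam hK (by omega), quantInt_term_odd hK]
  rfl

theorem quantHalf_eq_cancelled (hres : ∀ j : ℕ, mu - lam ≠ (j : ℂ) / 2)
    (hlam : ∀ j : ℕ, j ≤ K → (j : ℂ) + 2 * lam ≠ 0) (p : ℕ) (F₁ F₂ : SuperFun) :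
    quantHalf lam mu K p F₁ F₂ = quantHalfCancelled lam mu K p F₁ F₂ := by
  rw [quantHalf, show 2 * K + 2 = 2 * (K + 1) by ring, sum_range_two_mul]
  refine Finset.sum_congr rfl fun q hq => ?_
  rw [Finset.mem_range] at hq
  rw [quantHalf_term_even hres (by omega), quantHalf_term_odd hlam (by omega)]
  rfl

end

end SuperCircle

end

open SuperCircle in
/-- In the non-resonant case there is exactly one `osp(2|2)`-equivariant quantization map, among
all linear maps, and it is given by the explicit formula, for symbols of integer contact order `K`
and of half-integer contact order `K + 1/2`: in the form with the cancellations carried out, for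
all `λ`, and in the form `∑_n c_n DIV^n div^{k-n}` whenever no denominator vanishes. -/
theorem mainTheorem1 (lam mu : ℂ) (hres : ∀ j : ℕ, mu - lam ≠ (j : ℂ) / 2) :
    ∃ Q : Symbols →ₗ[ℂ] allDiffOps,
      (IsQuantizationMap Q ∧ IsOspEquivariant lam mu Q) ∧
      (∀ Q' : Symbols →ₗ[ℂ] allDiffOps,
        IsQuantizationMap Q' → IsOspEquivariant lam mu Q' → Q' = Q) ∧
      (∀ (K p : ℕ) (F₁ F₂ : SuperFun), HasParity F₁ p → HasParity F₂ p →
        (Q (symbolInt K F₁ F₂) : Op) = quantIntCancelled lam mu K p F₁ F₂ ∧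
        (Q (symbolHalf K F₁ F₂) : Op) = quantHalfCancelled lam mu K p F₁ F₂) ∧
      (∀ (K p : ℕ) (F₁ F₂ : SuperFun), HasParity F₁ p → HasParity F₂ p →
        (∀ j : ℕ, j ≤ K → (j : ℂ) + 2 * lam ≠ 0) →
        (1 ≤ K → (Q (symbolInt K F₁ F₂) : Op) = quantInt lam mu K p F₁ F₂) ∧
        (Q (symbolHalf K F₁ F₂) : Op) = quantHalf lam mu K p F₁ F₂) := by
  refine ⟨quantMap hres, ⟨isQuantizationMap_quantMap hres, isOspEquivariant_quantMap hres⟩,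
    fun Q' hQ' hE' => quantization_unique hres (isQuantizationMap_quantMap hres) hQ'
      (isOspEquivariant_quantMap hres) hE',
    fun K p F₁ F₂ h₁ h₂ => ⟨quantMap_symbolInt hres K p h₁ h₂, quantMap_symbolHalf hres K p h₁ h₂⟩,
    fun K p F₁ F₂ h₁ h₂ hlam => ⟨fun hK => ?_, ?_⟩⟩
  · rw [quantInt_eq_cancelled hres hlam hK, quantMap_symbolInt hres K p h₁ h₂]
  · rw [quantHalf_eq_cancelled hres hlam, quantMap_symbolHalf hres K p h₁ h₂]
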